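/- For $n\ge 1$ let $r_1(n)$ be the number of pairs $(a,p)$ with $a$ a positive integer, $p$ a prime and $n=a^2+p^2$, and let $\omega^*(n)$ be the number of distinct odd prime factors of $n$. Let $\delta=1-\frac{1+\log\log 2}{\log 2}$, and for real $x\ge 16$ put $L=\log\log x$ and $K=\lfloor \frac{\log\log x}{\log 2}\rfloor$. (1) There are constants $A,C$ such that for all real $x\ge 16$ $$\sum_{\substack{n\le x\\ \omega^*(n)\ge K}} r_1(n)\ \le\ C\,\frac{xL^{A}}{(\log x)^{1+\delta}} .$$ (2) For every integer $\ell\ge 2$ there are constants $A,C$, depending only on $\ell$, such that for every $B>0$, all real $x\ge 16$ and all integers $\tau$ with $0\le\tau\le B\log\log x$ $$\sum_{\substack{n\le x\\ \omega^*(n)\le K-\tau}} \binom{r_1(n)}{\ell}\ \le\ C\,\frac{xL^{A}}{(\log x)^{1+\delta}}\cdot\frac{1}{(2^{\ell-1}\log 2)^{\tau}} .$$ -/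

import Mathlib

namespace SquarePlusPrimeSquare

/-- The finite set of pairs `(a, p)` with `a > 0`, `p` prime and `n = a ^ 2 + p ^ 2`. -/
def reps (n : ℕ) : Finset (ℕ × ℕ) :=
  (Finset.range (n + 1) ×ˢ Finset.range (n + 1)).filter
    fun q => 0 < q.1 ∧ q.2.Prime ∧ q.1 ^ 2 + q.2 ^ 2 = n

/-- The bounding box in `reps` loses no representation. -/
theorem mem_reps {n a p : ℕ} :
    (a, p) ∈ reps n ↔ 0 < a ∧ p.Prime ∧ a ^ 2 + p ^ 2 = n := by
  simp only [reps, Finset.mem_filter, Finset.mem_product, Finset.mem_range,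
    and_iff_right_iff_imp]
  rintro ⟨_, _, h⟩
  constructor <;> nlinarith [Nat.le_self_pow two_ne_zero a, Nat.le_self_pow two_ne_zero p]

/-- `r₁(n)`, the number of representations `n = a ^ 2 + p ^ 2` with `a > 0` and `p` prime. -/
def r1 (n : ℕ) : ℕ := (reps n).card

/-- `ω*(n)`, the number of distinct odd prime factors of `n`. -/
def omegaStar (n : ℕ) : ℕ := (n.primeFactors.filter Odd).card

/-- The multiplication table constant `δ = 1 - (1 + log log 2) / log 2`. -/
noncomputable def delta : ℝ := 1 - (1 + Real.log (Real.log 2)) / Real.log 2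

/-- `L = log log x`. -/
noncomputable def L (x : ℝ) : ℝ := Real.log (Real.log x)

/-- `K = ⌊log log x / log 2⌋`. -/
noncomputable def K (x : ℝ) : ℤ := ⌊L x / Real.log 2⌋

end SquarePlusPrimeSquare

namespace SquarePlusPrimeSquare

/-! ### Mertens estimates -/

/-! A representation `n = a ^ 2 + p ^ 2` is a Gaussian integer `ξ = a + p i` of norm `n`, in the
open first quadrant, whose imaginary part is prime. Both estimates are Rankin bounds: the condition
on `ω*` is replaced by a weight `c ^ ω*(n)`, and the weighted sum is turned into a sum over tuples
of Gaussian factors.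

For (1), `2 ^ ω*(n)` is at most the number of Gaussian divisors of `ξ` (`two_pow_omegaStar_le`), so
`Σ r₁(n) (2z) ^ ω*(n)` is at most a sum of `z ^ ω*` over pairs `(α, β)` with `α β = ξ`
(`sum_r1_mul_le_tupleSum`). For (2), put `ℓ = m + 1`. The Gaussian integers `ξ 0, …, ξ m` of equal
norm are simultaneously products of `2 ^ m` common factors, each factor being conjugated or not in
each `ξ i`, up to units (`exists_simultaneous_factorization`). This bounds `Σ (r₁(n) choose ℓ) z ^
ω*(n)` by finitely many sums over `2 ^ m`-tuples (`exists_sum_choose_le_tupleSum`).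

The common estimate is `exists_tupleSum_le`. Apart from about `√x` tuples, one of the `k + 1`
factors has norm at least a fixed power of `x`. With the other factors fixed, of norm product `M`,
the imaginary parts of the `ξ i` are up to sign `ℓ` linear forms in the coordinates of the large
factor, pairwise independent because the `ξ i` are distinct points of the open first quadrant. A
two-dimensional sieve gives `(x / M) (log x) ^ (-ℓ - 1 + z)` up to a power of `L`: each prime form
saves a logarithm, and the weight `z ^ ω*` saves `1 - z` more. The remaining factors each contribute
`(log x) ^ z`, for a total of `x (log x) ^ ((k + 1) z - ℓ - 1)`.

Since powers of `L = log log x` may be lost, Brun's pure sieve suffices (`exists_sieveSum_le`). Its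
density needs Mertens' theorem and the boundedness of `Σ χ₄(p) / p`. The optimal `z` is `1 / (2 log
2)` in (1) and `1 / (2 ^ m log 2)` in (2); both lead to the exponent `-(1 + δ)`. -/

/-- Dirichlet's test, in the form of an explicit bound. -/
theorem abs_sum_mul_le_of_antitone {a w : ℕ → ℝ} {m : ℕ} {B : ℝ}
    (hB : ∀ k, |∑ i ∈ Finset.Ico m k, a i| ≤ B)
    (hw : ∀ i j, m ≤ i → i ≤ j → w j ≤ w i) (hw0 : ∀ i, m ≤ i → 0 ≤ w i) (n : ℕ) :
    |∑ i ∈ Finset.Ico m n, a i * w i| ≤ B * w m := by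
  have hB0 : 0 ≤ B := (abs_nonneg _).trans (hB m)
  rcases lt_or_ge n m with h | h
  · rw [Finset.Ico_eq_empty (by omega)]
    simpa using mul_nonneg hB0 (hw0 m le_rfl)
  have key : |∑ i ∈ Finset.Ico m n, a i * w i - (∑ i ∈ Finset.Ico m n, a i) * w n|
      ≤ B * (w m - w n) := by
    induction n, h using Nat.le_induction with
    | base => simp
    | succ n hn ih =>
      rw [Finset.sum_Ico_succ_top hn]
      have e : ∑ i ∈ Finset.Ico m n, a i * w i + a n * w n
            - (∑ i ∈ Finset.Ico m (n + 1), a i) * w (n + 1)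
          = (∑ i ∈ Finset.Ico m n, a i * w i - (∑ i ∈ Finset.Ico m n, a i) * w n)
            + (∑ i ∈ Finset.Ico m (n + 1), a i) * (w n - w (n + 1)) := by
        rw [Finset.sum_Ico_succ_top hn]; ring
      rw [e]
      have h1 : 0 ≤ w n - w (n + 1) := sub_nonneg.2 (hw _ _ hn (Nat.le_succ n))
      calc _ ≤ B * (w m - w n) + B * (w n - w (n + 1)) := by
            refine (abs_add_le _ _).trans (add_le_add ih ?_)
            rw [abs_mul, abs_of_nonneg h1]
            exact mul_le_mul_of_nonneg_right (hB _) h1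
        _ = _ := by ring
  have h2 : |(∑ i ∈ Finset.Ico m n, a i) * w n| ≤ B * w n := by
    rw [abs_mul, abs_of_nonneg (hw0 n h)]
    exact mul_le_mul_of_nonneg_right (hB n) (hw0 n h)
  rw [abs_le] at *
  constructor <;> linarith [key.1, key.2, h2.1, h2.2]

/-- The nontrivial character modulo `4`, as a real function. -/
noncomputable def chi (n : ℕ) : ℝ := ((ZMod.χ₄ (n : ZMod 4) : ℤ) : ℝ)

theorem chi_eq (n : ℕ) : chi n = if n % 2 = 0 then 0 else if n % 4 = 1 then 1 else -1 := by
  unfold chi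
  rw [ZMod.χ₄_nat_eq_if_mod_four]
  split_ifs <;> simp

theorem chi_mul (m n : ℕ) : chi (m * n) = chi m * chi n := by
  unfold chi
  rw [Nat.cast_mul, map_mul, Int.cast_mul]

theorem abs_chi_le (n : ℕ) : |chi n| ≤ 1 := by
  rw [chi_eq]; split_ifs <;> simp

theorem sum_range_chi (k : ℕ) :
    ∑ i ∈ Finset.range k, chi i = if k % 4 = 2 ∨ k % 4 = 3 then 1 else 0 := by
  induction k with
  | zero => simp
  | succ k ih =>
    rw [Finset.sum_range_succ, ih, chi_eq]
    have := Nat.mod_lt k (show 4 > 0 by norm_num)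
    split_ifs <;> first | omega | norm_num

theorem abs_sum_Ico_chi_le (m k : ℕ) : |∑ i ∈ Finset.Ico m k, chi i| ≤ 1 := by
  rcases le_total m k with h | h
  · rw [Finset.sum_Ico_eq_sub _ h, sum_range_chi, sum_range_chi]
    split_ifs <;> simp
  · rw [Finset.Ico_eq_empty_of_le h]; simp

theorem abs_sum_Ico_chi_div_le {m : ℕ} (hm : 1 ≤ m) (k : ℕ) :
    |∑ i ∈ Finset.Ico m k, chi i / i| ≤ 1 / m := by
  have := abs_sum_mul_le_of_antitone (a := chi) (w := fun i => 1 / (i : ℝ)) (m := m) (B := 1)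
    (abs_sum_Ico_chi_le m) (fun i j hi hij => by
      have : (0 : ℝ) < i := by exact_mod_cast (by omega : 0 < i)
      have h2 : (i : ℝ) ≤ j := by exact_mod_cast hij
      exact one_div_le_one_div_of_le this h2) (fun i _ => by positivity) k
  simpa [div_eq_mul_inv] using this

/-- The first term is `1` and the tail from `2` on is at most `1/2`. This elementary form of `L(1,
χ₄) ≠ 0` permits division by the partial sum later. -/
theorem half_le_sum_chi_div {N : ℕ} (hN : 1 ≤ N) :
    1 / 2 ≤ ∑ i ∈ Finset.Ico 1 (N + 1), chi i / i := by
  have h := abs_le.1 (abs_sum_Ico_chi_div_le (m := 2) (by norm_num) (N + 1))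
  rw [Finset.sum_eq_sum_Ico_succ_bot (by omega)]
  have : chi 1 = 1 := by rw [chi_eq]; norm_num
  rw [this]
  norm_num at h ⊢
  linarith [h.1]

theorem exists_abs_sum_chi_mul_log_div_le :
    ∃ C : ℝ, ∀ N : ℕ, |∑ i ∈ Finset.Ico 1 N, chi i * (Real.log i / i)| ≤ C := by
  -- The function `log t / t` decreases only from `e` on, so Dirichlet's test starts at `3`; the
  -- terms at `1` and `2` vanish because `log 1 = 0` and `chi 2 = 0`.
  have he : Real.exp 1 ≤ 3 := by linarith [Real.exp_one_lt_d9]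
  have h3 : ∀ N, |∑ i ∈ Finset.Ico 3 N, chi i * (Real.log i / i)| ≤ 1 * (Real.log (3 : ℕ) / (3 : ℕ)) :=
    fun N => abs_sum_mul_le_of_antitone (a := chi) (w := fun i => Real.log i / (i : ℝ)) (m := 3)
    (B := 1) (abs_sum_Ico_chi_le 3) (fun i j hi hij => by
      have h1 : (3 : ℝ) ≤ i := by exact_mod_cast hi
      have h2 : (i : ℝ) ≤ j := by exact_mod_cast hij
      exact Real.log_div_self_antitoneOn (Set.mem_Ici.2 (by linarith))
        (Set.mem_Ici.2 (by linarith)) h2) (fun i _ => by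
          have := Real.log_natCast_nonneg i
          positivity) N
  refine ⟨1 * (Real.log (3 : ℕ) / (3 : ℕ)), fun N => ?_⟩
  rcases le_or_gt 3 N with h | h
  · rw [Finset.sum_eq_sum_Ico_succ_bot (by omega), Finset.sum_eq_sum_Ico_succ_bot (by omega)]
    have : chi 2 = 0 := by rw [chi_eq]; norm_num
    have h3 := h3 N
    simpa [this] using h3
  · have h0 : 0 ≤ Real.log 3 := Real.log_nonneg (by norm_num)
    interval_cases N
    · simp; positivity
    · simp; positivity
    · norm_num; positivity

open ArithmeticFunction in
-- Since `log = Λ * 1` as a Dirichlet convolution and `f` is completely multiplicative, `f log = (f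
-- Λ) * f`.
theorem sum_Ioc_log_mul (f : ℕ → ℝ) (hf : ∀ m n, f (m * n) = f m * f n) (N : ℕ) :
    ∑ n ∈ Finset.Ioc 0 N, f n * Real.log n =
      ∑ d ∈ Finset.Ioc 0 N, f d * vonMangoldt d * ∑ m ∈ Finset.Ioc 0 (N / d), f m := by
  let F : ArithmeticFunction ℝ := ⟨fun n => if n = 0 then 0 else f n * vonMangoldt n, by simp⟩
  let G : ArithmeticFunction ℝ := ⟨fun n => if n = 0 then 0 else f n, by simp⟩
  have h := sum_Ioc_mul_eq_sum_sum F G N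
  have hl : ∑ n ∈ Finset.Ioc 0 N, (F * G) n = ∑ n ∈ Finset.Ioc 0 N, f n * Real.log n := by
    refine Finset.sum_congr rfl fun n hn => ?_
    have hn0 : n ≠ 0 := by simp at hn; omega
    rw [ArithmeticFunction.mul_apply, ← vonMangoldt_sum, Finset.mul_sum,
      ← Nat.sum_divisorsAntidiagonal (fun i _ => f n * vonMangoldt i)]
    refine Finset.sum_congr rfl fun p hp => ?_
    rw [Nat.mem_divisorsAntidiagonal] at hp
    have h1 : p.1 ≠ 0 := by rintro h; simp [h] at hp; omega
    have h2 : p.2 ≠ 0 := by rintro h; simp [h] at hp; omega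
    simp only [F, G, ArithmeticFunction.coe_mk, h1, h2, if_false]
    rw [← hp.1, hf]; ring
  rw [← hl, h]
  refine Finset.sum_congr rfl fun n hn => ?_
  have hn0 : n ≠ 0 := by simp at hn; omega
  simp only [F, G, ArithmeticFunction.coe_mk, hn0, if_false]
  congr 1
  refine Finset.sum_congr rfl fun m hm => ?_
  have hm0 : m ≠ 0 := by simp at hm; omega
  simp [hm0]

open ArithmeticFunction in
theorem sum_Ioc_vonMangoldt_le (N : ℕ) :
    ∑ d ∈ Finset.Ioc 0 N, vonMangoldt d ≤ (Real.log 4 + 4) * N := by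
  simpa [Chebyshev.psi] using Chebyshev.psi_le_const_mul_self (x := N) (Nat.cast_nonneg N)

theorem Ioc_zero_eq_Ico (N : ℕ) : Finset.Ioc 0 N = Finset.Ico 1 (N + 1) := by
  ext; simp; omega

open ArithmeticFunction in
-- Mertens' argument for `L(1, χ)`. In `Σ χ(n) log n / n = Σ χ(d) Λ(d) / d · S(N / d)`, replacing
-- `S(N / d)` by `S(N)` costs at most `d / N` per term, hence a bounded amount by Chebyshev's
-- estimate; then `S(N) ≥ 1/2` is divided out.
theorem exists_abs_sum_chi_mul_vonMangoldt_le :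
    ∃ C : ℝ, ∀ N : ℕ, |∑ d ∈ Finset.Ioc 0 N, chi d * (vonMangoldt d / d)| ≤ C := by
  obtain ⟨C, hC⟩ := exists_abs_sum_chi_mul_log_div_le
  refine ⟨2 * (C + (Real.log 4 + 4)), fun N => ?_⟩
  rcases Nat.eq_zero_or_pos N with rfl | hN
  · have := (abs_nonneg _).trans (hC 0)
    have h4 : 0 ≤ Real.log 4 := Real.log_nonneg (by norm_num)
    simp; positivity
  have hNr : (0 : ℝ) < N := by exact_mod_cast hN
  set S : ℕ → ℝ := fun k => ∑ m ∈ Finset.Ioc 0 k, chi m / m with hS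
  have h1 := sum_Ioc_log_mul (fun n => chi n / n) (fun m n => by
    simp only [chi_mul, Nat.cast_mul]; rw [mul_div_mul_comm]) N
  have h2 : |∑ n ∈ Finset.Ioc 0 N, chi n / n * Real.log n| ≤ C := by
    rw [Ioc_zero_eq_Ico]
    refine le_of_eq_of_le ?_ (hC (N + 1))
    congr 1
    exact Finset.sum_congr rfl fun i _ => by ring
  have hSN : 1 / 2 ≤ S N := by
    simp only [hS]; rw [Ioc_zero_eq_Ico]; exact half_le_sum_chi_div hN
  have hdiff : ∀ d ∈ Finset.Ioc 0 N, |S N - S (N / d)| ≤ d / N := by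
    intro d hd
    rw [Finset.mem_Ioc] at hd
    have hle : N / d ≤ N := Nat.div_le_self _ _
    have e : S N - S (N / d) = ∑ i ∈ Finset.Ico (N / d + 1) (N + 1), chi i / i := by
      simp only [hS]
      rw [Ioc_zero_eq_Ico, Ioc_zero_eq_Ico, Finset.sum_Ico_eq_sub _ (by omega),
        Finset.sum_Ico_eq_sub _ (Nat.le_add_left 1 (N / d)), Finset.sum_Ico_eq_sub _ (by omega)]
      ring
    rw [e]
    refine (abs_sum_Ico_chi_div_le (Nat.le_add_left 1 (N / d)) _).trans ?_
    have hd0 : (0 : ℝ) < d := by exact_mod_cast hd.1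
    rw [div_le_div_iff₀ (by positivity) hNr]
    have := Nat.lt_mul_div_succ N hd.1
    rw [one_mul]
    exact_mod_cast this.le
  have e : (∑ d ∈ Finset.Ioc 0 N, chi d * (vonMangoldt d / d)) * S N =
      ∑ n ∈ Finset.Ioc 0 N, chi n / n * Real.log n +
      ∑ d ∈ Finset.Ioc 0 N, chi d * (vonMangoldt d / d) * (S N - S (N / d)) := by
    rw [h1, Finset.sum_mul, ← Finset.sum_add_distrib]
    refine Finset.sum_congr rfl fun d _ => ?_
    simp only [hS]; ring
  have h3 : |∑ d ∈ Finset.Ioc 0 N, chi d * (vonMangoldt d / d) * (S N - S (N / d))|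
      ≤ Real.log 4 + 4 := by
    refine (Finset.abs_sum_le_sum_abs _ _).trans ?_
    have : ∀ d ∈ Finset.Ioc 0 N, |chi d * (vonMangoldt d / d) * (S N - S (N / d))|
        ≤ vonMangoldt d / N := by
      intro d hd
      have hd0 : (0 : ℝ) < d := by rw [Finset.mem_Ioc] at hd; exact_mod_cast hd.1
      have hv : 0 ≤ vonMangoldt d / (d : ℝ) := div_nonneg vonMangoldt_nonneg hd0.le
      rw [abs_mul, abs_mul, abs_of_nonneg hv]
      calc _ ≤ 1 * (vonMangoldt d / (d : ℝ)) * (d / N) := by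
            gcongr
            · exact abs_chi_le d
            · exact hdiff d hd
        _ = _ := by field_simp
    refine (Finset.sum_le_sum this).trans ?_
    rw [← Finset.sum_div, div_le_iff₀ hNr]
    exact sum_Ioc_vonMangoldt_le N
  have h4 : |(∑ d ∈ Finset.Ioc 0 N, chi d * (vonMangoldt d / d)) * S N| ≤ C + (Real.log 4 + 4) := by
    rw [e]; exact (abs_add_le _ _).trans (add_le_add h2 h3)
  rw [abs_mul, abs_of_nonneg (by linarith : 0 ≤ S N)] at h4
  have := abs_nonneg (∑ d ∈ Finset.Ioc 0 N, chi d * (vonMangoldt d / d))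
  nlinarith

open ArithmeticFunction in
-- Mertens' first theorem: `log N! = Σ Λ(d) ⌊N / d⌋` is `N log N` up to `O(N)`, and Chebyshev's
-- bound controls the removal of the floors.
theorem exists_abs_sum_vonMangoldt_div_sub_log_le :
    ∃ C : ℝ, ∀ N : ℕ, |∑ d ∈ Finset.Ioc 0 N, vonMangoldt d / d - Real.log N| ≤ C := by
  refine ⟨Real.log 4 + 4, fun N => ?_⟩
  have hl4 : 0 ≤ Real.log 4 := Real.log_nonneg (by norm_num)
  rcases Nat.eq_zero_or_pos N with rfl | hN
  · simp; positivity
  have hNr : (0 : ℝ) < N := by exact_mod_cast hN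
  have h1 := sum_Ioc_log_mul (fun _ => 1) (by simp) N
  simp only [one_mul, Finset.sum_const, Nat.card_Ioc, Nat.sub_zero, nsmul_eq_mul, mul_one] at h1
  have hfac : ∑ n ∈ Finset.Ioc 0 N, Real.log n = Real.log (N.factorial) := by
    clear h1 hNr hN
    induction N with
    | zero => simp
    | succ N ih =>
      rw [Nat.factorial_succ, Nat.cast_mul, Real.log_mul (by positivity) (by positivity), ← ih,
        ← Finset.insert_Ioc_right_eq_Ioc_add_one (by omega),
        Finset.sum_insert (by simp)]
  rw [hfac] at h1
  have hup : Real.log N.factorial ≤ N * Real.log N := by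
    rw [← Real.log_pow]
    exact Real.log_le_log (by positivity) (by exact_mod_cast Nat.factorial_le_pow N)
  have hlo : N * Real.log N - N ≤ Real.log N.factorial := by
    have := Real.pow_div_factorial_le_exp (x := N) hNr.le N
    have h := Real.log_le_log (by positivity) this
    rw [Real.log_exp, Real.log_div (by positivity) (by positivity), Real.log_pow] at h
    linarith
  have hs1 : Real.log N.factorial ≤ N * ∑ d ∈ Finset.Ioc 0 N, vonMangoldt d / d := by
    rw [h1, Finset.mul_sum]
    refine Finset.sum_le_sum fun d hd => ?_
    have h : ((N / d : ℕ) : ℝ) ≤ (N : ℝ) / d := Nat.cast_div_le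
    calc _ ≤ vonMangoldt d * ((N : ℝ) / d) := mul_le_mul_of_nonneg_left h vonMangoldt_nonneg
      _ = _ := by ring
  have hs2 : N * ∑ d ∈ Finset.Ioc 0 N, vonMangoldt d / d
      ≤ Real.log N.factorial + (Real.log 4 + 4) * N := by
    refine le_trans ?_ (add_le_add_right (sum_Ioc_vonMangoldt_le N) _)
    rw [h1, Finset.mul_sum, ← Finset.sum_add_distrib]
    refine Finset.sum_le_sum fun d hd => ?_
    have hd0 : 0 < d := by rw [Finset.mem_Ioc] at hd; exact hd.1
    have h : (N : ℝ) / d ≤ ((N / d : ℕ) : ℝ) + 1 := by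
      rw [div_le_iff₀ (by exact_mod_cast hd0)]
      have := Nat.lt_mul_div_succ N hd0
      rw [mul_comm]
      exact_mod_cast this.le
    calc _ = vonMangoldt d * ((N : ℝ) / d) := by ring
      _ ≤ vonMangoldt d * (((N / d : ℕ) : ℝ) + 1) := mul_le_mul_of_nonneg_left h vonMangoldt_nonneg
      _ = _ := by ring
  rw [abs_le]
  constructor <;> nlinarith

/-- Partial sums of `1 / (n log n)`. -/
theorem loglog_le_sum_inv_mul_log {N : ℕ} (hN : 2 ≤ N) :
    Real.log (Real.log N) - Real.log (Real.log 2) ≤ ∑ n ∈ Finset.Ico 2 N, 1 / (n * Real.log n) := by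
  induction N, hN using Nat.le_induction with
  | base => simp
  | succ n hn ih =>
    rw [Finset.sum_Ico_succ_top hn]
    have h0 : (2 : ℝ) ≤ n := by exact_mod_cast hn
    have h1 : 0 < Real.log n := Real.log_pos (by linarith)
    have h2 : 0 < Real.log (n + 1 : ℕ) := Real.log_pos (by push_cast; linarith)
    have h3 : Real.log (n + 1 : ℕ) - Real.log n ≤ 1 / n := by
      rw [← Real.log_div (by positivity) (by positivity)]
      refine (Real.log_le_sub_one_of_pos (by positivity)).trans (le_of_eq ?_)
      push_cast; field_simp; ring
    have h4 : Real.log (Real.log (n + 1 : ℕ)) - Real.log (Real.log n) ≤ 1 / (n * Real.log n) := by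
      rw [← Real.log_div h2.ne' h1.ne']
      refine (Real.log_le_sub_one_of_pos (by positivity)).trans ?_
      rw [div_sub_one h1.ne', div_le_div_iff₀ h1 (by positivity)]
      have : Real.log n * n * (1 / n) = Real.log n := by field_simp
      nlinarith [mul_le_mul_of_nonneg_left h3 (by positivity : 0 ≤ Real.log n * n)]
    linarith

theorem sum_inv_mul_log_le_loglog {N : ℕ} (hN : 2 ≤ N) :
    ∑ n ∈ Finset.Ico 2 (N + 1), 1 / (n * Real.log n) ≤
      Real.log (Real.log N) - Real.log (Real.log 2) + 1 / (2 * Real.log 2) := by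
  induction N, hN using Nat.le_induction with
  | base => simp
  | succ n hn ih =>
    rw [Finset.sum_Ico_succ_top (by omega)]
    have h0 : (2 : ℝ) ≤ n := by exact_mod_cast hn
    have h1 : 0 < Real.log n := Real.log_pos (by linarith)
    have h2 : 0 < Real.log (n + 1 : ℕ) := Real.log_pos (by push_cast; linarith)
    have h3 : 1 / ((n + 1 : ℕ) : ℝ) ≤ Real.log (n + 1 : ℕ) - Real.log n := by
      have := Real.log_le_sub_one_of_pos (x := (n : ℝ) / (n + 1 : ℕ)) (by positivity)
      rw [Real.log_div (by positivity) (by positivity)] at this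
      have e : (n : ℝ) / (n + 1 : ℕ) - 1 = - (1 / ((n + 1 : ℕ) : ℝ)) := by
        push_cast; field_simp; ring
      linarith
    have h4 : 1 / ((n + 1 : ℕ) * Real.log (n + 1 : ℕ)) ≤
        Real.log (Real.log (n + 1 : ℕ)) - Real.log (Real.log n) := by
      have := Real.log_le_sub_one_of_pos (x := Real.log n / Real.log (n + 1 : ℕ)) (by positivity)
      rw [Real.log_div (by positivity) (by positivity)] at this
      have e : Real.log n / Real.log (n + 1 : ℕ) - 1 =
        - ((Real.log (n + 1 : ℕ) - Real.log n) / Real.log (n + 1 : ℕ)) := by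
        field_simp; ring
      have e2 : 1 / ((n + 1 : ℕ) * Real.log (n + 1 : ℕ)) ≤
          (Real.log (n + 1 : ℕ) - Real.log n) / Real.log (n + 1 : ℕ) := by
        rw [← div_div]
        exact div_le_div_of_nonneg_right h3 h2.le
      linarith
    linarith

theorem sum_primePow_not_prime_le (N : ℕ) :
    ∑ n ∈ (Finset.Ico 2 (N + 1)).filter (fun n => IsPrimePow n ∧ ¬ n.Prime), 1 / (n : ℝ) ≤ 2 := by
  classical
  have hsub : (Finset.Ico 2 (N + 1)).filter (fun n => IsPrimePow n ∧ ¬ n.Prime) ⊆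
      (Finset.Ico 2 (N + 1) ×ˢ Finset.Ico 2 (N + 1)).image (fun q => q.1 ^ q.2) := by
    intro n hn
    simp only [Finset.mem_filter, Finset.mem_Ico] at hn
    obtain ⟨⟨h2, hN⟩, hpp, hnp⟩ := hn
    obtain ⟨p, k, hp, hk, rfl⟩ := (isPrimePow_nat_iff n).1 hpp
    have hk1 : k ≠ 1 := by rintro rfl; simp [hp] at hnp
    have : p ≤ p ^ k := Nat.le_self_pow (by omega) p
    have : k < p ^ k := Nat.lt_pow_self hp.one_lt
    simp only [Finset.mem_image, Finset.mem_product, Finset.mem_Ico, Prod.exists]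
    exact ⟨p, k, ⟨⟨hp.two_le, by omega⟩, by omega, by omega⟩, rfl⟩
  calc _ ≤ ∑ n ∈ (Finset.Ico 2 (N + 1) ×ˢ Finset.Ico 2 (N + 1)).image (fun q : ℕ × ℕ => q.1 ^ q.2),
          1 / (n : ℝ) := Finset.sum_le_sum_of_subset_of_nonneg hsub fun _ _ _ => by positivity
    _ ≤ ∑ q ∈ Finset.Ico 2 (N + 1) ×ˢ Finset.Ico 2 (N + 1), 1 / ((q.1 ^ q.2 : ℕ) : ℝ) :=
        Finset.sum_image_le_of_nonneg fun _ _ => by positivity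
    _ = ∑ q ∈ Finset.Ico 2 (N + 1), ∑ k ∈ Finset.Ico 2 (N + 1), 1 / ((q ^ k : ℕ) : ℝ) := by
        rw [Finset.sum_product]
    -- The geometric sum over `k ≥ 2` is at most `1 / (q (q - 1)) = 1 / (q - 1) - 1 / q`, which
    -- telescopes over `q`; the factor `2` is slack.
    _ ≤ ∑ q ∈ Finset.Ico 2 (N + 1), 2 * (1 / ((q : ℝ) - 1) - 1 / q) := by
        refine Finset.sum_le_sum fun q hq => ?_
        have hq2 : (2 : ℝ) ≤ q := by rw [Finset.mem_Ico] at hq; exact_mod_cast hq.1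
        have key : ∀ K : ℕ, 2 ≤ K → ∑ k ∈ Finset.Ico 2 K, 1 / ((q ^ k : ℕ) : ℝ) ≤
            1 / ((q : ℝ) - 1) * (1 / q - (1 / q) ^ (K - 1)) := by
          intro K hK
          induction K, hK using Nat.le_induction with
          | base => simp
          | succ K hK ih =>
            rw [Finset.sum_Ico_succ_top hK]
            obtain ⟨j, rfl⟩ : ∃ j, K = j + 1 := ⟨K - 1, by omega⟩
            have e : 1 / ((q ^ (j + 1) : ℕ) : ℝ) =
              1 / ((q : ℝ) - 1) * ((1 / q) ^ j - (1 / q) ^ (j + 1)) := by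
              have : (q : ℝ) - 1 ≠ 0 := by linarith
              have : (q : ℝ) ≠ 0 := by linarith
              push_cast
              rw [one_div_pow, one_div_pow]
              field_simp
              ring
            simp only [Nat.add_sub_cancel] at ih ⊢
            rw [e]
            linarith
        have h1 := key (N + 1) (by rw [Finset.mem_Ico] at hq; omega)
        have h2 : (0 : ℝ) ≤ (1 / q) ^ (N + 1 - 1) := by positivity
        have h3 : 0 ≤ 1 / ((q : ℝ) - 1) := one_div_nonneg.2 (by linarith)
        have e : 1 / ((q : ℝ) - 1) - 1 / q = 1 / ((q : ℝ) - 1) * (1 / q) := by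
          have : (q : ℝ) - 1 ≠ 0 := by linarith
          field_simp; ring
        have h4 : 0 ≤ 1 / ((q : ℝ) - 1) * (1 / q) := by positivity
        rw [e]
        nlinarith
    _ ≤ 2 := by
        rw [← Finset.mul_sum]
        have key : ∀ K : ℕ, 2 ≤ K → ∑ q ∈ Finset.Ico 2 K, (1 / ((q : ℝ) - 1) - 1 / q) =
            1 - 1 / ((K : ℝ) - 1) := by
          intro K hK
          induction K, hK using Nat.le_induction with
          | base => norm_num
          | succ K hK ih =>
            rw [Finset.sum_Ico_succ_top hK, ih]; push_cast; ring
        rcases Nat.lt_or_ge (N + 1) 2 with h | h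
        · rw [Finset.Ico_eq_empty (by omega)]; simp
        · rw [key _ h]
          have : (0 : ℝ) ≤ 1 / (((N + 1 : ℕ) : ℝ) - 1) := by
            push_cast; simp
          linarith

open ArithmeticFunction in
-- The two sums agree at primes; they differ only at higher prime powers, where `Λ(n) / log n ≤ 1`
-- and the reciprocals converge.
theorem abs_sum_vonMangoldt_sub_sum_prime_le (f : ℕ → ℝ) (hf : ∀ n, |f n| ≤ 1) (N : ℕ) :
    |∑ n ∈ Finset.Ico 2 (N + 1), f n * (vonMangoldt n / n) * (1 / Real.log n) -
      ∑ p ∈ (Finset.Ico 2 (N + 1)).filter Nat.Prime, f p / p| ≤ 2 := by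
  rw [Finset.sum_filter, ← Finset.sum_sub_distrib]
  refine (Finset.abs_sum_le_sum_abs _ _).trans ((Finset.sum_le_sum ?_).trans
    ((Finset.sum_filter _ _).symm.le.trans (sum_primePow_not_prime_le N)))
  intro n hn
  have hn2 : (2 : ℝ) ≤ n := by rw [Finset.mem_Ico] at hn; exact_mod_cast hn.1
  have hl : 0 < Real.log n := Real.log_pos (by linarith)
  by_cases hp : n.Prime
  · rw [if_pos hp, if_neg (by tauto), vonMangoldt_apply_prime hp]
    have : f n * (Real.log n / n) * (1 / Real.log n) - f n / n = 0 := by field_simp; ring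
    rw [this]; simp
  · by_cases hpp : IsPrimePow n
    · rw [if_neg hp, if_pos ⟨hpp, hp⟩, sub_zero, abs_mul, abs_mul,
        abs_of_nonneg (by positivity : 0 ≤ 1 / Real.log n),
        abs_of_nonneg (div_nonneg vonMangoldt_nonneg (by linarith))]
      calc _ ≤ 1 * (Real.log n / n) * (1 / Real.log n) := by
            gcongr
            · exact hf n
            · exact vonMangoldt_le_log
        _ = _ := by field_simp
    · rw [if_neg hp, if_neg (by tauto), vonMangoldt_eq_zero_iff.2 hpp]; simp

theorem antitone_inv_log {i j : ℕ} (hi : 2 ≤ i) (hij : i ≤ j) :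
    1 / Real.log j ≤ 1 / Real.log i := by
  have hi' : (2 : ℝ) ≤ i := by exact_mod_cast hi
  have hij' : (i : ℝ) ≤ j := by exact_mod_cast hij
  exact one_div_le_one_div_of_le (Real.log_pos (by linarith)) (Real.log_le_log (by linarith) hij')

/-- The sum of `χ₄(p) / p` over primes is bounded. -/
theorem exists_abs_sum_chi_div_prime_le :
    ∃ C : ℝ, ∀ N : ℕ, |∑ p ∈ (Finset.Ico 2 (N + 1)).filter Nat.Prime, chi p / p| ≤ C := by
  obtain ⟨C, hC⟩ := exists_abs_sum_chi_mul_vonMangoldt_le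
  refine ⟨C * (1 / Real.log (2 : ℕ)) + 2, fun N => ?_⟩
  -- Partial summation against `1 / log n`. It must start at `2`, since `1 / log 1` evaluates to
  -- `0`; nothing is lost because `Λ(1) = 0`.
  have h1 := abs_sum_mul_le_of_antitone
    (a := fun d => chi d * (ArithmeticFunction.vonMangoldt d / d)) (w := fun n => 1 / Real.log n)
    (m := 2) (B := C) (fun k => by
      rcases Nat.lt_or_ge k 2 with h | h
      · rw [Finset.Ico_eq_empty (by omega)]
        simpa using (abs_nonneg _).trans (hC 0)
      · have := hC (k - 1)
        rw [Ioc_zero_eq_Ico, Nat.sub_add_cancel (by omega),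
          Finset.sum_eq_sum_Ico_succ_bot (by omega)] at this
        simpa using this)
    (fun i j hi hij => antitone_inv_log hi hij)
    (fun i _ => one_div_nonneg.2 (Real.log_natCast_nonneg i)) (N + 1)
  have h2 := abs_sum_vonMangoldt_sub_sum_prime_le chi abs_chi_le N
  rw [abs_le] at *
  constructor <;> linarith [h1.1, h1.2, h2.1, h2.2]

/-- Mertens' second theorem. -/
theorem exists_abs_sum_inv_prime_sub_loglog_le :
    ∃ C : ℝ, ∀ N : ℕ, 2 ≤ N →
      |∑ p ∈ (Finset.Ico 2 (N + 1)).filter Nat.Prime, 1 / (p : ℝ) - Real.log (Real.log N)| ≤ C := by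
  obtain ⟨C, hC⟩ := exists_abs_sum_vonMangoldt_div_sub_log_le
  -- Subtracting `1 / d` from `Λ(d) / d` makes the partial sums bounded, so Dirichlet's test
  -- applies; the subtracted part becomes `Σ 1 / (n log n)`, which supplies `log log N`.
  have hpart : ∀ k, |∑ d ∈ Finset.Ico 2 k, (ArithmeticFunction.vonMangoldt d / d - 1 / d)| ≤ C + 2 := by
    intro k
    rcases Nat.lt_or_ge k 2 with h | h
    · rw [Finset.Ico_eq_empty (by omega)]
      have := (abs_nonneg _).trans (hC 0)
      simp; linarith
    · have h1 := hC (k - 1)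
      rw [Ioc_zero_eq_Ico, Nat.sub_add_cancel (by omega),
          Finset.sum_eq_sum_Ico_succ_bot (by omega)] at h1
      have h2 := log_add_one_le_harmonic (k - 1)
      have h3 := harmonic_le_one_add_log (k - 1)
      have e : ((harmonic (k - 1) : ℚ) : ℝ) = 1 + ∑ d ∈ Finset.Ico 2 k, 1 / (d : ℝ) := by
        rw [harmonic_eq_sum_Icc]
        have : Finset.Icc 1 (k - 1) = Finset.Ico 1 k := by ext; simp; omega
        rw [this, Finset.sum_eq_sum_Ico_succ_bot (by omega)]
        push_cast; simp
      rw [e] at h2 h3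
      have h4 : Real.log ((k - 1 : ℕ) : ℝ) ≤ Real.log ((k - 1 + 1 : ℕ) : ℝ) :=
        Real.log_le_log (by exact_mod_cast (by omega : 0 < k - 1)) (by push_cast; linarith)
      rw [Finset.sum_sub_distrib]
      simp only [ArithmeticFunction.vonMangoldt_apply_one, zero_div, zero_add] at h1
      rw [abs_le] at *
      constructor <;> linarith [h1.1, h1.2]
  refine ⟨(C + 2) * (1 / Real.log (2 : ℕ)) + 2 + |Real.log (Real.log 2)| + 1 / (2 * Real.log 2)
    + 1, fun N hN => ?_⟩
  have h1 := abs_sum_mul_le_of_antitone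
    (a := fun d : ℕ => ArithmeticFunction.vonMangoldt d / (d : ℝ) - 1 / d)
    (w := fun n => 1 / Real.log n) (m := 2) hpart
    (fun i j hi hij => antitone_inv_log hi hij)
    (fun i _ => one_div_nonneg.2 (Real.log_natCast_nonneg i)) (N + 1)
  have h2 := abs_sum_vonMangoldt_sub_sum_prime_le (fun _ => 1) (by simp) N
  have h3 := sum_inv_mul_log_le_loglog hN
  have h4 := loglog_le_sum_inv_mul_log hN
  have h5 : ∑ n ∈ Finset.Ico 2 N, 1 / (n * Real.log n) ≤
      ∑ n ∈ Finset.Ico 2 (N + 1), 1 / (n * Real.log n) :=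
    Finset.sum_le_sum_of_subset_of_nonneg (Finset.Ico_subset_Ico_right (by omega)) fun n _ _ => by
      have := Real.log_natCast_nonneg n
      positivity
  have e : ∑ i ∈ Finset.Ico 2 (N + 1),
      (ArithmeticFunction.vonMangoldt i / (i : ℝ) - 1 / i) * (1 / Real.log i) =
      ∑ n ∈ Finset.Ico 2 (N + 1), 1 * (ArithmeticFunction.vonMangoldt n / n) * (1 / Real.log n)
      - ∑ n ∈ Finset.Ico 2 (N + 1), 1 / (n * Real.log n) := by
    rw [← Finset.sum_sub_distrib]
    refine Finset.sum_congr rfl fun n _ => ?_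
    rw [sub_mul, one_mul, one_div_mul_one_div]
  rw [e] at h1
  have h6 := neg_abs_le (Real.log (Real.log 2))
  have h7 := le_abs_self (Real.log (Real.log 2))
  have h8 : 0 ≤ 1 / (2 * Real.log 2) := by
    have := Real.log_nonneg (show (1 : ℝ) ≤ 2 by norm_num)
    positivity
  rw [abs_le] at h1 h2 ⊢
  constructor <;> linarith [h1.1, h1.2, h2.1, h2.2]

/-! ### Brun's pure sieve in two variables -/

/-- The elementary symmetric sum of degree `j` of `g` over `P`. -/
noncomputable def esum (g : ℕ → ℝ) (P : Finset ℕ) (j : ℕ) : ℝ :=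
  ∑ D ∈ P.powersetCard j, ∏ q ∈ D, g q

theorem esum_zero (g : ℕ → ℝ) (P : Finset ℕ) : esum g P 0 = 1 := by simp [esum]

theorem esum_insert (g : ℕ → ℝ) {P : Finset ℕ} {q : ℕ} (hq : q ∉ P) (j : ℕ) :
    esum g (insert q P) (j + 1) = esum g P (j + 1) + g q * esum g P j := by
  unfold esum
  rw [Finset.powersetCard_succ_insert hq, Finset.sum_union, Finset.sum_image, Finset.mul_sum]
  · congr 1
    refine Finset.sum_congr rfl fun D hD => ?_
    rw [Finset.mem_powersetCard] at hD
    rw [Finset.prod_insert fun h => hq (hD.1 h)]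
  · intro D hD D' hD' h
    rw [Finset.mem_coe, Finset.mem_powersetCard] at hD hD'
    have h1 : q ∉ D := fun h => hq (hD.1 h)
    have h2 : q ∉ D' := fun h => hq (hD'.1 h)
    rw [← Finset.erase_insert h1, ← Finset.erase_insert h2, h]
  · rw [Finset.disjoint_left]
    intro D hD hD'
    rw [Finset.mem_powersetCard] at hD
    obtain ⟨D', _, rfl⟩ := Finset.mem_image.1 hD'
    exact hq (hD.1 (Finset.mem_insert_self _ _))

/-- The truncated inclusion-exclusion sum. -/
noncomputable def bonf (g : ℕ → ℝ) (P : Finset ℕ) (r : ℕ) : ℝ :=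
  ∑ j ∈ Finset.range (r + 1), (-1) ^ j * esum g P j

theorem bonf_insert (g : ℕ → ℝ) {P : Finset ℕ} {q : ℕ} (hq : q ∉ P) (r : ℕ) :
    bonf g (insert q P) (r + 1) = bonf g P (r + 1) - g q * bonf g P r := by
  unfold bonf
  rw [Finset.sum_range_succ', Finset.sum_range_succ' (fun j => (-1) ^ j * esum g P j) (r + 1),
    esum_zero, esum_zero, Finset.mul_sum]
  rw [add_sub_right_comm, ← Finset.sum_sub_distrib]
  congr 1
  refine Finset.sum_congr rfl fun j _ => ?_
  rw [esum_insert g hq, pow_succ]; ring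

/-- The Bonferroni inequalities. -/
theorem bonferroni {g : ℕ → ℝ} {P : Finset ℕ} (hg : ∀ q ∈ P, 0 ≤ g q ∧ g q ≤ 1) (r : ℕ) :
    0 ≤ (-1) ^ r * (bonf g P r - ∏ q ∈ P, (1 - g q)) := by
  induction P using Finset.induction_on generalizing r with
  | empty =>
    have : bonf g ∅ r = 1 := by
      unfold bonf
      rw [Finset.sum_range_succ', esum_zero, Finset.sum_eq_zero]
      · simp
      · intro j _
        rw [esum, Finset.powersetCard_eq_empty.2 (by simp)]
        simp
    simp [this]
  | insert q P hq ih =>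
    have hq' := hg q (Finset.mem_insert_self _ _)
    have hP : ∀ q ∈ P, 0 ≤ g q ∧ g q ≤ 1 := fun p hp => hg p (Finset.mem_insert_of_mem hp)
    rw [Finset.prod_insert hq]
    cases r with
    | zero =>
      have h1 : ∏ q ∈ P, (1 - g q) ≤ 1 := Finset.prod_le_one (fun p hp => by linarith [hP p hp])
        fun p hp => by linarith [hP p hp]
      have h2 : 0 ≤ ∏ q ∈ P, (1 - g q) := Finset.prod_nonneg fun p hp => by linarith [hP p hp]
      simp only [bonf, Finset.sum_range_one, esum_zero, zero_add]
      nlinarith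
    | succ r =>
      rw [bonf_insert g hq]
      have h1 := ih hP (r + 1)
      have h2 := ih hP r
      have h3 := mul_nonneg hq'.1 h2
      rw [pow_succ] at h1 ⊢
      nlinarith

/-- The truncation one degree further is already a lower bound for the product, so an even
truncation overshoots by at most the first omitted term. -/
theorem bonf_le_prod_add {g : ℕ → ℝ} {P : Finset ℕ} (hg : ∀ q ∈ P, 0 ≤ g q ∧ g q ≤ 1) {r : ℕ}
    (hr : Even r) : bonf g P r ≤ ∏ q ∈ P, (1 - g q) + esum g P (r + 1) := by
  have h := bonferroni hg (r + 1)
  have e : bonf g P (r + 1) = bonf g P r + (-1) ^ (r + 1) * esum g P (r + 1) := by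
    unfold bonf; rw [Finset.sum_range_succ]
  rw [e, pow_succ, hr.neg_one_pow] at h
  linarith

theorem prod_le_bonf {g : ℕ → ℝ} {P : Finset ℕ} (hg : ∀ q ∈ P, 0 ≤ g q ∧ g q ≤ 1) {r : ℕ}
    (hr : Even r) : ∏ q ∈ P, (1 - g q) ≤ bonf g P r := by
  have h := bonferroni hg r
  rw [hr.neg_one_pow] at h
  linarith

theorem pow_succ_add_le {s t : ℝ} (hs : 0 ≤ s) (ht : 0 ≤ t) (n : ℕ) :
    s ^ (n + 1) + (n + 1) * t * s ^ n ≤ (s + t) ^ (n + 1) := by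
  induction n with
  | zero => simp
  | succ n ih =>
    calc s ^ (n + 1 + 1) + ((n + 1 : ℕ) + 1) * t * s ^ (n + 1)
        ≤ (s ^ (n + 1) + (n + 1) * t * s ^ n) * (s + t) := by
          have : 0 ≤ (n + 1) * t * s ^ n * t := by positivity
          push_cast
          rw [pow_succ s (n + 1), pow_succ s n]
          nlinarith
      _ ≤ (s + t) ^ (n + 1) * (s + t) := by gcongr
      _ = _ := (pow_succ _ _).symm

/-- Expanding the power `(Σ g) ^ j` produces the product over each `j`-subset `j!` times, and all
terms are nonnegative. -/
theorem esum_le {g : ℕ → ℝ} {P : Finset ℕ} (hg : ∀ q ∈ P, 0 ≤ g q) (j : ℕ) :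
    esum g P j ≤ (∑ q ∈ P, g q) ^ j / j.factorial := by
  induction P using Finset.induction_on generalizing j with
  | empty =>
    cases j with
    | zero => simp [esum]
    | succ j =>
      rw [esum, Finset.powersetCard_eq_empty.2 (by simp)]
      simp
  | insert q P hq ih =>
    have hq' := hg q (Finset.mem_insert_self _ _)
    have hP : ∀ q ∈ P, 0 ≤ g q := fun p hp => hg p (Finset.mem_insert_of_mem hp)
    cases j with
    | zero => simp [esum_zero]
    | succ j =>
      rw [esum_insert g hq, Finset.sum_insert hq, add_comm (g q)]
      have hs : 0 ≤ ∑ q ∈ P, g q := Finset.sum_nonneg hP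
      calc _ ≤ (∑ q ∈ P, g q) ^ (j + 1) / (j + 1).factorial
            + g q * ((∑ q ∈ P, g q) ^ j / j.factorial) := by
            gcongr
            · exact ih hP _
            · exact ih hP _
        _ = ((∑ q ∈ P, g q) ^ (j + 1) + (j + 1) * g q * (∑ q ∈ P, g q) ^ j)
            / (j + 1).factorial := by
            rw [Nat.factorial_succ]; push_cast; field_simp
        _ ≤ _ := by
            gcongr
            exact pow_succ_add_le hs hq' j

/-! ### Averages of periodic functions over boxes, and the Chinese remainder theorem -/

theorem sum_range_shift_of_periodic {f : ℤ → ℝ} {d : ℕ} (hf : ∀ n, f (n + d) = f n) (a : ℤ) :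
    ∑ i ∈ Finset.range d, f (a + i) = ∑ i ∈ Finset.range d, f i := by
  have key : ∀ a : ℤ, ∑ i ∈ Finset.range d, f (a + 1 + i) = ∑ i ∈ Finset.range d, f (a + i) := by
    intro a
    have h := Finset.sum_range_succ' (fun i : ℕ => f (a + i)) d
    rw [Finset.sum_range_succ, hf] at h
    simp only [Nat.cast_zero, add_zero] at h
    rw [add_right_cancel h]
    exact Finset.sum_congr rfl fun i _ => by push_cast; congr 1; ring
  induction a using Int.induction_on with
  | zero => simp
  | succ a ih => rw [key, ih]
  | pred a ih =>
    rw [← ih, ← key]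
    exact Finset.sum_congr rfl fun i _ => by congr 1; ring

/-- Whole periods are removed one by one at no cost. For the last incomplete period, both the sum
and its predicted value lie between `0` and `d`. -/
theorem abs_sum_periodic_sub_le {f : ℤ → ℝ} {d : ℕ} (hd : 0 < d) (hf : ∀ n, f (n + d) = f n)
    (h01 : ∀ n, 0 ≤ f n ∧ f n ≤ 1) (a : ℤ) (N : ℕ) :
    |∑ i ∈ Finset.range N, f (a + i) - (N : ℝ) / d * ∑ i ∈ Finset.range d, f i| ≤ d := by
  have hdr : (0 : ℝ) < d := by exact_mod_cast hd
  induction N using Nat.strong_induction_on generalizing a with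
  | _ N ih =>
    rcases Nat.lt_or_ge N d with h | h
    · have hN : (N : ℝ) ≤ d := by exact_mod_cast h.le
      have h1 : 0 ≤ ∑ i ∈ Finset.range N, f (a + i) := Finset.sum_nonneg fun i _ => (h01 _).1
      have h2 : ∑ i ∈ Finset.range N, f (a + i) ≤ N := by
        refine (Finset.sum_le_sum fun (i : ℕ) _ => (h01 (a + i)).2).trans ?_
        simp
      have h3 : 0 ≤ ∑ i ∈ Finset.range d, f i := Finset.sum_nonneg fun i _ => (h01 _).1
      have h4 : ∑ i ∈ Finset.range d, f i ≤ d := by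
        refine (Finset.sum_le_sum fun (i : ℕ) _ => (h01 i).2).trans ?_
        simp
      have h5 : (N : ℝ) / d * ∑ i ∈ Finset.range d, f i ≤ N := by
        calc _ ≤ (N : ℝ) / d * d := by gcongr
          _ = N := by field_simp
      have h6 : 0 ≤ (N : ℝ) / d * ∑ i ∈ Finset.range d, f i := by positivity
      rw [abs_le]
      constructor <;> linarith
    · obtain ⟨N', rfl⟩ := Nat.exists_eq_add_of_le h
      have := ih N' (by omega) (a + d)
      rw [Finset.sum_range_add, sum_range_shift_of_periodic hf]
      have e : ∀ x : ℕ, f (a + ((d + x : ℕ) : ℤ)) = f (a + d + x) := fun x => by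
        push_cast; congr 1; ring
      simp only [e]
      refine le_of_eq_of_le ?_ this
      congr 1
      push_cast
      field_simp
      ring

/-- The one-variable estimate is used twice: inside each row, then for the row means, which are
again periodic with values in `[0, 1]`. -/
theorem abs_sum_sum_periodic_sub_le {F : ℤ → ℤ → ℝ} {d : ℕ} (hd : 0 < d)
    (hF1 : ∀ m n, F (m + d) n = F m n) (hF2 : ∀ m n, F m (n + d) = F m n)
    (h01 : ∀ m n, 0 ≤ F m n ∧ F m n ≤ 1) (a : ℤ) (N : ℕ) :
    |∑ i ∈ Finset.range N, ∑ j ∈ Finset.range N, F (a + i) (a + j) -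
      (N : ℝ) ^ 2 * ((∑ i ∈ Finset.range d, ∑ j ∈ Finset.range d, F i j) / (d : ℝ) ^ 2)|
      ≤ 2 * N * d := by
  have hdr : (0 : ℝ) < d := by exact_mod_cast hd
  set S : ℤ → ℝ := fun m => (∑ j ∈ Finset.range d, F m j) / d with hS
  have h1 : ∀ i : ℕ, |∑ j ∈ Finset.range N, F (a + i) (a + j) - N * S (a + i)| ≤ d := by
    intro i
    have := abs_sum_periodic_sub_le hd (hF2 (a + i)) (h01 (a + i)) a N
    refine le_of_eq_of_le ?_ this
    simp only [hS]; congr 1; ring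
  have h2 : |∑ i ∈ Finset.range N, S (a + i) - (N : ℝ) / d * ∑ i ∈ Finset.range d, S i| ≤ d := by
    refine abs_sum_periodic_sub_le hd (fun n => ?_) (fun n => ⟨?_, ?_⟩) a N
    · simp only [hS, hF1]
    · exact div_nonneg (Finset.sum_nonneg fun j _ => (h01 _ _).1) hdr.le
    · simp only [hS]
      rw [div_le_one hdr]
      refine (Finset.sum_le_sum fun (j : ℕ) _ => (h01 n j).2).trans ?_
      simp
  have h3 : |∑ i ∈ Finset.range N, (∑ j ∈ Finset.range N, F (a + i) (a + j) - N * S (a + i))|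
      ≤ N * d := by
    refine (Finset.abs_sum_le_sum_abs _ _).trans ((Finset.sum_le_sum fun i _ => h1 i).trans ?_)
    simp
  have h4 : |(N : ℝ) * (∑ i ∈ Finset.range N, S (a + i) - (N : ℝ) / d * ∑ i ∈ Finset.range d, S i)|
      ≤ N * d := by
    rw [abs_mul, Nat.abs_cast]
    gcongr
  have e : ∑ i ∈ Finset.range N, ∑ j ∈ Finset.range N, F (a + i) (a + j) -
      (N : ℝ) ^ 2 * ((∑ i ∈ Finset.range d, ∑ j ∈ Finset.range d, F i j) / (d : ℝ) ^ 2) =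
      ∑ i ∈ Finset.range N, (∑ j ∈ Finset.range N, F (a + i) (a + j) - N * S (a + i)) +
      (N : ℝ) * (∑ i ∈ Finset.range N, S (a + i) - (N : ℝ) / d * ∑ i ∈ Finset.range d, S i) := by
    have : ∑ i ∈ Finset.range d, S i = (∑ i ∈ Finset.range d, ∑ j ∈ Finset.range d, F i j) / d := by
      simp only [hS]; rw [Finset.sum_div]
    rw [this, Finset.sum_sub_distrib, ← Finset.mul_sum]
    field_simp
    ring
  rw [e]
  refine (abs_add_le _ _).trans ((add_le_add h3 h4).trans (le_of_eq ?_))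
  ring

theorem periodic_emod {f : ℤ → ℝ} {d : ℕ} (hf : ∀ n, f (n + d) = f n) (i : ℕ) :
    f ((i % d : ℕ) : ℤ) = f i := by
  have h : ∀ k : ℕ, ∀ n : ℤ, f (n + d * k) = f n := by
    intro k
    induction k with
    | zero => simp
    | succ k ih => intro n; rw [← ih n, ← hf (n + d * k)]; push_cast; congr 1; ring
  conv_rhs => rw [← Nat.mod_add_div i d]
  rw [Nat.cast_add, Nat.cast_mul, h]

/-- By the Chinese remainder theorem `i ↦ (i mod d, i mod q)` is a bijection, and the periods let
each argument be reduced separately. -/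
theorem sum_range_mul_of_coprime {h : ℤ → ℤ → ℝ} {d q : ℕ} (hd : 0 < d) (hq : 0 < q)
    (hdq : Nat.Coprime d q) (h1 : ∀ m n, h (m + d) n = h m n) (h2 : ∀ m n, h m (n + q) = h m n) :
    ∑ i ∈ Finset.range (d * q), h i i =
      ∑ a ∈ Finset.range d, ∑ b ∈ Finset.range q, h a b := by
  rw [← Finset.sum_product']
  refine Finset.sum_nbij (fun i => (i % d, i % q)) ?_ ?_ ?_ ?_
  · intro i _
    simp [Nat.mod_lt _ hd, Nat.mod_lt _ hq]
  · intro i hi j hj hij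
    simp only [Finset.coe_range, Set.mem_Iio, Prod.mk.injEq] at hi hj hij
    have := (Nat.modEq_and_modEq_iff_modEq_mul hdq).1 hij
    exact Nat.ModEq.eq_of_lt_of_lt this hi hj
  · intro p hp
    simp only [Finset.coe_product, Finset.coe_range, Set.mem_prod, Set.mem_Iio] at hp
    obtain ⟨k, hk⟩ := Nat.chineseRemainder hdq p.1 p.2
    refine ⟨k % (d * q), ?_, ?_⟩
    · simp [Nat.mod_lt _ (Nat.mul_pos hd hq)]
    · have e1 : k % (d * q) % d = p.1 := by
        rw [Nat.mod_mul_right_mod]; exact (Nat.mod_eq_of_modEq hk.1 hp.1)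
      have e2 : k % (d * q) % q = p.2 := by
        rw [Nat.mod_mul_left_mod]; exact (Nat.mod_eq_of_modEq hk.2 hp.2)
      simp only [e1, e2]
  · intro i _
    simp only
    rw [periodic_emod (f := fun m => h m _) (fun n => h1 n _),
      periodic_emod (f := fun m => h _ m) (fun n => h2 _ n)]

theorem sum_sum_range_mul_of_coprime {F G : ℤ → ℤ → ℝ} {d q : ℕ} (hd : 0 < d) (hq : 0 < q)
    (hdq : Nat.Coprime d q)
    (hF1 : ∀ m n, F (m + d) n = F m n) (hF2 : ∀ m n, F m (n + d) = F m n)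
    (hG1 : ∀ m n, G (m + q) n = G m n) (hG2 : ∀ m n, G m (n + q) = G m n) :
    ∑ i ∈ Finset.range (d * q), ∑ j ∈ Finset.range (d * q), F i j * G i j =
      (∑ i ∈ Finset.range d, ∑ j ∈ Finset.range d, F i j) *
      (∑ i ∈ Finset.range q, ∑ j ∈ Finset.range q, G i j) := by
  have h1 : ∀ i i' : ℤ, ∑ j ∈ Finset.range (d * q), F i j * G i' j =
      (∑ j ∈ Finset.range d, F i j) * (∑ j ∈ Finset.range q, G i' j) := by
    intro i i'
    rw [sum_range_mul_of_coprime (h := fun m n => F i m * G i' n) hd hq hdq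
      (fun m n => by simp only [hF2]) (fun m n => by simp only [hG2]), Finset.sum_mul_sum]
  simp only [h1]
  rw [sum_range_mul_of_coprime
    (h := fun m n => (∑ j ∈ Finset.range d, F m j) * (∑ j ∈ Finset.range q, G n j)) hd hq hdq
      (fun m n => by simp only [hF1]) (fun m n => by simp only [hG1]), Finset.sum_mul_sum]

/-- The mean of a `q`-periodic function of two variables. -/
noncomputable def mean2 (F : ℤ → ℤ → ℝ) (q : ℕ) : ℝ :=
  (∑ i ∈ Finset.range q, ∑ j ∈ Finset.range q, F i j) / (q : ℝ) ^ 2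

theorem mean2_mem {F : ℤ → ℤ → ℝ} {q : ℕ} (hq : 0 < q) (h01 : ∀ m n, 0 ≤ F m n ∧ F m n ≤ 1) :
    0 ≤ mean2 F q ∧ mean2 F q ≤ 1 := by
  have hq0 : (0 : ℝ) < q := by exact_mod_cast hq
  refine ⟨div_nonneg (Finset.sum_nonneg fun i _ => Finset.sum_nonneg fun j _ =>
    (h01 _ _).1) (by positivity), ?_⟩
  unfold mean2
  rw [div_le_one (by positivity)]
  refine (Finset.sum_le_sum fun (i : ℕ) _ => Finset.sum_le_sum fun (j : ℕ) _ =>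
    (h01 i j).2).trans ?_
  simp [sq]

/-- Makes the sieve density multiplicative: conditions at distinct primes are independent modulo the
product. The periodicity statements are what the box estimate needs at that modulus. -/
theorem mean2_prod {g : ℕ → ℤ → ℤ → ℝ} {D : Finset ℕ} (hD : ∀ q ∈ D, q.Prime)
    (h1 : ∀ q ∈ D, ∀ m n, g q (m + q) n = g q m n)
    (h2 : ∀ q ∈ D, ∀ m n, g q m (n + q) = g q m n) :
    (∀ m n, ∏ q ∈ D, g q (m + (∏ q ∈ D, q : ℕ)) n = ∏ q ∈ D, g q m n) ∧
    (∀ m n, ∏ q ∈ D, g q m (n + (∏ q ∈ D, q : ℕ)) = ∏ q ∈ D, g q m n) ∧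
    mean2 (fun m n => ∏ q ∈ D, g q m n) (∏ q ∈ D, q) = ∏ q ∈ D, mean2 (g q) q := by
  have hper : ∀ {f : ℤ → ℝ} {q d : ℕ}, q ∣ d → (∀ n, f (n + q) = f n) →
      ∀ n, f (n + d) = f n := by
    rintro f q _ ⟨k, rfl⟩ hf n
    induction k generalizing n with
    | zero => simp
    | succ k ih => rw [← ih n, ← hf (n + (q * k : ℕ))]; push_cast; congr 1; ring
  refine ⟨fun m n => Finset.prod_congr rfl fun q hq => ?_,
    fun m n => Finset.prod_congr rfl fun q hq => ?_, ?_⟩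
  · exact hper (f := fun m => g q m n) (Finset.dvd_prod_of_mem _ hq) (fun m => h1 q hq m n) m
  · exact hper (f := fun n => g q m n) (Finset.dvd_prod_of_mem _ hq) (fun n => h2 q hq m n) n
  · induction D using Finset.induction_on with
    | empty => simp [mean2]
    | insert p D hp ih =>
      have hD' : ∀ q ∈ D, q.Prime := fun q hq => hD q (Finset.mem_insert_of_mem hq)
      have hpp := hD p (Finset.mem_insert_self _ _)
      have ih' := ih hD' (fun q hq => h1 q (Finset.mem_insert_of_mem hq))
        (fun q hq => h2 q (Finset.mem_insert_of_mem hq))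
      rw [Finset.prod_insert hp, Finset.prod_insert hp, ← ih']
      have hcop : Nat.Coprime p (∏ q ∈ D, q) := Nat.Coprime.prod_right fun q hq =>
        (Nat.coprime_primes hpp (hD' q hq)).2 fun h => hp (h ▸ hq)
      unfold mean2
      simp only [Finset.prod_insert hp]
      rw [sum_sum_range_mul_of_coprime (G := fun m n => ∏ q ∈ D, g q m n) hpp.pos
        (Finset.prod_pos fun q hq => (hD' q hq).pos) hcop
        (h1 p (Finset.mem_insert_self _ _)) (h2 p (Finset.mem_insert_self _ _))]
      · push_cast; rw [mul_pow, mul_div_mul_comm]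
      · intro m n
        refine Finset.prod_congr rfl fun q hq => ?_
        exact hper (f := fun m => g q m n) (Finset.dvd_prod_of_mem _ hq)
          (fun m => h1 q (Finset.mem_insert_of_mem hq) m n) m
      · intro m n
        refine Finset.prod_congr rfl fun q hq => ?_
        exact hper (f := fun n => g q m n) (Finset.dvd_prod_of_mem _ hq)
          (fun n => h2 q (Finset.mem_insert_of_mem hq) m n) n

theorem sum_range_choose_le (n r : ℕ) :
    ∑ j ∈ Finset.range (r + 1), (n.choose j : ℝ) ≤ ((n : ℝ) + 1) ^ r := by
  rw [add_pow]
  refine Finset.sum_le_sum fun j hj => ?_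
  rw [Finset.mem_range] at hj
  have h1 : (n.choose j : ℝ) ≤ (n : ℝ) ^ j := by exact_mod_cast Nat.choose_le_pow n j
  have h2 : (1 : ℝ) ≤ r.choose j := by exact_mod_cast Nat.choose_pos (by omega)
  rw [one_pow, mul_one]
  nlinarith [pow_nonneg (Nat.cast_nonneg (α := ℝ) n) j]

/-- Brun's pure sieve for sums over a square. -/
theorem sum_prod_one_sub_le {g : ℕ → ℤ → ℤ → ℝ} {P : Finset ℕ} (hP : ∀ q ∈ P, q.Prime)
    (h1 : ∀ q ∈ P, ∀ m n, g q (m + q) n = g q m n)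
    (h2 : ∀ q ∈ P, ∀ m n, g q m (n + q) = g q m n)
    (h01 : ∀ q ∈ P, ∀ m n, 0 ≤ g q m n ∧ g q m n ≤ 1)
    {Y : ℝ} (hY : ∀ q ∈ P, (q : ℝ) ≤ Y) (hcard : (P.card : ℝ) + 1 ≤ Y) {r : ℕ} (hr : Even r)
    (a : ℤ) (N : ℕ) :
    ∑ i ∈ Finset.range N, ∑ j ∈ Finset.range N, ∏ q ∈ P, (1 - g q (a + i) (a + j)) ≤
      (N : ℝ) ^ 2 * (∏ q ∈ P, (1 - mean2 (g q) q) +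
        (∑ q ∈ P, mean2 (g q) q) ^ (r + 1) / (r + 1).factorial) + 2 * N * Y ^ (2 * r) := by
  have hmean : ∀ q ∈ P, 0 ≤ mean2 (g q) q ∧ mean2 (g q) q ≤ 1 := fun q hq =>
    mean2_mem (hP q hq).pos (h01 q hq)
  have hY1 : 1 ≤ Y := by
    have : (0 : ℝ) ≤ P.card := Nat.cast_nonneg _
    linarith
  -- The modulus attached to `D` is at most `Y ^ D.card`, and the box estimate has error `2 N` times
  -- the modulus.
  have hterm : ∀ D ∈ P.powerset, |∑ i ∈ Finset.range N, ∑ j ∈ Finset.range N,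
      ∏ q ∈ D, g q (a + i) (a + j) - (N : ℝ) ^ 2 * ∏ q ∈ D, mean2 (g q) q| ≤ 2 * N * Y ^ D.card := by
    intro D hD
    have hDP := Finset.mem_powerset.1 hD
    obtain ⟨p1, p2, p3⟩ := mean2_prod (g := g) (D := D) (fun q hq => hP q (hDP hq))
      (fun q hq => h1 q (hDP hq)) (fun q hq => h2 q (hDP hq))
    have := abs_sum_sum_periodic_sub_le (F := fun m n => ∏ q ∈ D, g q m n)
      (d := ∏ q ∈ D, q) (Finset.prod_pos fun q hq => (hP q (hDP hq)).pos) p1 p2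
      (fun m n => ⟨Finset.prod_nonneg fun q hq => (h01 q (hDP hq) m n).1,
        Finset.prod_le_one (fun q hq => (h01 q (hDP hq) m n).1)
          fun q hq => (h01 q (hDP hq) m n).2⟩) a N
    rw [← p3]
    refine this.trans ?_
    gcongr
    push_cast
    rw [← Finset.prod_const]
    exact Finset.prod_le_prod (fun q _ => Nat.cast_nonneg q) fun q hq => hY q (hDP hq)
  have hswap : ∑ i ∈ Finset.range N, ∑ j ∈ Finset.range N, bonf (fun q => g q (a + i) (a + j)) P r =
      ∑ k ∈ Finset.range (r + 1), ∑ D ∈ P.powersetCard k, (-1) ^ k *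
        ∑ i ∈ Finset.range N, ∑ j ∈ Finset.range N, ∏ q ∈ D, g q (a + i) (a + j) := by
    simp only [bonf, esum, Finset.mul_sum]
    rw [Finset.sum_congr rfl fun i _ => Finset.sum_comm, Finset.sum_comm]
    refine Finset.sum_congr rfl fun k _ => ?_
    rw [Finset.sum_congr rfl fun i _ => Finset.sum_comm, Finset.sum_comm]
  have hmain : (N : ℝ) ^ 2 * bonf (fun q => mean2 (g q) q) P r =
      ∑ k ∈ Finset.range (r + 1), ∑ D ∈ P.powersetCard k, (-1) ^ k *
        ((N : ℝ) ^ 2 * ∏ q ∈ D, mean2 (g q) q) := by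
    simp only [bonf, esum, Finset.mul_sum]
    refine Finset.sum_congr rfl fun k _ => Finset.sum_congr rfl fun D _ => by ring
  have herr : ∑ i ∈ Finset.range N, ∑ j ∈ Finset.range N, bonf (fun q => g q (a + i) (a + j)) P r -
      (N : ℝ) ^ 2 * bonf (fun q => mean2 (g q) q) P r ≤ 2 * N * Y ^ (2 * r) := by
    rw [hswap, hmain, ← Finset.sum_sub_distrib]
    -- There are at most `(P.card + 1) ^ r ≤ Y ^ r` subsets of size up to `r`, each with error at
    -- most `2 N Y ^ r`; hence the exponent `2 r`.
    calc _ ≤ ∑ k ∈ Finset.range (r + 1), ∑ D ∈ P.powersetCard k, 2 * N * Y ^ r := by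
          refine Finset.sum_le_sum fun k hk => ?_
          rw [← Finset.sum_sub_distrib]
          refine Finset.sum_le_sum fun D hD => ?_
          rw [Finset.mem_powersetCard] at hD
          rw [← mul_sub]
          refine (le_abs_self _).trans ?_
          rw [abs_mul, abs_pow, abs_neg, abs_one, one_pow, one_mul]
          refine (hterm D (Finset.mem_powerset.2 hD.1)).trans ?_
          rw [Finset.mem_range] at hk
          gcongr
          omega
      _ = (∑ k ∈ Finset.range (r + 1), (P.card.choose k : ℝ)) * (2 * N * Y ^ r) := by
          rw [Finset.sum_mul]
          simp
      _ ≤ Y ^ r * (2 * N * Y ^ r) := by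
          gcongr
          exact (sum_range_choose_le _ _).trans (by gcongr)
      _ = _ := by rw [two_mul r, pow_add]; ring
  have hle : ∑ i ∈ Finset.range N, ∑ j ∈ Finset.range N, ∏ q ∈ P, (1 - g q (a + i) (a + j)) ≤
      ∑ i ∈ Finset.range N, ∑ j ∈ Finset.range N, bonf (fun q => g q (a + i) (a + j)) P r :=
    Finset.sum_le_sum fun i _ => Finset.sum_le_sum fun j _ =>
      prod_le_bonf (fun q hq => h01 q hq _ _) hr
  have h3 := bonf_le_prod_add hmean hr
  have h4 := esum_le (fun q hq => (hmean q hq).1) (r + 1)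
  have h5 : (N : ℝ) ^ 2 * bonf (fun q => mean2 (g q) q) P r ≤ (N : ℝ) ^ 2 *
      (∏ q ∈ P, (1 - mean2 (g q) q) + (∑ q ∈ P, mean2 (g q) q) ^ (r + 1) / (r + 1).factorial) := by
    gcongr
    linarith
  linarith

/-! ### Local densities -/

theorem sum_range_eq_sum_zmod (q : ℕ) [NeZero q] (G : ZMod q → ZMod q → ℝ) :
    ∑ i ∈ Finset.range q, ∑ j ∈ Finset.range q, G ((i : ℤ) : ZMod q) ((j : ℤ) : ZMod q) =
      ∑ x : ZMod q, ∑ y : ZMod q, G x y := by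
  have key : ∀ f : ZMod q → ℝ, ∑ i ∈ Finset.range q, f ((i : ℤ) : ZMod q) = ∑ x : ZMod q, f x := by
    intro f
    refine Finset.sum_nbij (fun i => ((i : ℤ) : ZMod q)) (fun i _ => Finset.mem_univ _) ?_ ?_ ?_
    · intro i hi j hj hij
      simp only [Finset.coe_range, Set.mem_Iio, Int.cast_natCast] at hi hj hij
      exact Nat.ModEq.eq_of_lt_of_lt ((ZMod.natCast_eq_natCast_iff _ _ _).1 hij) hi hj
    · intro x _
      exact ⟨x.val, by simpa using ZMod.val_lt x, by simp⟩
    · intro i _; rfl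
  simp only [key]
  exact key fun x => ∑ y : ZMod q, G x y

/-- The local sieve weight at `q`: it removes the zeros of the linear forms `Im (γ i * (u + v i))`
completely and the zeros of the norm form partially. -/
noncomputable def localWeight (z : ℝ) {ℓ : ℕ} (γ : Fin ℓ → GaussianInt) (q : ℕ) (u v : ℤ) : ℝ :=
  open Classical in
  if ∃ i, (q : ℤ) ∣ (γ i).im * u + (γ i).re * v then 1
  else if (q : ℤ) ∣ u ^ 2 + v ^ 2 then 1 - z else 0

theorem localWeight_mem {z : ℝ} (hz0 : 0 < z) (hz1 : z < 1) {ℓ : ℕ} (γ : Fin ℓ → GaussianInt)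
    (q : ℕ) (u v : ℤ) : 0 ≤ localWeight z γ q u v ∧ localWeight z γ q u v ≤ 1 := by
  unfold localWeight
  split_ifs <;> constructor <;> linarith

open Classical in
theorem localWeight_eq (z : ℝ) {ℓ : ℕ} (γ : Fin ℓ → GaussianInt) (q : ℕ) (u v : ℤ) :
    localWeight z γ q u v =
      if ∃ i, ((γ i).im : ZMod q) * (u : ZMod q) + ((γ i).re : ZMod q) * (v : ZMod q) = 0 then 1
      else if (u : ZMod q) ^ 2 + (v : ZMod q) ^ 2 = 0 then 1 - z else 0 := by
  unfold localWeight
  have h1 : ∀ i, (q : ℤ) ∣ (γ i).im * u + (γ i).re * v ↔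
      ((γ i).im : ZMod q) * (u : ZMod q) + ((γ i).re : ZMod q) * (v : ZMod q) = 0 := by
    intro i
    rw [← ZMod.intCast_zmod_eq_zero_iff_dvd]; push_cast; rfl
  have h2 : (q : ℤ) ∣ u ^ 2 + v ^ 2 ↔ (u : ZMod q) ^ 2 + (v : ZMod q) ^ 2 = 0 := by
    rw [← ZMod.intCast_zmod_eq_zero_iff_dvd]; push_cast; rfl
  simp only [h1, h2]

theorem localWeight_add_left (z : ℝ) {ℓ : ℕ} (γ : Fin ℓ → GaussianInt) (q : ℕ) (u v : ℤ) :
    localWeight z γ q (u + q) v = localWeight z γ q u v := by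
  rw [localWeight_eq, localWeight_eq]; simp

theorem localWeight_add_right (z : ℝ) {ℓ : ℕ} (γ : Fin ℓ → GaussianInt) (q : ℕ) (u v : ℤ) :
    localWeight z γ q u (v + q) = localWeight z γ q u v := by
  rw [localWeight_eq, localWeight_eq]; simp

section
variable {q : ℕ} [Fact q.Prime]

open Classical in
theorem sum_line_le {b a : ZMod q} (h : b ≠ 0 ∨ a ≠ 0) :
    ∑ x : ZMod q, ∑ y : ZMod q, (if b * x + a * y = 0 then (1 : ℝ) else 0) ≤ q := by
  have aux : ∀ {b a : ZMod q}, a ≠ 0 →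
      ∑ x : ZMod q, ∑ y : ZMod q, (if b * x + a * y = 0 then (1 : ℝ) else 0) ≤ q := by
    intro b a ha
    have : ∀ x : ZMod q, ∑ y : ZMod q, (if b * x + a * y = 0 then (1 : ℝ) else 0) ≤ 1 := by
      intro x
      rw [Finset.sum_boole]
      have : (Finset.univ.filter fun y : ZMod q => b * x + a * y = 0).card ≤ 1 := by
        rw [Finset.card_le_one]
        intro y hy y' hy'
        simp only [Finset.mem_filter, Finset.mem_univ, true_and] at hy hy'
        exact mul_left_cancel₀ ha (by linear_combination hy - hy')
      exact_mod_cast this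
    refine (Finset.sum_le_sum fun x _ => this x).trans ?_
    simp [ZMod.card]
  rcases h with hb | ha
  · rw [Finset.sum_comm]
    simpa only [add_comm] using aux (b := a) hb
  · exact aux ha

open Classical in
theorem sum_norm_zero_le :
    ∑ x : ZMod q, ∑ y : ZMod q, (if x ^ 2 + y ^ 2 = 0 then (1 : ℝ) else 0) ≤ 2 * q := by
  have : ∀ x : ZMod q, ∑ y : ZMod q, (if x ^ 2 + y ^ 2 = 0 then (1 : ℝ) else 0) ≤ 2 := by
    intro x
    rw [Finset.sum_boole]
    have : (Finset.univ.filter fun y : ZMod q => x ^ 2 + y ^ 2 = 0).card ≤ 2 := by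
      rcases Finset.eq_empty_or_nonempty (Finset.univ.filter fun y : ZMod q => x ^ 2 + y ^ 2 = 0)
        with h | ⟨y0, hy0⟩
      · rw [h]; simp
      · refine le_trans (Finset.card_le_card (t := {y0, -y0}) ?_) Finset.card_le_two
        intro y hy
        simp only [Finset.mem_filter, Finset.mem_univ, true_and] at hy hy0
        have : y ^ 2 = y0 ^ 2 := by linear_combination hy - hy0
        simpa using sq_eq_sq_iff_eq_or_eq_neg.1 this
    exact_mod_cast this
  refine (Finset.sum_le_sum fun x _ => this x).trans ?_
  simp [ZMod.card, mul_comm]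

open Classical in
-- The line is parametrized by `t ↦ (t a, -t b)`. The origin is left out because it is where
-- distinct lines and the norm-zero set meet.
theorem le_sum_line {b a : ZMod q} (h : b ≠ 0 ∨ a ≠ 0) :
    (q : ℝ) - 1 ≤ ∑ x : ZMod q, ∑ y : ZMod q,
      (if b * x + a * y = 0 ∧ ¬ (x = 0 ∧ y = 0) then (1 : ℝ) else 0) := by
  rw [← Finset.sum_product', Finset.sum_boole]
  have h1 : ((Finset.univ : Finset (ZMod q)).erase 0).card ≤ ((Finset.univ ×ˢ Finset.univ).filter
      fun p : ZMod q × ZMod q => b * p.1 + a * p.2 = 0 ∧ ¬ (p.1 = 0 ∧ p.2 = 0)).card := by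
    refine Finset.card_le_card_of_injOn (fun t => (t * a, -(t * b))) ?_ ?_
    · intro t ht
      simp only [Finset.coe_erase, Finset.coe_univ, Set.mem_sdiff, Set.mem_singleton_iff] at ht
      simp only [Finset.coe_filter, Finset.mem_product, Finset.mem_univ, true_and, Set.mem_ofPred_eq]
      refine ⟨by ring, ?_⟩
      rintro ⟨h1, h2⟩
      rcases h with hb | ha
      · exact hb ((mul_eq_zero.1 (neg_eq_zero.1 h2)).resolve_left ht.2)
      · exact ha ((mul_eq_zero.1 h1).resolve_left ht.2)
    · intro t _ t' _ htt
      simp only [Prod.mk.injEq, neg_inj] at htt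
      rcases h with hb | ha
      · exact mul_right_cancel₀ hb htt.2
      · exact mul_right_cancel₀ ha htt.1
  rw [Finset.card_erase_of_mem (Finset.mem_univ _), Finset.card_univ, ZMod.card] at h1
  have h2 : (q : ℝ) - 1 = ((q - 1 : ℕ) : ℝ) := by
    rw [Nat.cast_sub (Fact.out : q.Prime).one_lt.le]; simp
  rw [h2]
  exact_mod_cast h1

open Classical in
-- If `q ≡ 1 mod 4` and `i ^ 2 = -1`, each `y ≠ 0` yields the two solutions `x = ± i y`. If `q ≡ 3
-- mod 4` the left side is `0`.
theorem le_sum_norm_zero (hq2 : q ≠ 2) :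
    (1 + chi q) * ((q : ℝ) - 1) ≤ ∑ x : ZMod q, ∑ y : ZMod q,
      (if x ^ 2 + y ^ 2 = 0 ∧ ¬ (x = 0 ∧ y = 0) then (1 : ℝ) else 0) := by
  have hq := (Fact.out : q.Prime)
  have hodd := hq.eq_two_or_odd.resolve_left hq2
  by_cases h4 : q % 4 = 1
  · have hchi : chi q = 1 := by rw [chi_eq, if_neg (by omega), if_pos h4]
    obtain ⟨i, hi⟩ := ZMod.exists_sq_eq_neg_one_iff.2 (by omega : q % 4 ≠ 3)
    have hi0 : i ≠ 0 := by rintro rfl; simp at hi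
    have h2 : (2 : ZMod q) ≠ 0 := by
      have : ((2 : ℕ) : ZMod q) ≠ 0 := by
        rw [Ne, ZMod.natCast_eq_zero_iff]
        intro h
        exact hq2 ((Nat.prime_dvd_prime_iff_eq hq Nat.prime_two).1 h)
      simpa using this
    have hsum : ∀ y : ZMod q, y ≠ 0 →
        (2 : ℝ) ≤ ∑ x : ZMod q, (if x ^ 2 + y ^ 2 = 0 ∧ ¬ (x = 0 ∧ y = 0) then (1 : ℝ) else 0) := by
      intro y hy
      rw [Finset.sum_boole]
      have : ({i * y, -(i * y)} : Finset (ZMod q)).card ≤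
          (Finset.univ.filter fun x : ZMod q => x ^ 2 + y ^ 2 = 0 ∧ ¬ (x = 0 ∧ y = 0)).card := by
        refine Finset.card_le_card ?_
        intro x hx
        simp only [Finset.mem_insert, Finset.mem_singleton] at hx
        simp only [Finset.mem_filter, Finset.mem_univ, true_and, hy, and_false, not_false_eq_true,
          and_true]
        rcases hx with rfl | rfl <;> linear_combination (-y ^ 2) * hi
      rw [Finset.card_pair] at this
      · exact_mod_cast this
      · intro h
        have : 2 * (i * y) = 0 := by linear_combination h
        simp [h2, hi0, hy] at this
    rw [hchi, Finset.sum_comm]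
    calc (1 + 1) * ((q : ℝ) - 1) = ∑ y ∈ (Finset.univ : Finset (ZMod q)).erase 0, (2 : ℝ) := by
          rw [Finset.sum_const, Finset.card_erase_of_mem (Finset.mem_univ _), Finset.card_univ,
            ZMod.card, nsmul_eq_mul, Nat.cast_sub hq.one_lt.le]
          push_cast; ring
      _ ≤ ∑ y ∈ (Finset.univ : Finset (ZMod q)).erase 0, ∑ x : ZMod q,
          (if x ^ 2 + y ^ 2 = 0 ∧ ¬ (x = 0 ∧ y = 0) then (1 : ℝ) else 0) :=
          Finset.sum_le_sum fun y hy => hsum y (Finset.ne_of_mem_erase hy)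
      _ ≤ _ := Finset.sum_le_sum_of_subset_of_nonneg (Finset.erase_subset _ _) fun y _ _ =>
          Finset.sum_nonneg fun x _ => by split_ifs <;> norm_num
  · have hchi : chi q = -1 := by rw [chi_eq, if_neg (by omega), if_neg h4]
    rw [hchi]
    simp only [add_neg_cancel, zero_mul]
    exact Finset.sum_nonneg fun x _ => Finset.sum_nonneg fun y _ => by split_ifs <;> norm_num

end

/-- Conditions under which the linear forms attached to `γ` are in general position modulo `q`. -/
def GoodPrime {ℓ : ℕ} (γ : Fin ℓ → GaussianInt) (M : ℕ) (q : ℕ) : Prop :=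
  ¬ q ∣ M ∧ ∀ i j, i ≠ j → ¬ (q : ℤ) ∣ (γ i).im * (γ j).re - (γ i).re * (γ j).im

/-- The upper bound is a union bound over `ℓ` lines and the norm-zero set, which has at most `2 q`
points. For the lower bound the origin is removed: the lines are then disjoint because the
determinants are invertible, and they miss the norm-zero set because `M` is invertible, so the
counts add. -/
theorem mean2_localWeight_bounds {z : ℝ} (hz0 : 0 < z) (hz1 : z < 1) {ℓ : ℕ}
    {γ : Fin ℓ → GaussianInt} {M : ℕ} (hγ : ∀ i, (γ i).norm = M) {q : ℕ} (hq : q.Prime)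
    (hq2 : q ≠ 2) (hgood : GoodPrime γ M q) :
    mean2 (localWeight z γ q) q ≤ (ℓ + 2) / q ∧
    (ℓ + (1 - z) * (1 + chi q)) / q - (ℓ + 2) / (q : ℝ) ^ 2 ≤ mean2 (localWeight z γ q) q := by
  classical
  have : Fact q.Prime := ⟨hq⟩
  have hq0 : (0 : ℝ) < q := by exact_mod_cast hq.pos
  have hM : (M : ZMod q) ≠ 0 := by rw [Ne, ZMod.natCast_eq_zero_iff]; exact hgood.1
  have hnorm : ∀ i, ((γ i).re : ZMod q) ^ 2 + ((γ i).im : ZMod q) ^ 2 = M := by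
    intro i
    have := congrArg (Int.cast : ℤ → ZMod q) (hγ i)
    rw [Zsqrtd.norm_def] at this
    push_cast at this
    linear_combination this
  have hne : ∀ i, ((γ i).im : ZMod q) ≠ 0 ∨ ((γ i).re : ZMod q) ≠ 0 := by
    intro i
    by_contra! h
    apply hM
    rw [← hnorm i, h.1, h.2]; ring
  have hdet : ∀ i j, i ≠ j → ((γ i).im : ZMod q) * (γ j).re - (γ i).re * (γ j).im ≠ 0 := by
    intro i j hij h
    apply hgood.2 i j hij
    rw [← ZMod.intCast_zmod_eq_zero_iff_dvd]; push_cast; exact h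
  let G : ZMod q → ZMod q → ℝ := fun x y =>
    if ∃ i, ((γ i).im : ZMod q) * x + ((γ i).re : ZMod q) * y = 0 then 1
      else if x ^ 2 + y ^ 2 = 0 then 1 - z else 0
  have hmean : mean2 (localWeight z γ q) q = (∑ x, ∑ y, G x y) / (q : ℝ) ^ 2 := by
    unfold mean2
    rw [← sum_range_eq_sum_zmod]
    simp only [localWeight_eq, G]
  rw [hmean]
  constructor
  · have hle : ∀ x y, G x y ≤ ∑ i, (if ((γ i).im : ZMod q) * x + ((γ i).re : ZMod q) * y = 0
        then (1 : ℝ) else 0) + (if x ^ 2 + y ^ 2 = 0 then (1 : ℝ) else 0) := by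
      intro x y
      have hs0 : 0 ≤ ∑ i, (if ((γ i).im : ZMod q) * x + ((γ i).re : ZMod q) * y = 0
        then (1 : ℝ) else 0) := Finset.sum_nonneg fun i _ => by split_ifs <;> norm_num
      simp only [G]
      by_cases h : ∃ i, ((γ i).im : ZMod q) * x + ((γ i).re : ZMod q) * y = 0
      · rw [if_pos h]
        obtain ⟨i, hi⟩ := h
        have := Finset.single_le_sum (f := fun i => if ((γ i).im : ZMod q) * x +
          ((γ i).re : ZMod q) * y = 0 then (1 : ℝ) else 0)
          (fun i _ => by split_ifs <;> norm_num) (Finset.mem_univ i)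
        simp only [hi, if_true] at this
        have h2 : (0 : ℝ) ≤ if x ^ 2 + y ^ 2 = 0 then (1 : ℝ) else 0 := by
          split_ifs <;> norm_num
        linarith
      · rw [if_neg h]
        split_ifs <;> linarith
    have : ∑ x, ∑ y, G x y ≤ ℓ * q + 2 * q := by
      refine (Finset.sum_le_sum fun x _ => Finset.sum_le_sum fun y _ => hle x y).trans ?_
      simp only [Finset.sum_add_distrib]
      refine add_le_add ?_ sum_norm_zero_le
      rw [Finset.sum_congr rfl fun x _ => Finset.sum_comm, Finset.sum_comm]
      refine (Finset.sum_le_sum fun i _ => sum_line_le (hne i)).trans ?_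
      simp
    rw [div_le_div_iff₀ (by positivity) hq0]
    nlinarith
  · have hge : ∀ x y, ∑ i, (if ((γ i).im : ZMod q) * x + ((γ i).re : ZMod q) * y = 0 ∧
        ¬ (x = 0 ∧ y = 0) then (1 : ℝ) else 0) +
        (1 - z) * (if x ^ 2 + y ^ 2 = 0 ∧ ¬ (x = 0 ∧ y = 0) then (1 : ℝ) else 0) ≤ G x y := by
      intro x y
      simp only [G]
      by_cases h0 : x = 0 ∧ y = 0
      · have hf : ∀ c : Prop, ¬ (c ∧ ¬ (x = 0 ∧ y = 0)) := fun c h => h.2 h0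
        rw [Finset.sum_eq_zero fun i _ => if_neg (hf _), if_neg (hf _), mul_zero, add_zero]
        split_ifs <;> linarith
      · simp only [h0, not_false_eq_true, and_true]
        by_cases h : ∃ i, ((γ i).im : ZMod q) * x + ((γ i).re : ZMod q) * y = 0
        · rw [if_pos h]
          obtain ⟨i, hi⟩ := h
          rw [Finset.sum_eq_single i, if_pos hi, if_neg, mul_zero, add_zero]
          · intro hN
            apply h0
            -- A zero of the form gives `im ^ 2 x ^ 2 = re ^ 2 y ^ 2`; combined with `x ^ 2 + y ^ 2
            -- = 0` and `re ^ 2 + im ^ 2 = M` this forces `M x ^ 2 = 0`, and likewise for `y`.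
            have e1 : (M : ZMod q) * x ^ 2 = 0 := by
              linear_combination (-x ^ 2) * hnorm i + ((γ i).re : ZMod q) ^ 2 * hN
                + (((γ i).im : ZMod q) * x - ((γ i).re : ZMod q) * y) * hi
            have e2 : (M : ZMod q) * y ^ 2 = 0 := by
              linear_combination (-y ^ 2) * hnorm i + ((γ i).im : ZMod q) ^ 2 * hN
                + (((γ i).re : ZMod q) * y - ((γ i).im : ZMod q) * x) * hi
            exact ⟨by simpa [hM] using e1, by simpa [hM] using e2⟩
          · intro j _ hj
            rw [if_neg]
            intro hj0
            apply h0
            have hd := hdet j i hj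
            have e1 : (((γ j).im : ZMod q) * (γ i).re - (γ j).re * (γ i).im) * x = 0 := by
              linear_combination ((γ i).re : ZMod q) * hj0 - ((γ j).re : ZMod q) * hi
            have e2 : (((γ j).im : ZMod q) * (γ i).re - (γ j).re * (γ i).im) * y = 0 := by
              linear_combination ((γ j).im : ZMod q) * hi - ((γ i).im : ZMod q) * hj0
            exact ⟨(mul_eq_zero.1 e1).resolve_left hd, (mul_eq_zero.1 e2).resolve_left hd⟩
          · simp
        · rw [if_neg h, Finset.sum_eq_zero, zero_add]
          · split_ifs <;> simp
          · intro i _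
            rw [if_neg fun hi => h ⟨i, hi⟩]
    have : ℓ * ((q : ℝ) - 1) + (1 - z) * ((1 + chi q) * ((q : ℝ) - 1)) ≤ ∑ x, ∑ y, G x y := by
      refine le_trans ?_ (Finset.sum_le_sum fun x _ => Finset.sum_le_sum fun y _ => hge x y)
      simp only [Finset.sum_add_distrib, ← Finset.mul_sum]
      refine add_le_add ?_ (mul_le_mul_of_nonneg_left (le_sum_norm_zero hq2) (by linarith))
      rw [Finset.sum_congr rfl fun x _ => Finset.sum_comm, Finset.sum_comm]
      refine le_trans ?_ (Finset.sum_le_sum fun i _ => le_sum_line (hne i))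
      rw [Finset.sum_const, Finset.card_univ, Fintype.card_fin, nsmul_eq_mul]
    rw [le_div_iff₀ (by positivity), sub_mul, div_mul_cancel₀ _ (by positivity), sq, ← mul_assoc,
      div_mul_cancel₀ _ hq0.ne']
    have hchi := abs_le.1 (abs_chi_le q)
    nlinarith [hchi.1, hchi.2, mul_nonneg (sub_nonneg.2 hz1.le) (sub_nonneg.2 hchi.2)]

/-! ### The sieve bound for a square of Gaussian integers -/

theorem card_primeFactors_mul_log_two_le {R : ℕ} (hR : R ≠ 0) :
    (R.primeFactors.card : ℝ) * Real.log 2 ≤ Real.log R := by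
  have h1 : 2 ^ R.primeFactors.card ≤ R := by
    refine le_trans ?_ (Nat.le_of_dvd (Nat.pos_of_ne_zero hR) (Nat.prod_primeFactors_dvd R))
    exact Finset.pow_card_le_prod _ _ _ fun p hp => (Nat.prime_of_mem_primeFactors hp).two_le
  rw [← Real.log_pow]
  exact Real.log_le_log (by positivity) (by exact_mod_cast h1)

theorem one_le_log_of_sixteen_le {x : ℝ} (hx : 16 ≤ x) : Real.exp 1 ≤ Real.log x := by
  have h1 : Real.log 16 ≤ Real.log x := Real.log_le_log (by norm_num) hx
  have h2 : Real.log 16 = 4 * Real.log 2 := by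
    rw [show (16 : ℝ) = 2 ^ 4 by norm_num, Real.log_pow]; norm_num
  linarith [Real.log_two_gt_d9, Real.exp_one_lt_d9]

theorem one_le_L {x : ℝ} (hx : 16 ≤ x) : 1 ≤ L x := by
  have := one_le_log_of_sixteen_le hx
  unfold L
  rw [Real.le_log_iff_exp_le (lt_of_lt_of_le (Real.exp_pos 1) this)]
  exact this

/-- The sum of the reciprocals of the prime factors of a number bounded by a power of `x`. -/
theorem exists_sum_inv_primeFactors_le (k : ℕ) : ∃ C : ℝ, 0 ≤ C ∧ ∀ x : ℝ, 16 ≤ x → ∀ R : ℕ, R ≠ 0 →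
    (R : ℝ) ≤ x ^ k → ∑ p ∈ R.primeFactors, 1 / (p : ℝ) ≤ Real.log (L x) + C := by
  obtain ⟨C, hC⟩ := exists_abs_sum_inv_prime_sub_loglog_le
  have hC0 : 0 ≤ C := (abs_nonneg _).trans (hC 2 le_rfl)
  have hl2 : 0 < Real.log 2 := Real.log_pos (by norm_num)
  refine ⟨C + k / Real.log 2, by positivity, fun x hx R hR hRx => ?_⟩
  have hlx := one_le_log_of_sixteen_le hx
  have he : 2 ≤ Real.exp 1 := by linarith [Real.exp_one_gt_d9]
  -- The prime factors are split at `log x`. The small ones contribute at most `log L` plus a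
  -- constant by Mertens; there are `O(log x)` large ones, each with reciprocal below `1 / log x`.
  set N := ⌊Real.log x⌋₊ with hN
  have hN2 : 2 ≤ N := Nat.le_floor (by push_cast; linarith)
  have hNx : (N : ℝ) ≤ Real.log x := Nat.floor_le (by linarith)
  have hNx' : Real.log x < N + 1 := Nat.lt_floor_add_one _
  rw [← Finset.sum_filter_add_sum_filter_not _ (fun p => p ≤ N)]
  have h1 : ∑ p ∈ R.primeFactors.filter (fun p => p ≤ N), 1 / (p : ℝ) ≤ Real.log (L x) + C := by
    have h2 : ∑ p ∈ R.primeFactors.filter (fun p => p ≤ N), 1 / (p : ℝ) ≤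
        ∑ p ∈ (Finset.Ico 2 (N + 1)).filter Nat.Prime, 1 / (p : ℝ) := by
      refine Finset.sum_le_sum_of_subset_of_nonneg (fun p hp => ?_) fun _ _ _ => by positivity
      rw [Finset.mem_filter] at hp
      have hpp := Nat.prime_of_mem_primeFactors hp.1
      simp only [Finset.mem_filter, Finset.mem_Ico]
      exact ⟨⟨hpp.two_le, by omega⟩, hpp⟩
    have h3 := (abs_le.1 (hC N hN2)).2
    have hN2' : (2 : ℝ) ≤ N := by exact_mod_cast hN2
    have h4 : Real.log (Real.log N) ≤ Real.log (L x) :=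
      Real.log_le_log (Real.log_pos (by linarith)) (Real.log_le_log (by linarith) hNx)
    linarith
  have h2 : ∑ p ∈ R.primeFactors.filter (fun p => ¬ p ≤ N), 1 / (p : ℝ) ≤ k / Real.log 2 := by
    calc _ ≤ ∑ p ∈ R.primeFactors.filter (fun p => ¬ p ≤ N), 1 / Real.log x := by
          refine Finset.sum_le_sum fun p hp => ?_
          rw [Finset.mem_filter] at hp
          have : ((N + 1 : ℕ) : ℝ) ≤ p := by exact_mod_cast (by omega : N + 1 ≤ p)
          push_cast at this
          exact one_div_le_one_div_of_le (by linarith) (by linarith)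
      _ ≤ ∑ p ∈ R.primeFactors, 1 / Real.log x :=
          Finset.sum_le_sum_of_subset_of_nonneg (Finset.filter_subset _ _) fun _ _ _ =>
            one_div_nonneg.2 (by linarith)
      _ = R.primeFactors.card / Real.log x := by
          rw [Finset.sum_const, nsmul_eq_mul]; ring
      _ ≤ _ := by
          rw [div_le_div_iff₀ (by linarith) hl2]
          refine (card_primeFactors_mul_log_two_le hR).trans ?_
          rw [← Real.log_pow]
          exact Real.log_le_log (by exact_mod_cast Nat.pos_of_ne_zero hR) hRx
  linarith

theorem exists_le_sum_inv_prime_floor :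
    ∃ C : ℝ, 0 ≤ C ∧ ∀ Y : ℝ, 1 < Y → Real.log (Real.log Y) - C ≤
      ∑ p ∈ (Finset.Ico 2 (⌊Y⌋₊ + 1)).filter Nat.Prime, 1 / (p : ℝ) := by
  obtain ⟨C, hC⟩ := exists_abs_sum_inv_prime_sub_loglog_le
  have hC0 : 0 ≤ C := (abs_nonneg _).trans (hC 2 le_rfl)
  have hl2 : 0 < Real.log 2 := Real.log_pos (by norm_num)
  refine ⟨C + Real.log 2, by positivity, fun Y hY => ?_⟩
  have hlY : 0 < Real.log Y := Real.log_pos hY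
  rcases Nat.lt_or_ge ⌊Y⌋₊ 2 with h | h
  · have hY2 : Y < 2 := by
      have := (Nat.floor_lt (by linarith)).1 h
      exact_mod_cast this
    have : Real.log (Real.log Y) ≤ 0 := by
      refine Real.log_nonpos hlY.le ?_
      have := Real.log_le_log (by linarith) hY2.le
      linarith [Real.log_two_lt_d9]
    have h3 : 0 ≤ ∑ p ∈ (Finset.Ico 2 (⌊Y⌋₊ + 1)).filter Nat.Prime, 1 / (p : ℝ) :=
      Finset.sum_nonneg fun _ _ => by positivity
    linarith
  · have h1 := (abs_le.1 (hC _ h)).1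
    have h' : (2 : ℝ) ≤ (⌊Y⌋₊ : ℝ) := by exact_mod_cast h
    have hlN : 0 < Real.log (⌊Y⌋₊ : ℝ) := Real.log_pos (by linarith)
    -- Since `⌊Y⌋ ≥ 2`, one has `Y < ⌊Y⌋ + 1 ≤ ⌊Y⌋ ^ 2`, so the floor costs at most `log 2` after
    -- the second logarithm.
    have h2 : Real.log Y ≤ 2 * Real.log (⌊Y⌋₊ : ℝ) := by
      have e : 2 * Real.log (⌊Y⌋₊ : ℝ) = Real.log ((⌊Y⌋₊ : ℝ) ^ 2) := by
        rw [Real.log_pow]; norm_num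
      rw [e]
      refine Real.log_le_log (by linarith) ?_
      have := Nat.lt_floor_add_one Y
      nlinarith
    have h3 : Real.log (Real.log Y) ≤ Real.log 2 + Real.log (Real.log (⌊Y⌋₊ : ℝ)) := by
      rw [← Real.log_mul two_ne_zero hlN.ne']
      exact Real.log_le_log hlY h2
    linarith

/-- `z` to the number of odd prime factors of `n` that do not divide `M`. -/
noncomputable def oddWeight (z : ℝ) (M n : ℕ) : ℝ :=
  z ^ (n.primeFactors.filter fun q => Odd q ∧ ¬ q ∣ M).card

theorem oddWeight_nonneg {z : ℝ} (hz0 : 0 < z) (M n : ℕ) : 0 ≤ oddWeight z M n := by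
  unfold oddWeight; positivity

theorem oddWeight_le_one {z : ℝ} (hz0 : 0 < z) (hz1 : z < 1) (M n : ℕ) : oddWeight z M n ≤ 1 :=
  pow_le_one₀ hz0.le hz1.le

theorem sum_Icc_int_eq (f : ℤ → ℝ) (H : ℕ) :
    ∑ u ∈ Finset.Icc (-(H : ℤ)) H, f u = ∑ i ∈ Finset.range (2 * H + 1), f (-(H : ℤ) + i) := by
  symm
  refine Finset.sum_nbij (fun i : ℕ => -(H : ℤ) + i) ?_ ?_ ?_ fun _ _ => rfl
  · intro i hi
    rw [Finset.mem_range] at hi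
    rw [Finset.mem_Icc]; omega
  · intro i _ j _ h
    simp only at h; omega
  · intro u hu
    simp only [Finset.coe_Icc, Set.mem_Icc] at hu
    refine ⟨(u + H).toNat, ?_, ?_⟩
    · simp only [Finset.coe_range, Set.mem_Iio]; omega
    · simp only; omega

open Classical in
/-- The number of points of a square where a nonzero linear form is small. -/
theorem sum_small_form_le {b a : ℤ} (hab : b ≠ 0 ∨ a ≠ 0) {Y : ℝ} (hY : 1 ≤ Y) {H : ℕ}
    (hH : 1 ≤ H) :
    ∑ u ∈ Finset.Icc (-(H : ℤ)) H, ∑ v ∈ Finset.Icc (-(H : ℤ)) H,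
      (if (((b * u + a * v).natAbs : ℕ) : ℝ) ≤ Y then (1 : ℝ) else 0) ≤ 9 * H * Y := by
  have hHr : (1 : ℝ) ≤ H := by exact_mod_cast hH
  have hfl : (⌊Y⌋₊ : ℝ) ≤ Y := Nat.floor_le (by linarith)
  have aux : ∀ {b a : ℤ}, a ≠ 0 →
      ∑ u ∈ Finset.Icc (-(H : ℤ)) H, ∑ v ∈ Finset.Icc (-(H : ℤ)) H,
      (if (((b * u + a * v).natAbs : ℕ) : ℝ) ≤ Y then (1 : ℝ) else 0) ≤ 9 * H * Y := by
    intro b a ha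
    -- For fixed `u` the form is injective in `v`, so it takes small values at most `2 ⌊Y⌋ + 1 ≤ 3
    -- Y` times; the number of `u` is at most `3 H`.
    have h1 : ∀ u : ℤ, ∑ v ∈ Finset.Icc (-(H : ℤ)) H,
        (if (((b * u + a * v).natAbs : ℕ) : ℝ) ≤ Y then (1 : ℝ) else 0) ≤ 3 * Y := by
      intro u
      rw [Finset.sum_boole]
      have hc : ((Finset.Icc (-(H : ℤ)) H).filter
          fun v => (((b * u + a * v).natAbs : ℕ) : ℝ) ≤ Y).card ≤
          (Finset.Icc (-(⌊Y⌋₊ : ℤ)) ⌊Y⌋₊).card := by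
        refine Finset.card_le_card_of_injOn (fun v => b * u + a * v) ?_ ?_
        · intro v hv
          simp only [Finset.coe_filter, Set.mem_ofPred_eq] at hv
          have := Nat.le_floor hv.2
          simp only [Finset.coe_Icc, Set.mem_Icc]; omega
        · intro v _ v' _ h
          exact mul_left_cancel₀ ha (by simpa using h)
      rw [Int.card_Icc] at hc
      have : (((Finset.Icc (-(H : ℤ)) H).filter
          fun v => (((b * u + a * v).natAbs : ℕ) : ℝ) ≤ Y).card : ℝ) ≤ ((2 * ⌊Y⌋₊ + 1 : ℕ) : ℝ) := by
        exact_mod_cast hc.trans (by omega)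
      push_cast at this
      linarith
    refine (Finset.sum_le_sum fun u _ => h1 u).trans ?_
    rw [Finset.sum_const, Int.card_Icc, nsmul_eq_mul]
    have : (((H : ℤ) + 1 - -(H : ℤ)).toNat : ℝ) ≤ ((2 * H + 1 : ℕ) : ℝ) := by
      exact_mod_cast (by omega)
    push_cast at this
    nlinarith
  rcases hab with hb | ha
  · rw [Finset.sum_comm]
    simpa only [add_comm] using aux (b := a) hb
  · exact aux ha

/-- The sieve weights bound the indicator of prime values of the linear forms. -/
theorem indicator_mul_oddWeight_le {z : ℝ} (hz0 : 0 < z) (hz1 : z < 1) {ℓ : ℕ}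
    (γ : Fin ℓ → GaussianInt) (M : ℕ) {P : Finset ℕ} {Y : ℝ} (hP : ∀ q ∈ P, q.Prime ∧ Odd q ∧
      ¬ q ∣ M ∧ (q : ℝ) ≤ Y) (u v : ℤ) (huv : u ^ 2 + v ^ 2 ≠ 0)
    (hprime : ∀ i, ((γ i).im * u + (γ i).re * v).natAbs.Prime)
    (hlarge : ∀ i, Y < ((((γ i).im * u + (γ i).re * v).natAbs : ℕ) : ℝ)) :
    oddWeight z M (u ^ 2 + v ^ 2).natAbs ≤ ∏ q ∈ P, (1 - localWeight z γ q u v) := by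
  classical
  -- The forms are primes exceeding every sieve prime, so none vanishes modulo `q`; only the partial
  -- weight of the norm form survives.
  have h1 : ∏ q ∈ P, (1 - localWeight z γ q u v) =
      ∏ q ∈ P, (if (q : ℤ) ∣ u ^ 2 + v ^ 2 then z else 1) := by
    refine Finset.prod_congr rfl fun q hq => ?_
    obtain ⟨hqp, _, _, hqY⟩ := hP q hq
    unfold localWeight
    rw [if_neg]
    · split_ifs <;> ring
    · rintro ⟨i, hi⟩
      have h2 : q ∣ ((γ i).im * u + (γ i).re * v).natAbs := Int.natCast_dvd.1 hi
      have h3 := (Nat.prime_dvd_prime_iff_eq hqp (hprime i)).1 h2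
      have h4 := hlarge i
      rw [← h3] at h4
      linarith
  rw [h1, Finset.prod_ite, Finset.prod_const, Finset.prod_const_one, mul_one]
  refine pow_le_pow_of_le_one hz0.le hz1.le (Finset.card_le_card ?_)
  intro q hq
  rw [Finset.mem_filter] at hq
  obtain ⟨hqp, hqo, hqM, _⟩ := hP q hq.1
  rw [Finset.mem_filter, Nat.mem_primeFactors]
  exact ⟨⟨hqp, Int.natCast_dvd.1 hq.2, by simpa using huv⟩, hqo, hqM⟩

/-- The odd primes up to `Y` modulo which the forms attached to `γ` are in general position. -/
noncomputable def sievePrimes {ℓ : ℕ} (γ : Fin ℓ → GaussianInt) (M : ℕ) (Y : ℝ) : Finset ℕ :=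
  open Classical in (Finset.Icc 3 ⌊Y⌋₊).filter fun q => q.Prime ∧ GoodPrime γ M q

theorem mem_sievePrimes {ℓ : ℕ} {γ : Fin ℓ → GaussianInt} {M : ℕ} {Y : ℝ} {q : ℕ} :
    q ∈ sievePrimes γ M Y ↔ (3 ≤ q ∧ q ≤ ⌊Y⌋₊) ∧ q.Prime ∧ GoodPrime γ M q := by
  simp [sievePrimes]

/-- Take `R = 2 M` times all the determinants, with `1` on the diagonal. By the
Brahmagupta–Fibonacci identity each determinant is at most `M` in absolute value, so `R` is bounded
by a fixed power of `x` and its prime factors cost only a power of `L`. -/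
theorem exists_bad_modulus {ℓ : ℕ} {γ : Fin ℓ → GaussianInt} {M : ℕ} (hM : 0 < M) {x : ℝ}
    (hx : 16 ≤ x) (hMx : (M : ℝ) ≤ x) (hγ : ∀ i, (γ i).norm = M)
    (hdet : ∀ i j, i ≠ j → (γ i).im * (γ j).re - (γ i).re * (γ j).im ≠ 0) :
    ∃ R : ℕ, R ≠ 0 ∧ (R : ℝ) ≤ x ^ (2 + ℓ * ℓ) ∧ 2 ∣ R ∧ ∀ q, ¬ GoodPrime γ M q → q ∣ R := by
  classical
  let D : Fin ℓ × Fin ℓ → ℕ := fun p =>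
    if p.1 = p.2 then 1 else ((γ p.1).im * (γ p.2).re - (γ p.1).re * (γ p.2).im).natAbs
  have hDle : ∀ p, D p ≤ M := by
    intro p
    simp only [D]
    split_ifs
    · exact hM
    · have h1 := hγ p.1
      have h2 := hγ p.2
      rw [Zsqrtd.norm_def] at h1 h2
      have h3 : ((γ p.1).im * (γ p.2).re - (γ p.1).re * (γ p.2).im) ^ 2 ≤ (M : ℤ) ^ 2 := by
        have e : (M : ℤ) ^ 2 = ((γ p.1).re ^ 2 + (γ p.1).im ^ 2) * ((γ p.2).re ^ 2 + (γ p.2).im ^ 2) := by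
          rw [sq (M : ℤ)]
          nth_rewrite 1 [← h1]
          rw [← h2]; ring
        rw [e]
        nlinarith [sq_nonneg ((γ p.1).im * (γ p.2).im + (γ p.1).re * (γ p.2).re)]
      have := sq_le_sq.1 h3
      rw [Nat.abs_cast] at this
      zify
      exact this
  refine ⟨2 * M * ∏ p, D p, ?_, ?_, ⟨M * ∏ p, D p, by ring⟩, ?_⟩
  · refine mul_ne_zero (by omega) (Finset.prod_ne_zero_iff.2 fun p _ => ?_)
    simp only [D]
    split_ifs with h
    · simp
    · simpa using hdet p.1 p.2 h
  · push_cast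
    calc (2 : ℝ) * M * ∏ p, (D p : ℝ) ≤ x * x * ∏ p : Fin ℓ × Fin ℓ, x := by
          gcongr
          · linarith
          · exact (by exact_mod_cast hDle _ : ((D _ : ℕ) : ℝ) ≤ M).trans hMx
      _ = _ := by
          rw [Finset.prod_const, Finset.card_univ, Fintype.card_prod, Fintype.card_fin, pow_add]
          ring
  · intro q hq
    unfold GoodPrime at hq
    by_cases h : q ∣ M
    · exact Dvd.dvd.mul_right (Dvd.dvd.mul_left h 2) _
    · push Not at hq
      obtain ⟨i, j, hij, hd⟩ := hq h
      refine Dvd.dvd.mul_left (dvd_trans ?_ (Finset.dvd_prod_of_mem D (Finset.mem_univ (i, j)))) _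
      simp only [D, hij, if_false]
      exact Int.natCast_dvd.1 hd

/-- A lower bound for the sifting density. -/
theorem exists_le_sum_mean2 {z : ℝ} (hz0 : 0 < z) (hz1 : z < 1) (ℓ : ℕ) :
    ∃ C : ℝ, 0 ≤ C ∧ ∀ x : ℝ, 16 ≤ x → ∀ M : ℕ, 0 < M → (M : ℝ) ≤ x →
      ∀ γ : Fin ℓ → GaussianInt, (∀ i, (γ i).norm = M) →
      (∀ i j, i ≠ j → (γ i).im * (γ j).re - (γ i).re * (γ j).im ≠ 0) → ∀ Y : ℝ, 1 < Y →
      (ℓ + 1 - z) * Real.log (Real.log Y) - (ℓ + 2) * Real.log (L x) - C ≤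
        ∑ q ∈ sievePrimes γ M Y, mean2 (localWeight z γ q) q := by
  classical
  obtain ⟨C₁, hC₁0, hC₁⟩ := exists_sum_inv_primeFactors_le (2 + ℓ * ℓ)
  obtain ⟨C₂, hC₂0, hC₂⟩ := exists_le_sum_inv_prime_floor
  obtain ⟨C₃, hC₃⟩ := exists_abs_sum_chi_div_prime_le
  have hC₃0 : 0 ≤ C₃ := (abs_nonneg _).trans (hC₃ 0)
  have hκ : 0 ≤ (ℓ : ℝ) + 1 - z := by
    have : (0 : ℝ) ≤ ℓ := Nat.cast_nonneg _
    linarith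
  refine ⟨(ℓ + 1 - z) * C₂ + C₃ + (ℓ + 2) * C₁ + (ℓ + 2), by positivity, ?_⟩
  intro x hx M hM hMx γ hγ hdet Y hY
  obtain ⟨R, hR0, hRx, hR2, hRbad⟩ := exists_bad_modulus hM hx hMx hγ hdet
  set P := sievePrimes γ M Y with hPdef
  set T := (Finset.Ico 2 (⌊Y⌋₊ + 1)).filter Nat.Prime with hT
  set f : ℕ → ℝ := fun q => (ℓ + (1 - z) * (1 + chi q)) / q with hf
  have hPT : P ⊆ T := by
    intro q hq
    rw [hPdef, mem_sievePrimes] at hq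
    simp only [hT, Finset.mem_filter, Finset.mem_Ico]
    exact ⟨⟨by omega, by omega⟩, hq.2.1⟩
  have hfle : ∀ q, f q ≤ (ℓ + 2) * (1 / (q : ℝ)) := by
    intro q
    have hchi := abs_le.1 (abs_chi_le q)
    simp only [hf]
    rw [mul_one_div]
    gcongr
    nlinarith
  -- The main term of the density splits into a Mertens sum and a sum of `chi q / q`; the latter is
  -- bounded, so the sieve dimension is `ℓ + 1 - z`.
  have h1 : ∑ q ∈ T, f q = (ℓ + 1 - z) * ∑ q ∈ T, 1 / (q : ℝ) + (1 - z) * ∑ q ∈ T, chi q / q := by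
    rw [Finset.mul_sum, Finset.mul_sum, ← Finset.sum_add_distrib]
    refine Finset.sum_congr rfl fun q _ => ?_
    simp only [hf]; ring
  have h2 : ∑ q ∈ T \ P, f q ≤ (ℓ + 2) * (Real.log (L x) + C₁) := by
    calc _ ≤ ∑ q ∈ T \ P, (ℓ + 2) * (1 / (q : ℝ)) := Finset.sum_le_sum fun q _ => hfle q
      _ ≤ ∑ q ∈ R.primeFactors, (ℓ + 2) * (1 / (q : ℝ)) := by
          refine Finset.sum_le_sum_of_subset_of_nonneg (fun q hq => ?_) fun _ _ _ => by positivity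
          rw [Finset.mem_sdiff, hPdef, mem_sievePrimes] at hq
          simp only [hT, Finset.mem_filter, Finset.mem_Ico] at hq
          obtain ⟨⟨⟨hq1, hq2⟩, hqp⟩, hq3⟩ := hq
          rw [Nat.mem_primeFactors]
          refine ⟨hqp, ?_, hR0⟩
          by_cases hq2' : q = 2
          · rw [hq2']; exact hR2
          · exact hRbad q fun hg => hq3 ⟨⟨by omega, by omega⟩, hqp, hg⟩
      _ ≤ _ := by
          rw [← Finset.mul_sum]
          gcongr
          exact hC₁ x hx R hR0 hRx
  have h3 : ∑ q ∈ P, ((ℓ : ℝ) + 2) / (q : ℝ) ^ 2 ≤ (ℓ : ℝ) + 2 := by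
    calc _ ≤ ∑ q ∈ Finset.Ioo 1 (⌊Y⌋₊ + 1), (ℓ + 2) * ((q : ℝ) ^ 2)⁻¹ := by
          simp only [div_eq_mul_inv]
          refine Finset.sum_le_sum_of_subset_of_nonneg (fun q hq => ?_) fun _ _ _ => by positivity
          rw [hPdef, mem_sievePrimes] at hq
          rw [Finset.mem_Ioo]; omega
      _ ≤ (ℓ + 2) * 1 := by
          rw [← Finset.mul_sum]
          gcongr
          have := sum_Ioo_inv_sq_le (α := ℝ) 1 (⌊Y⌋₊ + 1)
          norm_num at this ⊢
          linarith
      _ = _ := mul_one _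
  have h4 : ∑ q ∈ P, f q - ∑ q ∈ P, (ℓ + 2) / (q : ℝ) ^ 2 ≤
      ∑ q ∈ P, mean2 (localWeight z γ q) q := by
    rw [← Finset.sum_sub_distrib]
    refine Finset.sum_le_sum fun q hq => ?_
    rw [hPdef, mem_sievePrimes] at hq
    exact (mean2_localWeight_bounds hz0 hz1 hγ hq.2.1 (by omega) hq.2.2).2
  have h5 : ∑ q ∈ T \ P, f q + ∑ q ∈ P, f q = ∑ q ∈ T, f q := Finset.sum_sdiff hPT
  have h6 := hC₂ Y hY
  have h7 := (abs_le.1 (hC₃ ⌊Y⌋₊)).1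
  have h8 : (ℓ + 1 - z) * (Real.log (Real.log Y) - C₂) ≤ (ℓ + 1 - z) * ∑ q ∈ T, 1 / (q : ℝ) :=
    mul_le_mul_of_nonneg_left h6 hκ
  have h9 : -C₃ ≤ (1 - z) * ∑ q ∈ T, chi q / q := by nlinarith
  linarith

/-- An upper bound for the sifting density. -/
theorem exists_sum_mean2_le {z : ℝ} (hz0 : 0 < z) (hz1 : z < 1) (ℓ : ℕ) :
    ∃ C : ℝ, 0 ≤ C ∧ ∀ M : ℕ, ∀ γ : Fin ℓ → GaussianInt, (∀ i, (γ i).norm = M) → ∀ H : ℕ,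
      16 ≤ H → ∀ Y : ℝ, Y ≤ H →
      ∑ q ∈ sievePrimes γ M Y, mean2 (localWeight z γ q) q ≤ C * L H := by
  obtain ⟨C, hC⟩ := exists_abs_sum_inv_prime_sub_loglog_le
  have hC0 : 0 ≤ C := (abs_nonneg _).trans (hC 2 le_rfl)
  refine ⟨(ℓ + 2) * (1 + C), by positivity, fun M γ hγ H hH Y hYH => ?_⟩
  have hL := one_le_L (x := H) (by exact_mod_cast hH)
  have h1 := (abs_le.1 (hC H (by omega))).2
  calc _ ≤ ∑ q ∈ sievePrimes γ M Y, (ℓ + 2) * (1 / (q : ℝ)) := by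
        refine Finset.sum_le_sum fun q hq => ?_
        rw [mem_sievePrimes] at hq
        rw [mul_one_div]
        exact (mean2_localWeight_bounds hz0 hz1 hγ hq.2.1 (by omega) hq.2.2).1
    _ ≤ ∑ q ∈ (Finset.Ico 2 (H + 1)).filter Nat.Prime, (ℓ + 2) * (1 / (q : ℝ)) := by
        refine Finset.sum_le_sum_of_subset_of_nonneg (fun q hq => ?_) fun _ _ _ => by positivity
        rw [mem_sievePrimes] at hq
        have : ⌊Y⌋₊ ≤ H := Nat.floor_le_of_le hYH
        simp only [Finset.mem_filter, Finset.mem_Ico]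
        exact ⟨⟨by omega, by omega⟩, hq.2.1⟩
    _ = (ℓ + 2) * ∑ q ∈ (Finset.Ico 2 (H + 1)).filter Nat.Prime, 1 / (q : ℝ) := by
        rw [Finset.mul_sum]
    _ ≤ (ℓ + 2) * ((1 + C) * L H) := by
        gcongr
        unfold L at hL ⊢
        nlinarith
    _ = _ := by ring

/-- From `(8 S) ^ n / n! ≤ e ^ (8 S) ≤ e ^ n` and `e ^ 2 ≤ 8`. It makes the truncation error of
Brun's sieve negligible. -/
theorem pow_div_factorial_le_exp_neg {S : ℝ} (hS : 0 ≤ S) {n : ℕ} (hn : 8 * S ≤ n) :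
    S ^ n / n.factorial ≤ Real.exp (-n) := by
  have h1 := Real.pow_div_factorial_le_exp (x := 8 * S) (by positivity) n
  rw [mul_pow, mul_div_assoc] at h1
  have h8 : Real.exp (2 * n) ≤ 8 ^ n := by
    rw [mul_comm, Real.exp_nat_mul]
    gcongr
    rw [show (2 : ℝ) = 1 + 1 by norm_num, Real.exp_add]
    nlinarith [Real.exp_one_lt_d9, Real.exp_one_gt_d9]
  have h2 : Real.exp (8 * S) ≤ Real.exp n := Real.exp_le_exp.2 hn
  have h3 : 0 ≤ S ^ n / n.factorial := by positivity
  have h4 : Real.exp (2 * n) * (S ^ n / n.factorial) ≤ Real.exp (2 * n) * Real.exp (-n) := by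
    rw [← Real.exp_add]
    calc _ ≤ 8 ^ n * (S ^ n / n.factorial) := by gcongr
      _ ≤ Real.exp n := h1.trans h2
      _ = _ := by congr 1; ring
  exact le_of_mul_le_mul_left h4 (Real.exp_pos _)

open Classical in
/-- The weighted number of Gaussian integers in a square at which the linear forms attached to `γ`
take prime values. -/
noncomputable def sieveSum (z : ℝ) {ℓ : ℕ} (γ : Fin ℓ → GaussianInt) (M H : ℕ) : ℝ :=
  ∑ u ∈ Finset.Icc (-(H : ℤ)) H, ∑ v ∈ Finset.Icc (-(H : ℤ)) H,
    if u ^ 2 + v ^ 2 ≠ 0 ∧ ∀ i, ((γ i).im * u + (γ i).re * v).natAbs.Prime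
      then oddWeight z M (u ^ 2 + v ^ 2).natAbs else 0

/-- At each point either every form exceeds `Y`, and the sieve product dominates the weight, or some
form is at most `Y`, which happens at `O(H Y)` points. The side of the square is `2 H + 1`. -/
theorem sieveSum_le {z : ℝ} (hz0 : 0 < z) (hz1 : z < 1) {ℓ : ℕ} {γ : Fin ℓ → GaussianInt} {M : ℕ}
    (hM : 0 < M) (hγ : ∀ i, (γ i).norm = M) {H : ℕ} (hH : 16 ≤ H) {Y : ℝ} (hY : 1 < Y) {r : ℕ}
    (hr : Even r) :
    sieveSum z γ M H ≤ (2 * H + 1) ^ 2 *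
      (∏ q ∈ sievePrimes γ M Y, (1 - mean2 (localWeight z γ q) q) +
        (∑ q ∈ sievePrimes γ M Y, mean2 (localWeight z γ q) q) ^ (r + 1) / (r + 1).factorial) +
      2 * (2 * H + 1) * Y ^ (2 * r) + ℓ * (9 * H * Y) := by
  classical
  have hPmem : ∀ q ∈ sievePrimes γ M Y, q.Prime ∧ Odd q ∧ ¬ q ∣ M ∧ (q : ℝ) ≤ Y := by
    intro q hq
    rw [mem_sievePrimes] at hq
    refine ⟨hq.2.1, hq.2.1.odd_of_ne_two (by omega), hq.2.2.1, ?_⟩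
    exact (by exact_mod_cast hq.1.2 : (q : ℝ) ≤ ⌊Y⌋₊).trans (Nat.floor_le (by linarith))
  have hcard : ((sievePrimes γ M Y).card : ℝ) + 1 ≤ Y := by
    have h1 : (sievePrimes γ M Y).card ≤ ⌊Y⌋₊ + 1 - 3 := by
      rw [← Nat.card_Icc]
      exact Finset.card_le_card (Finset.filter_subset _ _)
    have h2 : 1 ≤ ⌊Y⌋₊ := Nat.le_floor (by push_cast; linarith)
    have h3 : (((sievePrimes γ M Y).card + 1 : ℕ) : ℝ) ≤ ⌊Y⌋₊ := by
      exact_mod_cast (by omega)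
    push_cast at h3
    exact h3.trans (Nat.floor_le (by linarith))
  have hloc := localWeight_mem hz0 hz1 γ
  have hpt : ∀ u v : ℤ, (if u ^ 2 + v ^ 2 ≠ 0 ∧ ∀ i, ((γ i).im * u + (γ i).re * v).natAbs.Prime
      then oddWeight z M (u ^ 2 + v ^ 2).natAbs else 0) ≤
      ∏ q ∈ sievePrimes γ M Y, (1 - localWeight z γ q u v) +
      ∑ i, (if ((((γ i).im * u + (γ i).re * v).natAbs : ℕ) : ℝ) ≤ Y then (1 : ℝ) else 0) := by
    intro u v
    have h1 : 0 ≤ ∏ q ∈ sievePrimes γ M Y, (1 - localWeight z γ q u v) :=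
      Finset.prod_nonneg fun q _ => by linarith [(hloc q u v).2]
    have h2 : 0 ≤ ∑ i, (if ((((γ i).im * u + (γ i).re * v).natAbs : ℕ) : ℝ) ≤ Y
        then (1 : ℝ) else 0) := Finset.sum_nonneg fun i _ => by split_ifs <;> norm_num
    split_ifs with h
    · by_cases hl : ∀ i, Y < ((((γ i).im * u + (γ i).re * v).natAbs : ℕ) : ℝ)
      · have := indicator_mul_oddWeight_le hz0 hz1 γ M hPmem u v h.1 h.2 hl
        linarith
      · push Not at hl
        obtain ⟨i, hi⟩ := hl
        have h3 := Finset.single_le_sum (f := fun i => if ((((γ i).im * u +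
          (γ i).re * v).natAbs : ℕ) : ℝ) ≤ Y then (1 : ℝ) else 0)
          (fun i _ => by split_ifs <;> norm_num) (Finset.mem_univ i)
        simp only [hi, if_true] at h3
        have := oddWeight_le_one hz0 hz1 M (u ^ 2 + v ^ 2).natAbs
        linarith
    · linarith
  unfold sieveSum
  refine (Finset.sum_le_sum fun u _ => Finset.sum_le_sum fun v _ => hpt u v).trans ?_
  simp only [Finset.sum_add_distrib]
  refine add_le_add ?_ ?_
  · rw [sum_Icc_int_eq]
    simp only [sum_Icc_int_eq]
    have := sum_prod_one_sub_le (g := localWeight z γ) (P := sievePrimes γ M Y)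
      (fun q hq => (hPmem q hq).1) (fun q _ m n => localWeight_add_left z γ q m n)
      (fun q _ m n => localWeight_add_right z γ q m n) (fun q _ m n => hloc q m n)
      (fun q hq => (hPmem q hq).2.2.2) hcard hr (-(H : ℤ)) (2 * H + 1)
    push_cast at this
    exact this
  · rw [Finset.sum_congr rfl fun u _ => Finset.sum_comm, Finset.sum_comm]
    have : ∀ i ∈ Finset.univ, ∑ u ∈ Finset.Icc (-(H : ℤ)) H, ∑ v ∈ Finset.Icc (-(H : ℤ)) H,
        (if ((((γ i).im * u + (γ i).re * v).natAbs : ℕ) : ℝ) ≤ Y then (1 : ℝ) else 0)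
        ≤ 9 * H * Y := by
      intro i _
      refine sum_small_form_le ?_ hY.le (by omega)
      by_contra! h
      have h1 := hγ i
      rw [Zsqrtd.norm_def, h.1, h.2] at h1
      simp at h1
      omega
    refine (Finset.sum_le_sum this).trans ?_
    simp

set_option maxHeartbeats 800000 in
/-- The sieve bound. -/
theorem exists_sieveSum_le {z : ℝ} (hz0 : 0 < z) (hz1 : z < 1) (ℓ : ℕ) :
    ∃ A : ℕ, ∃ C : ℝ, 0 < C ∧ ∀ x : ℝ, 16 ≤ x → ∀ H : ℕ, 16 ≤ H → (H : ℝ) ≤ x →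
      ∀ M : ℕ, 0 < M → (M : ℝ) ≤ x →
      ∀ γ : Fin ℓ → GaussianInt, (∀ i, (γ i).norm = M) →
      (∀ i j, i ≠ j → (γ i).im * (γ j).re - (γ i).re * (γ j).im ≠ 0) →
      sieveSum z γ M H ≤ C * ((H : ℝ) ^ 2 * L x ^ A * Real.log H ^ (-(ℓ + 1 - z))) := by
  obtain ⟨C₁, hC₁0, hC₁⟩ := exists_le_sum_mean2 hz0 hz1 ℓ
  obtain ⟨C₂, hC₂0, hC₂⟩ := exists_sum_mean2_le hz0 hz1 ℓ
  set κ : ℝ := ℓ + 1 - z with hκdef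
  have hℓ0 : (0 : ℝ) ≤ ℓ := Nat.cast_nonneg _
  have hκ : 0 ≤ κ := by rw [hκdef]; linarith
  -- With `r ≥ 2 C₃ log log H` the truncation degree dominates both `8 S` and `κ log log H`. Then `c
  -- = 1 / (16 C₃)` is the largest choice compatible with `Y ^ (2 r) ≤ √H`, and `D` absorbs `(log H)
  -- ^ κ` into `√H`.
  set C₃ : ℝ := 8 * (C₂ + ℓ + 1) with hC₃
  have hC₃1 : 8 ≤ C₃ := by rw [hC₃]; linarith
  set c : ℝ := 1 / (16 * C₃) with hc
  have hc0 : 0 < c := by positivity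
  set D : ℝ := (ℓ + 1).factorial * 2 ^ (ℓ + 1) with hD
  have hD0 : 0 < D := by positivity
  refine ⟨2 * ℓ + 3, 9 * (Real.exp C₁ * c ^ (-κ) + 1) + 6 * D + ℓ * (9 * D), by positivity, ?_⟩
  intro x hx H hH hHx M hM hMx γ hγ hdet
  have hH' : (16 : ℝ) ≤ H := by exact_mod_cast hH
  set h := Real.log H with hh
  have hh1 : Real.exp 1 ≤ h := one_le_log_of_sixteen_le hH'
  have hh2 : 2 ≤ h := by linarith [Real.exp_one_gt_d9]
  have hl1 : 1 ≤ L H := one_le_L hH'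
  set l := L H with hl
  have hlh : l = Real.log h := rfl
  have hlLx : l ≤ L x := Real.log_le_log (by linarith) (Real.log_le_log (by linarith) hHx)
  have hLx1 : 1 ≤ L x := hl1.trans hlLx
  set Y := Real.exp (c * h / l) with hY
  have hY1 : 1 < Y := Real.one_lt_exp_iff.2 (by positivity)
  set r := 2 * ⌈C₃ * l⌉₊ with hr
  have hr1 : 2 * (C₃ * l) ≤ r := by
    rw [hr]; push_cast; linarith [Nat.le_ceil (C₃ * l)]
  have hC₃l : 8 ≤ C₃ * l := by nlinarith
  have hr2 : (r : ℝ) ≤ 4 * (C₃ * l) := by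
    rw [hr]; push_cast; linarith [Nat.ceil_lt_add_one (by positivity : 0 ≤ C₃ * l)]
  have hr3 : 1 ≤ r := by
    have : (1 : ℝ) ≤ r := by linarith
    exact_mod_cast this
  set E := Real.exp (h / 2) with hE
  have hEE : E * E = H := by
    rw [hE, ← Real.exp_add, add_halves, hh, Real.exp_log (by linarith)]
  have hE0 : 0 < E := Real.exp_pos _
  have hYr : Y ^ (2 * r) ≤ E := by
    rw [hY, ← Real.exp_nat_mul, hE]
    refine Real.exp_le_exp.2 ?_
    push_cast
    calc 2 * (r : ℝ) * (c * h / l) ≤ 2 * (4 * (C₃ * l)) * (c * h / l) := by gcongr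
      _ = h / 2 := by rw [hc]; field_simp; norm_num
  have hYE : Y ≤ E := (le_self_pow₀ hY1.le (by omega)).trans hYr
  have hE1 : 1 ≤ E := by linarith
  have hYH : Y ≤ H := by nlinarith
  have hκh : h ^ κ ≤ D * E := by
    calc h ^ κ ≤ h ^ ((ℓ + 1 : ℕ) : ℝ) :=
          Real.rpow_le_rpow_of_exponent_le (by linarith) (by push_cast; linarith)
      _ = h ^ (ℓ + 1) := Real.rpow_natCast _ _
      _ = D * ((h / 2) ^ (ℓ + 1) / (ℓ + 1).factorial) := by
          rw [hD, div_pow]; field_simp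
      _ ≤ D * E := by
          gcongr
          exact Real.pow_div_factorial_le_exp (x := h / 2) (by positivity) _
  have hκpos : 0 < h ^ κ := Real.rpow_pos_of_pos (by linarith) _
  -- The sieve error and the small values of the forms are both of order `H √H`, which a power
  -- saving makes smaller than the main term.
  have hHE : H * E ≤ D * ((H : ℝ) ^ 2 * h ^ (-κ)) := by
    rw [Real.rpow_neg (by linarith), ← div_eq_mul_inv, mul_div_assoc', le_div_iff₀ hκpos]
    calc H * E * h ^ κ ≤ H * E * (D * E) := by gcongr
      _ = D * (H * (E * E)) := by ring
      _ = _ := by rw [hEE]; ring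
  have hden := hC₁ x hx M hM hMx γ hγ hdet Y hY1
  have hup := hC₂ M γ hγ H hH Y hYH
  set S := ∑ q ∈ sievePrimes γ M Y, mean2 (localWeight z γ q) q with hS
  have hmem : ∀ q ∈ sievePrimes γ M Y, 0 ≤ mean2 (localWeight z γ q) q ∧
      mean2 (localWeight z γ q) q ≤ 1 := fun q hq => by
    rw [mem_sievePrimes] at hq
    exact mean2_mem hq.2.1.pos (localWeight_mem hz0 hz1 γ q)
  have hS0 : 0 ≤ S := Finset.sum_nonneg fun q hq => (hmem q hq).1
  have hlogY : Real.log Y = c * h / l := by rw [hY, Real.log_exp]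
  -- The power `2 ℓ + 3` of `L` has two sources: `ℓ + 2` from the exceptional primes, and at most `ℓ
  -- + 1` from `log Y = c log H / log log H`.
  have hprod : ∏ q ∈ sievePrimes γ M Y, (1 - mean2 (localWeight z γ q) q) ≤
      Real.exp C₁ * c ^ (-κ) * (L x ^ (2 * ℓ + 3) * h ^ (-κ)) := by
    calc _ ≤ ∏ q ∈ sievePrimes γ M Y, Real.exp (-mean2 (localWeight z γ q) q) :=
          Finset.prod_le_prod (fun q hq => by linarith [(hmem q hq).2])
            fun q _ => Real.one_sub_le_exp_neg _
      _ = Real.exp (-S) := by rw [← Real.exp_sum, Finset.sum_neg_distrib]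
      _ ≤ Real.exp (C₁ + (Real.log (L x) * ((ℓ + 2 : ℕ) : ℝ) + Real.log (c * h / l) * (-κ))) := by
          refine Real.exp_le_exp.2 ?_
          rw [hlogY] at hden
          push_cast
          linarith
      _ = Real.exp C₁ * (L x ^ (ℓ + 2) * (c * h / l) ^ (-κ)) := by
          rw [Real.exp_add, Real.exp_add, ← Real.rpow_def_of_pos (by linarith),
            ← Real.rpow_def_of_pos (by positivity), Real.rpow_natCast]
      _ = Real.exp C₁ * (L x ^ (ℓ + 2) * (c ^ (-κ) * h ^ (-κ) * l ^ κ)) := by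
          rw [Real.div_rpow (by positivity) (by positivity),
            Real.mul_rpow hc0.le (by positivity), Real.rpow_neg (x := l) (by positivity), div_inv_eq_mul]
      _ ≤ Real.exp C₁ * (L x ^ (ℓ + 2) * (c ^ (-κ) * h ^ (-κ) * L x ^ (ℓ + 1))) := by
          gcongr
          calc l ^ κ ≤ l ^ ((ℓ + 1 : ℕ) : ℝ) :=
                Real.rpow_le_rpow_of_exponent_le hl1 (by push_cast; linarith)
            _ = l ^ (ℓ + 1) := Real.rpow_natCast _ _
            _ ≤ _ := by gcongr
      _ = _ := by
          rw [show 2 * ℓ + 3 = (ℓ + 2) + (ℓ + 1) by ring, pow_add]; ring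
  have hLA : 1 ≤ L x ^ (2 * ℓ + 3) := one_le_pow₀ hLx1
  have hhκ0 : 0 < h ^ (-κ) := Real.rpow_pos_of_pos (by linarith) _
  have htail : S ^ (r + 1) / (r + 1).factorial ≤ L x ^ (2 * ℓ + 3) * h ^ (-κ) := by
    have hlC₂ : 0 ≤ C₂ * l := by positivity
    have hlℓ : 0 ≤ (ℓ : ℝ) * l := by positivity
    have hexpand : C₃ * l = 8 * (C₂ * l) + 8 * (ℓ * l) + 8 * l := by rw [hC₃]; ring
    have h1 : 8 * S ≤ ((r + 1 : ℕ) : ℝ) := by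
      push_cast
      linarith
    calc _ ≤ Real.exp (-((r + 1 : ℕ) : ℝ)) := pow_div_factorial_le_exp_neg hS0 h1
      _ ≤ Real.exp (l * (-κ)) := by
          refine Real.exp_le_exp.2 ?_
          push_cast
          have : κ * l ≤ (ℓ + 1) * l := by
            gcongr; linarith
          linarith
      _ = h ^ (-κ) := by rw [hlh, ← Real.rpow_def_of_pos (by linarith)]
      _ ≤ _ := le_mul_of_one_le_left hhκ0.le hLA
  refine (sieveSum_le hz0 hz1 hM hγ hH hY1 ((even_two_mul _ : Even r))).trans ?_
  set W := L x ^ (2 * ℓ + 3) * h ^ (-κ) with hW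
  have hW0 : 0 < W := by positivity
  have hHEW : H * E ≤ D * ((H : ℝ) ^ 2 * W) := by
    refine hHE.trans ?_
    gcongr
    exact le_mul_of_one_le_left hhκ0.le hLA
  calc _ ≤ (3 * (H : ℝ)) ^ 2 * (Real.exp C₁ * c ^ (-κ) * W + W) + 2 * (3 * H) * E
        + ℓ * (9 * H * E) := by
        have : 2 * (H : ℝ) + 1 ≤ 3 * H := by linarith
        have hp0 : 0 ≤ ∏ q ∈ sievePrimes γ M Y, (1 - mean2 (localWeight z γ q) q) :=
          Finset.prod_nonneg fun q hq => by linarith [(hmem q hq).2]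
        gcongr
    _ = 9 * (H : ℝ) ^ 2 * ((Real.exp C₁ * c ^ (-κ) + 1) * W) + (6 + ℓ * 9) * (H * E) := by ring
    _ ≤ 9 * (H : ℝ) ^ 2 * ((Real.exp C₁ * c ^ (-κ) + 1) * W)
        + (6 + ℓ * 9) * (D * ((H : ℝ) ^ 2 * W)) := by gcongr
    _ = _ := by rw [hW]; ring

/-! ### Sums over Gaussian integers -/

/-- The norm of a Gaussian integer, as a natural number. -/
def nrm (α : GaussianInt) : ℕ := α.norm.natAbs

theorem cast_nrm (α : GaussianInt) : (nrm α : ℤ) = α.norm := GaussianInt.abs_natCast_norm α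

theorem cast_nrm_eq (α : GaussianInt) : (nrm α : ℤ) = α.re ^ 2 + α.im ^ 2 := by
  rw [cast_nrm, Zsqrtd.norm_def]; ring

theorem nrm_mul (α β : GaussianInt) : nrm (α * β) = nrm α * nrm β := by
  simp [nrm, Zsqrtd.norm_mul, Int.natAbs_mul]

theorem nrm_star (α : GaussianInt) : nrm (star α) = nrm α := by
  simp [nrm, Zsqrtd.norm_conj]

theorem nrm_pos {α : GaussianInt} : 0 < nrm α ↔ α ≠ 0 := by
  rw [← GaussianInt.norm_pos, ← cast_nrm]; simp

theorem natAbs_re_le {α : GaussianInt} {H : ℕ} (h : nrm α ≤ H ^ 2) : |α.re| ≤ H := by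
  have h1 := cast_nrm_eq α
  have h2 : (nrm α : ℤ) ≤ (H : ℤ) ^ 2 := by exact_mod_cast h
  exact abs_le_of_sq_le_sq (by nlinarith [sq_nonneg α.im]) (by positivity)

theorem natAbs_im_le {α : GaussianInt} {H : ℕ} (h : nrm α ≤ H ^ 2) : |α.im| ≤ H := by
  have h1 := cast_nrm_eq α
  have h2 : (nrm α : ℤ) ≤ (H : ℤ) ^ 2 := by exact_mod_cast h
  exact abs_le_of_sq_le_sq (by nlinarith [sq_nonneg α.re]) (by positivity)

/-- The nonzero Gaussian integers of norm at most `X`. -/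
noncomputable def gaussBall (X : ℕ) : Finset GaussianInt :=
  open Classical in
  ((Finset.Icc (-(X : ℤ)) X ×ˢ Finset.Icc (-(X : ℤ)) X).image fun p => (⟨p.1, p.2⟩ : GaussianInt)).filter
    fun α => 0 < nrm α ∧ nrm α ≤ X

theorem mem_gaussBall {X : ℕ} {α : GaussianInt} : α ∈ gaussBall X ↔ 0 < nrm α ∧ nrm α ≤ X := by
  classical
  unfold gaussBall
  rw [Finset.mem_filter, and_iff_right_iff_imp]
  rintro ⟨_, h⟩
  have h' : nrm α ≤ X ^ 2 := h.trans (Nat.le_self_pow two_ne_zero X)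
  have h1 := abs_le.1 (natAbs_re_le h')
  have h2 := abs_le.1 (natAbs_im_le h')
  rw [Finset.mem_image]
  exact ⟨(α.re, α.im), by simp [h1, h2], rfl⟩

theorem card_gaussBall_le (X : ℕ) : (gaussBall X).card ≤ 9 * X := by
  rcases Nat.eq_zero_or_pos X with rfl | hX
  · rw [Finset.card_eq_zero.2]
    refine Finset.eq_empty_of_forall_notMem fun α hα => ?_
    rw [mem_gaussBall] at hα; omega
  set s := Nat.sqrt X
  have hs : s * s ≤ X := Nat.sqrt_le X
  have hs1 : 1 ≤ s := Nat.le_sqrt.2 (by omega)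
  have h1 : (gaussBall X).card ≤ (Finset.Icc (-(s : ℤ)) s ×ˢ Finset.Icc (-(s : ℤ)) s).card := by
    refine Finset.card_le_card_of_injOn (fun α => (α.re, α.im)) ?_ ?_
    · intro α hα
      rw [Finset.mem_coe, mem_gaussBall] at hα
      have hn := cast_nrm_eq α
      have key : ∀ t : ℤ, t ^ 2 ≤ nrm α → -(s : ℤ) ≤ t ∧ t ≤ s := by
        intro t ht
        have h2 : t.natAbs ≤ s := by
          refine Nat.le_sqrt.2 ?_
          have h3 : ((t.natAbs * t.natAbs : ℕ) : ℤ) ≤ X := by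
            push_cast
            rw [abs_mul_abs_self, ← sq]
            exact ht.trans (by exact_mod_cast hα.2)
          exact_mod_cast h3
        omega
      have hre := key α.re (by nlinarith [sq_nonneg α.im])
      have him := key α.im (by nlinarith [sq_nonneg α.re])
      simp [hre, him]
    · intro α _ β _ h
      simp only [Prod.mk.injEq] at h
      exact Zsqrtd.ext h.1 h.2
  rw [Finset.card_product, Int.card_Icc] at h1
  have h2 : ((s : ℤ) + 1 - -(s : ℤ)).toNat = 2 * s + 1 := by omega
  rw [h2] at h1
  nlinarith

open Classical in
-- Writing `α = u + v i`, the imaginary part of `γ i * α` is the linear form of the sieve, so this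
-- is a subsum of nonnegative terms.
theorem sum_oddWeight_le_sieveSum {z : ℝ} (hz0 : 0 < z) {ℓ : ℕ} (γ : Fin ℓ → GaussianInt)
    (M : ℕ) {H : ℕ} {s : Finset GaussianInt} (hs : ∀ α ∈ s, α ≠ 0 ∧ nrm α ≤ H ^ 2 ∧
      ∀ i, (γ i * α).im.natAbs.Prime) :
    ∑ α ∈ s, oddWeight z M (nrm α) ≤ sieveSum z γ M H := by
  unfold sieveSum
  rw [← Finset.sum_product']
  set T := Finset.Icc (-(H : ℤ)) H ×ˢ Finset.Icc (-(H : ℤ)) H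
  set F : ℤ × ℤ → ℝ := fun p =>
    if p.1 ^ 2 + p.2 ^ 2 ≠ 0 ∧ ∀ i, ((γ i).im * p.1 + (γ i).re * p.2).natAbs.Prime
      then oddWeight z M (p.1 ^ 2 + p.2 ^ 2).natAbs else 0 with hF
  have hF0 : ∀ p, 0 ≤ F p := fun p => by
    simp only [hF]; split_ifs
    · exact oddWeight_nonneg hz0 _ _
    · exact le_rfl
  have hinj : Set.InjOn (fun α : GaussianInt => (α.re, α.im)) s := by
    intro α _ β _ h
    simp only [Prod.mk.injEq] at h
    exact Zsqrtd.ext h.1 h.2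
  calc ∑ α ∈ s, oddWeight z M (nrm α) = ∑ α ∈ s, F (α.re, α.im) := by
        refine Finset.sum_congr rfl fun α hα => ?_
        obtain ⟨h0, _, hp⟩ := hs α hα
        have hn := cast_nrm_eq α
        simp only [hF]
        rw [if_pos, ← hn, Int.natAbs_natCast]
        refine ⟨?_, fun i => ?_⟩
        · rw [← hn]
          have := nrm_pos.2 h0
          omega
        · have := hp i
          rw [Zsqrtd.im_mul] at this
          rwa [add_comm]
    _ = ∑ p ∈ s.image (fun α : GaussianInt => (α.re, α.im)), F p :=
        (Finset.sum_image hinj).symm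
    _ ≤ ∑ p ∈ T, F p := by
        refine Finset.sum_le_sum_of_subset_of_nonneg ?_ fun p _ _ => hF0 p
        intro p hp
        obtain ⟨α, hα, rfl⟩ := Finset.mem_image.1 hp
        have h1 := abs_le.1 (natAbs_re_le (hs α hα).2.1)
        have h2 := abs_le.1 (natAbs_im_le (hs α hα).2.1)
        simp [T, h1, h2]

theorem log_sq_le_two_mul_L {x : ℝ} (hx : 16 ≤ x) : L (x ^ 2) ≤ 2 * L x := by
  have h1 := one_le_log_of_sixteen_le hx
  have h2 : 2 ≤ Real.log x := by linarith [Real.exp_one_gt_d9]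
  unfold L
  rw [Real.log_pow]
  push_cast
  rw [Real.log_mul two_ne_zero (by linarith)]
  have := Real.log_le_log (by norm_num) h2
  linarith

/-- The dyadic bound for the logarithmic average of the weights over Gaussian integers. -/
theorem exists_sum_oddWeight_div_le {z : ℝ} (hz0 : 0 < z) (hz1 : z < 1) :
    ∃ A : ℕ, ∃ C : ℝ, 0 < C ∧ ∀ x : ℝ, 16 ≤ x → ∀ M : ℕ, 0 < M → (M : ℝ) ≤ x →
      ∑ α ∈ gaussBall ⌊x⌋₊, oddWeight z M (nrm α) / nrm α ≤ C * (L x ^ A * Real.log x ^ z) := by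
  classical
  obtain ⟨A, C, hC0, hC⟩ := exists_sieveSum_le hz0 hz1 0
  refine ⟨A + 1, 3 * 9 * 4 ^ 3 + 4 * C * (3 / Real.log 2), by
    have := Real.log_pos one_lt_two; positivity, fun x hx M hM hMx => ?_⟩
  have hl2 : 0 < Real.log 2 := Real.log_pos one_lt_two
  have hL := one_le_L hx
  have hlx := one_le_log_of_sixteen_le hx
  have hlx2 : 2 ≤ Real.log x := by linarith [Real.exp_one_gt_d9]
  set X := ⌊x⌋₊ with hX
  have hXx : (X : ℝ) ≤ x := Nat.floor_le (by linarith)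
  have hX16 : 16 ≤ X := Nat.le_floor (by exact_mod_cast hx)
  set J := Nat.log 4 X with hJ
  have hJ2 : 2 ≤ J := Nat.le_log_of_pow_le (by norm_num) (by omega)
  have hjx : ∀ j ≤ J, (4 : ℝ) ^ j ≤ x := fun j hj => by
    have : 4 ^ j ≤ X := (Nat.pow_le_pow_right (by norm_num) hj).trans
      (Nat.pow_log_le_self 4 (by omega))
    exact le_trans (by exact_mod_cast this) hXx
  have hjlog : ∀ j ≤ J, 1 ≤ j → ((j : ℝ) + 1) * Real.log 2 ≤ Real.log x := fun j hj hj1 => by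
    have h1 := Real.log_le_log (by positivity) (hjx j hj)
    rw [Real.log_pow, show (4 : ℝ) = 2 ^ 2 by norm_num, Real.log_pow] at h1
    have : (1 : ℝ) ≤ j := by exact_mod_cast hj1
    push_cast at h1
    nlinarith
  have hfib : ∑ α ∈ gaussBall X, oddWeight z M (nrm α) / nrm α =
      ∑ j ∈ Finset.range (J + 1), ∑ α ∈ (gaussBall X).filter (fun α => Nat.log 4 (nrm α) = j),
        oddWeight z M (nrm α) / nrm α := by
    refine (Finset.sum_fiberwise_of_maps_to (fun α hα => ?_) _).symm
    rw [mem_gaussBall] at hα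
    rw [Finset.mem_range, Nat.lt_succ_iff]
    exact Nat.log_mono_right hα.2
  have hlz0 : 0 < Real.log x ^ z := Real.rpow_pos_of_pos (by linarith) _
  have hlz1 : 1 ≤ Real.log x ^ z := Real.one_le_rpow (by linarith) hz0.le
  have hLA : 1 ≤ L x ^ A := one_le_pow₀ hL
  have hfiber : ∀ j ∈ Finset.range (J + 1),
      ∑ α ∈ (gaussBall X).filter (fun α => Nat.log 4 (nrm α) = j), oddWeight z M (nrm α) / nrm α ≤
      -- The shell `4 ^ j ≤ nrm α < 4 ^ (j + 1)` lies in the square with `H = 2 ^ (j + 1)`. The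
      -- sieve requires `H ≥ 16`, so the shells with `j < 3` are counted trivially.
      (if j < 3 then 9 * 4 ^ 3 else 0) +
        4 * C * (L x ^ A * (Real.log x ^ z / Real.log 2)) * (1 / ((j : ℝ) + 1)) := by
    intro j hj
    rw [Finset.mem_range, Nat.lt_succ_iff] at hj
    set s := (gaussBall X).filter (fun α => Nat.log 4 (nrm α) = j) with hs
    have hmem : ∀ α ∈ s, 4 ^ j ≤ nrm α ∧ nrm α < 4 ^ (j + 1) := by
      intro α hα
      rw [hs, Finset.mem_filter, mem_gaussBall] at hα
      rw [← hα.2]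
      exact ⟨Nat.pow_log_le_self 4 (by omega), Nat.lt_pow_succ_log_self (by norm_num) _⟩
    have hpos : 0 ≤ 4 * C * (L x ^ A * (Real.log x ^ z / Real.log 2)) * (1 / ((j : ℝ) + 1)) := by
      positivity
    have hterm : ∀ α ∈ s, oddWeight z M (nrm α) / nrm α ≤ oddWeight z M (nrm α) / 4 ^ j := by
      intro α hα
      have h1 : (4 : ℝ) ^ j ≤ nrm α := by exact_mod_cast (hmem α hα).1
      exact div_le_div_of_nonneg_left (oddWeight_nonneg hz0 _ _) (by positivity) h1
    split_ifs with hj3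
    · have h1 : ∑ α ∈ s, oddWeight z M (nrm α) / nrm α ≤ ∑ α ∈ s, (1 : ℝ) := by
        refine Finset.sum_le_sum fun α hα => ?_
        have h2 : (1 : ℝ) ≤ nrm α := by
          exact_mod_cast (Nat.one_le_pow j 4 (by norm_num)).trans (hmem α hα).1
        rw [div_le_one (by linarith)]
        exact (oddWeight_le_one hz0 hz1 _ _).trans h2
      have h2 : s.card ≤ 9 * 4 ^ 3 := by
        refine le_trans (Finset.card_le_card (t := gaussBall (4 ^ 3)) ?_) (card_gaussBall_le _)
        intro α hα
        rw [mem_gaussBall]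
        have h3 := hmem α hα
        have h4 : 4 ^ (j + 1) ≤ 4 ^ 3 := Nat.pow_le_pow_right (by norm_num) (by omega)
        have h5 : 1 ≤ 4 ^ j := Nat.one_le_pow j 4 (by norm_num)
        omega
      rw [Finset.sum_const, nsmul_eq_mul, mul_one] at h1
      have h3 : (s.card : ℝ) ≤ 9 * 4 ^ 3 := by exact_mod_cast h2
      linarith
    · rw [zero_add]
      set H := 2 ^ (j + 1) with hH
      have hH16 : 16 ≤ H := by
        rw [hH]
        calc 16 = 2 ^ 4 := by norm_num
          _ ≤ _ := Nat.pow_le_pow_right (by norm_num) (by omega)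
      have hHH : (H : ℝ) ^ 2 = 4 * 4 ^ j := by
        rw [hH]; push_cast
        rw [← pow_mul, mul_comm, pow_mul, pow_succ]; norm_num; ring
      have hHx : (H : ℝ) ≤ x := by
        have h1 := hjx j hj
        have h2 : (16 : ℝ) ≤ H := by exact_mod_cast hH16
        nlinarith
      have hb := hC x hx H hH16 hHx M hM hMx Fin.elim0 (fun i => i.elim0) (fun i => i.elim0)
      have hss := sum_oddWeight_le_sieveSum hz0 (γ := Fin.elim0) M (H := H) (s := s)
        (fun α hα => ⟨nrm_pos.1 (by
          have := (hmem α hα).1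
          have h5 : 1 ≤ 4 ^ j := Nat.one_le_pow j 4 (by norm_num)
          omega), by
          have h1 := (hmem α hα).2
          have h2 : H ^ 2 = 4 ^ (j + 1) := by
            rw [hH, ← pow_mul, mul_comm, pow_mul]; norm_num
          omega, fun i => i.elim0⟩)
      have hlogH : Real.log H = ((j : ℝ) + 1) * Real.log 2 := by
        rw [hH]; push_cast; rw [Real.log_pow]; push_cast; ring
      have hj1 := hjlog j hj (by omega)
      have hlH0 : 0 < ((j : ℝ) + 1) * Real.log 2 := by positivity
      -- Without linear forms the exponent is `z - 1`. Bounding the `z`-th power by `(log x) ^ z`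
      -- leaves `1 / (j + 1)`, whose sum over the shells costs one more power of `L`.
      have hexp : Real.log H ^ (-(((0 : ℕ) : ℝ) + 1 - z)) ≤
          (Real.log x ^ z / Real.log 2) * (1 / ((j : ℝ) + 1)) := by
        rw [hlogH, show (-(((0 : ℕ) : ℝ) + 1 - z)) = z - 1 by push_cast; ring,
          Real.rpow_sub_one hlH0.ne', div_mul_div_comm, mul_one, mul_comm (Real.log 2)]
        gcongr
      calc ∑ α ∈ s, oddWeight z M (nrm α) / nrm α
          ≤ ∑ α ∈ s, oddWeight z M (nrm α) / 4 ^ j := Finset.sum_le_sum hterm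
        _ = (∑ α ∈ s, oddWeight z M (nrm α)) / 4 ^ j := by rw [Finset.sum_div]
        _ ≤ (C * ((H : ℝ) ^ 2 * L x ^ A * ((Real.log x ^ z / Real.log 2) * (1 / ((j : ℝ) + 1))))) / 4 ^ j := by
            gcongr
            refine (hss.trans hb).trans ?_
            gcongr
        _ = _ := by rw [hHH]; field_simp
  rw [hfib]
  refine (Finset.sum_le_sum hfiber).trans ?_
  rw [Finset.sum_add_distrib, ← Finset.mul_sum]
  have h1 : ∑ j ∈ Finset.range (J + 1), (if j < 3 then (9 * 4 ^ 3 : ℝ) else 0) ≤ 3 * 9 * 4 ^ 3 := by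
    rw [← Finset.sum_filter, Finset.sum_const, nsmul_eq_mul]
    have : ((Finset.range (J + 1)).filter fun j => j < 3).card ≤ (Finset.range 3).card :=
      Finset.card_le_card fun j hj => by simp at hj ⊢; omega
    rw [Finset.card_range] at this
    have : (((Finset.range (J + 1)).filter fun j => j < 3).card : ℝ) ≤ 3 := by exact_mod_cast this
    nlinarith
  have h2 : ∑ j ∈ Finset.range (J + 1), 1 / ((j : ℝ) + 1) ≤ 3 * L x := by
    have h3 := harmonic_le_one_add_log (J + 1)
    have e : ((harmonic (J + 1) : ℚ) : ℝ) = ∑ j ∈ Finset.range (J + 1), 1 / ((j : ℝ) + 1) := by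
      rw [harmonic]; push_cast
      exact Finset.sum_congr rfl fun j _ => by rw [one_div]
    rw [e] at h3
    refine h3.trans ?_
    have h4 := hjlog J le_rfl (by omega)
    have h5 : ((J + 1 : ℕ) : ℝ) ≤ 2 * Real.log x := by
      push_cast
      nlinarith [Real.log_two_gt_d9]
    have h6 := Real.log_le_log (by positivity) h5
    rw [Real.log_mul two_ne_zero (by linarith)] at h6
    unfold L at hL ⊢
    linarith [Real.log_two_lt_d9]
  have h3 : (1 : ℝ) ≤ L x ^ (A + 1) * Real.log x ^ z :=
    one_le_mul_of_one_le_of_one_le (one_le_pow₀ hL) hlz1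
  calc _ ≤ 3 * 9 * 4 ^ 3 * (L x ^ (A + 1) * Real.log x ^ z) +
        4 * C * (L x ^ A * (Real.log x ^ z / Real.log 2)) * (3 * L x) := by
        gcongr
        exact h1.trans (le_mul_of_one_le_right (by norm_num) h3)
    _ = _ := by rw [pow_succ]; ring

/-! ### Splitting the weight and averaging over tuples -/

theorem oddWeight_one (z : ℝ) (n : ℕ) : oddWeight z 1 n = z ^ omegaStar n := by
  unfold oddWeight omegaStar
  congr 2
  refine Finset.filter_congr fun q hq => ?_
  have := (Nat.prime_of_mem_primeFactors hq).one_lt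
  simp only [Nat.dvd_one, and_iff_left_iff_imp]
  omega

/-- The primes of a product are those of `M` together with those of `n` not dividing `M`. This exact
factorization, with no coprimality needed, is why the weight omits the divisors of `M`. -/
theorem oddWeight_one_mul (z : ℝ) {M n : ℕ} (hM : M ≠ 0) (hn : n ≠ 0) :
    oddWeight z 1 (M * n) = oddWeight z 1 M * oddWeight z M n := by
  classical
  rw [oddWeight_one, oddWeight_one]
  unfold oddWeight omegaStar
  rw [← pow_add, ← Finset.card_union_of_disjoint]
  · congr 2
    ext q
    simp only [Finset.mem_filter, Finset.mem_union, Nat.mem_primeFactors]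
    constructor
    · rintro ⟨⟨hq, hd, _⟩, ho⟩
      by_cases h : q ∣ M
      · exact Or.inl ⟨⟨hq, h, hM⟩, ho⟩
      · exact Or.inr ⟨⟨hq, (hq.dvd_mul.1 hd).resolve_left h, hn⟩, ho, h⟩
    · rintro (⟨⟨hq, hd, _⟩, ho⟩ | ⟨⟨hq, hd, _⟩, ho, _⟩)
      · exact ⟨⟨hq, Dvd.dvd.mul_right hd _, mul_ne_zero hM hn⟩, ho⟩
      · exact ⟨⟨hq, Dvd.dvd.mul_left hd _, mul_ne_zero hM hn⟩, ho⟩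
  · rw [Finset.disjoint_left]
    intro q h1 h2
    simp only [Finset.mem_filter, Nat.mem_primeFactors] at h1 h2
    exact h2.2.2 h1.1.2.1

theorem sum_piFinset_insertNth {k : ℕ} (j : Fin (k + 1)) (s : Finset GaussianInt)
    (F : (Fin (k + 1) → GaussianInt) → ℝ) :
    ∑ a ∈ Fintype.piFinset (fun _ : Fin (k + 1) => s), F a =
      ∑ b ∈ Fintype.piFinset (fun _ : Fin k => s), ∑ t ∈ s, F (j.insertNth t b) := by
  rw [← Finset.sum_product']
  refine Finset.sum_nbij' (fun a => (j.removeNth a, a j)) (fun p => j.insertNth p.2 p.1) ?_ ?_ ?_ ?_ ?_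
  · intro a ha
    simp only [Fintype.mem_piFinset, Finset.mem_product] at ha ⊢
    exact ⟨fun i => ha _, ha j⟩
  · intro p hp
    simp only [Fintype.mem_piFinset, Finset.mem_product] at hp ⊢
    intro i
    refine Fin.succAboveCases j ?_ ?_ i
    · simpa using hp.2
    · intro i; simpa using hp.1 i
  · intro a _; simp
  · intro p _; simp
  · intro a _; simp

theorem prod_nrm_insertNth {k : ℕ} (j : Fin (k + 1)) (t : GaussianInt) (b : Fin k → GaussianInt) :
    ∏ i, nrm ((j.insertNth t b : Fin (k + 1) → GaussianInt) i) = (∏ i, nrm (b i)) * nrm t := by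
  rw [Fin.prod_univ_succAbove _ j, mul_comm]
  simp

/-- Logarithmic averages over tuples of Gaussian integers. -/
theorem exists_sum_tuple_oddWeight_div_le {z : ℝ} (hz0 : 0 < z) (hz1 : z < 1) :
    ∃ A : ℕ, ∃ C : ℝ, 0 < C ∧ ∀ x : ℝ, 16 ≤ x → ∀ k : ℕ,
      ∑ a ∈ Fintype.piFinset (fun _ : Fin k => gaussBall ⌊x⌋₊),
        (if ∏ i, nrm (a i) ≤ ⌊x⌋₊ then oddWeight z 1 (∏ i, nrm (a i)) / (∏ i, nrm (a i) : ℕ) else 0)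
        ≤ (C * (L x ^ A * Real.log x ^ z)) ^ k := by
  obtain ⟨A, C, hC0, hC⟩ := exists_sum_oddWeight_div_le hz0 hz1
  refine ⟨A, C, hC0, fun x hx k => ?_⟩
  have hL := one_le_L hx
  have hlx : 0 < Real.log x := lt_of_lt_of_le (Real.exp_pos 1) (one_le_log_of_sixteen_le hx)
  induction k with
  | zero =>
    have : 1 ≤ ⌊x⌋₊ := Nat.le_floor (by push_cast; linarith)
    simp [this, oddWeight]
  | succ k ih =>
    rw [sum_piFinset_insertNth 0, pow_succ]
    refine le_trans ?_ (mul_le_mul_of_nonneg_right ih (by positivity))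
    rw [Finset.sum_mul]
    refine Finset.sum_le_sum fun b hb => ?_
    simp only [prod_nrm_insertNth]
    rw [Fintype.mem_piFinset] at hb
    set M := ∏ i, nrm (b i) with hMdef
    have hM : 0 < M := Finset.prod_pos fun i _ => (mem_gaussBall.1 (hb i)).1
    split_ifs with hMX
    · have hMx : (M : ℝ) ≤ x := le_trans (by exact_mod_cast hMX) (Nat.floor_le (by linarith))
      calc _ ≤ ∑ t ∈ gaussBall ⌊x⌋₊, oddWeight z 1 M / M * (oddWeight z M (nrm t) / nrm t) := by
            refine Finset.sum_le_sum fun t ht => ?_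
            have ht0 := (mem_gaussBall.1 ht).1
            split_ifs
            · rw [oddWeight_one_mul z hM.ne' ht0.ne', Nat.cast_mul, mul_div_mul_comm]
            · have := oddWeight_nonneg hz0 1 M
              have := oddWeight_nonneg hz0 M (nrm t)
              positivity
        _ = oddWeight z 1 M / M * ∑ t ∈ gaussBall ⌊x⌋₊, oddWeight z M (nrm t) / nrm t := by
            rw [Finset.mul_sum]
        _ ≤ _ := mul_le_mul_of_nonneg_left (hC x hx M hM hMx)
            (div_nonneg (oddWeight_nonneg hz0 _ _) (Nat.cast_nonneg _))
    · rw [zero_mul]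
      refine le_of_eq (Finset.sum_eq_zero fun t ht => ?_)
      rw [if_neg]
      intro h
      exact hMX ((Nat.le_mul_of_pos_right M (mem_gaussBall.1 ht).1).trans h)

/-! ### Simultaneous factorization of Gaussian integers of equal norm -/

theorem dvd_star_of_coprime_of_nrm {ξ β : GaussianInt} {m : ℕ} (hco : IsCoprime ξ β)
    (h : nrm ξ = nrm β * m) : β ∣ star ξ := by
  have h1 : ((nrm ξ : ℤ) : GaussianInt) = ξ * star ξ := by
    rw [cast_nrm]; exact Zsqrtd.norm_eq_mul_conj ξ
  have h2 : ((nrm β : ℤ) : GaussianInt) = β * star β := by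
    rw [cast_nrm]; exact Zsqrtd.norm_eq_mul_conj β
  have h3 : β ∣ ξ * star ξ := by
    rw [← h1, h]
    push_cast at h2 ⊢
    rw [h2, mul_assoc]
    exact Dvd.intro _ rfl
  exact hco.symm.dvd_of_dvd_mul_left h3

/-- If the norm of `α` divides the norm of `ξ`, then part of `α` and the conjugate of the rest of
`α` divide `ξ`. -/
theorem exists_split_factor {ξ α : GaussianInt} {m : ℕ} (hξ : ξ ≠ 0) (h : nrm ξ = nrm α * m) :
    ∃ β β' ξ' : GaussianInt, α = β * β' ∧ ξ = β * star β' * ξ' ∧ nrm ξ' = m := by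
  classical
  have hα : α ≠ 0 := by
    rintro rfl
    have := nrm_pos.2 hξ
    simp [nrm] at h
    simp [nrm] at this
    contradiction
  -- The part kept unconjugated is `β = gcd(ξ, α)`. The cofactors are coprime while the norm of `β'`
  -- divides that of `ξ₁`, so `β'` divides the conjugate of `ξ₁`.
  have hg : EuclideanDomain.gcd ξ α ≠ 0 := fun h0 => hα (EuclideanDomain.gcd_eq_zero_iff.1 h0).2
  obtain ⟨ξ₁, hξ₁⟩ := EuclideanDomain.gcd_dvd_left ξ α
  obtain ⟨β', hβ'⟩ := EuclideanDomain.gcd_dvd_right ξ α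
  set β := EuclideanDomain.gcd ξ α with hβ
  have hco : IsCoprime ξ₁ β' := by
    refine ⟨EuclideanDomain.gcdA ξ α, EuclideanDomain.gcdB ξ α, ?_⟩
    have := EuclideanDomain.gcd_eq_gcd_ab ξ α
    rw [← hβ] at this
    apply mul_left_cancel₀ hg
    linear_combination -this - EuclideanDomain.gcdA ξ α * hξ₁ - EuclideanDomain.gcdB ξ α * hβ'
  have hn : nrm ξ₁ = nrm β' * m := by
    have h0 : 0 < nrm β := nrm_pos.2 hg
    rw [hξ₁, hβ', nrm_mul, nrm_mul, mul_assoc] at h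
    exact Nat.eq_of_mul_eq_mul_left h0 h
  obtain ⟨η, hη⟩ := dvd_star_of_coprime_of_nrm hco hn
  have hξ₁' : ξ₁ = star β' * star η := by
    rw [← star_star ξ₁, hη, star_mul']
  have hβ'0 : 0 < nrm β' := nrm_pos.2 fun h0 => hα (by rw [hβ', h0, mul_zero])
  refine ⟨β, β', star η, hβ', ?_, ?_⟩
  · rw [hξ₁, hξ₁']; ring
  · rw [hξ₁', nrm_mul, nrm_star, nrm_star] at hn
    rw [nrm_star]
    exact Nat.eq_of_mul_eq_mul_left hβ'0 hn

/-- The factors `α t` are split off one after another; the norm equality leaves a quotient of norm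
`1`. -/
theorem exists_split_finset {ι : Type} [DecidableEq ι] (s : Finset ι) (α : ι → GaussianInt)
    (ξ : GaussianInt) (hξ : ξ ≠ 0) (h : nrm ξ = ∏ t ∈ s, nrm (α t)) :
    ∃ (β β' : ι → GaussianInt) (u : GaussianInt), nrm u = 1 ∧ (∀ t ∈ s, α t = β t * β' t) ∧
      ξ = u * ∏ t ∈ s, (β t * star (β' t)) := by
  induction s using Finset.induction_on generalizing ξ with
  | empty => exact ⟨α, α, ξ, by simpa using h, by simp, by simp⟩
  | insert t s ht ih =>
    rw [Finset.prod_insert ht] at h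
    obtain ⟨b, b', ξ', h1, h2, h3⟩ := exists_split_factor hξ h
    have hξ' : ξ' ≠ 0 := by rintro rfl; apply hξ; rw [h2, mul_zero]
    obtain ⟨β, β', u, hu, h4, h5⟩ := ih ξ' hξ' h3
    have hne : ∀ i ∈ s, i ≠ t := fun i hi he => ht (he ▸ hi)
    refine ⟨Function.update β t b, Function.update β' t b', u, hu, ?_, ?_⟩
    · intro i hi
      rcases Finset.mem_insert.1 hi with rfl | hi
      · simpa using h1
      · simpa [hne i hi] using h4 i hi
    · have hprod : ∏ i ∈ s, (Function.update β t b i * star (Function.update β' t b' i)) =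
          ∏ i ∈ s, (β i * star (β' i)) := Finset.prod_congr rfl fun i hi => by
        rw [Function.update_of_ne (hne i hi), Function.update_of_ne (hne i hi)]
      rw [Finset.prod_insert ht, hprod, h2, h5, Function.update_self, Function.update_self]
      ring

/-- `α` or its conjugate, according to a sign. -/
def conjIf (b : Bool) (α : GaussianInt) : GaussianInt := if b then α else star α

theorem conjIf_mul (b : Bool) (α β : GaussianInt) :
    conjIf b (α * β) = conjIf b α * conjIf b β := by
  cases b <;> simp [conjIf]

theorem nrm_conjIf (b : Bool) (α : GaussianInt) : nrm (conjIf b α) = nrm α := by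
  cases b <;> simp [conjIf, nrm_star]

theorem nrm_prod {ι : Type} (s : Finset ι) (f : ι → GaussianInt) :
    nrm (∏ t ∈ s, f t) = ∏ t ∈ s, nrm (f t) := by
  classical
  induction s using Finset.induction_on with
  | empty => simp [nrm]
  | insert t s ht ih => rw [Finset.prod_insert ht, Finset.prod_insert ht, nrm_mul, ih]

/-- Gaussian integers `ξ 0, …, ξ m` of equal norm are, up to units, products of `2 ^ m` common
factors and their conjugates. -/
theorem exists_simultaneous_factorization (m : ℕ) :
    ∃ (ι : Type) (_ : Fintype ι), Fintype.card ι = 2 ^ m ∧ ∃ ε : ℕ → ι → Bool,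
      ∀ ξ : ℕ → GaussianInt, (∀ i ≤ m, ξ i ≠ 0) → (∀ i ≤ m, nrm (ξ i) = nrm (ξ 0)) →
        ∃ (α : ι → GaussianInt) (u : ℕ → GaussianInt), ∀ i ≤ m, nrm (u i) = 1 ∧
          ξ i = u i * ∏ t, conjIf (ε i t) (α t) := by
  classical
  induction m with
  | zero =>
    refine ⟨Unit, inferInstance, by simp, fun _ _ => true, fun ξ _ _ => ⟨fun _ => ξ 0, fun _ => 1, ?_⟩⟩
    intro i hi
    obtain rfl : i = 0 := by omega
    simp [nrm, conjIf]
  | succ m ih =>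
    obtain ⟨ι, _, hcard, ε, hε⟩ := ih
    -- Each common factor splits as `β β'` while the new element contains `β * star β'`. Hence the
    -- index set doubles: earlier elements give both halves the old sign, and the new one conjugates
    -- exactly the second half.
    refine ⟨ι × Bool, inferInstance, by simp [hcard, pow_succ],
      fun i p => if i ≤ m then ε i p.1 else p.2, fun ξ hξ0 hξ => ?_⟩
    obtain ⟨α, u, hα⟩ := hε ξ (fun i hi => hξ0 i (by omega)) (fun i hi => hξ i (by omega))
    have hn : nrm (ξ (m + 1)) = ∏ t, nrm (α t) := by
      rw [hξ (m + 1) le_rfl, (hα 0 (by omega)).2, nrm_mul, (hα 0 (by omega)).1, nrm_prod, one_mul]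
      exact Finset.prod_congr rfl fun t _ => nrm_conjIf _ _
    obtain ⟨β, β', v, hv, h1, h2⟩ :=
      exists_split_finset Finset.univ α (ξ (m + 1)) (hξ0 (m + 1) le_rfl) hn
    refine ⟨fun p => if p.2 then β p.1 else β' p.1, fun i => if i ≤ m then u i else v, ?_⟩
    intro i hi
    rw [Fintype.prod_prod_type]
    by_cases him : i ≤ m
    · simp only [him, if_true]
      refine ⟨(hα i him).1, ?_⟩
      rw [(hα i him).2]
      congr 1
      refine Finset.prod_congr rfl fun t _ => ?_
      rw [h1 t (Finset.mem_univ t), conjIf_mul]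
      simp
    · obtain rfl : i = m + 1 := by omega
      simp only [him, if_false]
      refine ⟨hv, ?_⟩
      rw [h2]
      congr 1
      refine Finset.prod_congr rfl fun t _ => ?_
      simp [conjIf]

open Classical in
/-- A Gaussian integer has at least `2 ^ ω` divisors. -/
theorem two_pow_omegaStar_le {ξ : GaussianInt} {s : Finset GaussianInt}
    (hs : ∀ α, α ∣ ξ → α ∈ s) : 2 ^ omegaStar (nrm ξ) ≤ (s.filter fun α => α ∣ ξ).card := by
  classical
  unfold omegaStar
  rw [← Finset.card_powerset]
  -- Distinct sets `T` of primes give distinct divisors, because `T` is recovered as the set of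
  -- primes dividing the norm of `g T`.
  set g : Finset ℕ → GaussianInt := fun T => EuclideanDomain.gcd ξ ((∏ q ∈ T, q : ℕ) : GaussianInt)
  have hg : ∀ T ∈ ((nrm ξ).primeFactors.filter Odd).powerset, ∀ q : ℕ, q.Prime →
      (q ∣ nrm (g T) ↔ q ∈ T) := by
    intro T hT q hq
    rw [Finset.mem_powerset] at hT
    constructor
    · intro h
      have h1 : nrm (g T) ∣ nrm ((∏ q ∈ T, q : ℕ) : GaussianInt) := by
        obtain ⟨c, hc⟩ := EuclideanDomain.gcd_dvd_right ξ ((∏ q ∈ T, q : ℕ) : GaussianInt)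
        rw [hc, nrm_mul]; exact Dvd.intro _ rfl
      have h2 : nrm ((∏ q ∈ T, q : ℕ) : GaussianInt) = (∏ q ∈ T, q) * (∏ q ∈ T, q) := by
        unfold nrm; rw [Zsqrtd.norm_natCast, Int.natAbs_mul, Int.natAbs_natCast]
      have h3 := (h.trans h1)
      rw [h2] at h3
      have h4 : q ∣ ∏ q ∈ T, q := (hq.dvd_mul.1 h3).elim id id
      obtain ⟨p, hp, hqp⟩ := (hq.prime.dvd_finsetProd_iff _).1 h4
      have hpp := Nat.prime_of_mem_primeFactors (Finset.mem_filter.1 (hT hp)).1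
      rwa [(Nat.prime_dvd_prime_iff_eq hq hpp).1 hqp]
    · intro h
      by_contra hnd
      have hqξ := Nat.dvd_of_mem_primeFactors (Finset.mem_filter.1 (hT h)).1
      -- If `q` did not divide the norm of `g T`, then `gcd(ξ, q)` would be a unit. But `q ∣ ξ *
      -- star ξ` would then give `q ∣ star ξ`, so `q ∣ ξ`, making `q` a unit.
      set d := EuclideanDomain.gcd ξ (q : GaussianInt)
      have hd1 : d ∣ g T := EuclideanDomain.dvd_gcd (EuclideanDomain.gcd_dvd_left _ _)
        ((EuclideanDomain.gcd_dvd_right _ _).trans (Nat.cast_dvd_cast (Finset.dvd_prod_of_mem (fun q => q) h)))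
      have hdn : nrm d ∣ nrm (g T) := by
        obtain ⟨c, hc⟩ := hd1
        rw [hc, nrm_mul]; exact Dvd.intro _ rfl
      have hdq : nrm d ∣ q ^ 2 := by
        obtain ⟨c, hc⟩ := EuclideanDomain.gcd_dvd_right ξ (q : GaussianInt)
        have : nrm (q : GaussianInt) = q ^ 2 := by
          unfold nrm; rw [Zsqrtd.norm_natCast, Int.natAbs_mul, sq]; simp
        rw [← this, hc, nrm_mul]; exact Dvd.intro _ rfl
      have hd : nrm d = 1 := by
        obtain ⟨k, hk, hdk⟩ := (Nat.dvd_prime_pow hq).1 hdq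
        rcases Nat.eq_zero_or_pos k with rfl | hk0
        · simpa using hdk
        · exact absurd ((hdk ▸ dvd_pow_self q hk0.ne').trans hdn) hnd
      have hunit : IsUnit d := Zsqrtd.norm_eq_one_iff.1 hd
      have hco : IsCoprime ξ (q : GaussianInt) := EuclideanDomain.gcd_isUnit_iff.1 hunit
      have h5 : (q : GaussianInt) ∣ ξ * star ξ := by
        obtain ⟨c, hc⟩ := hqξ
        have h1 : ((nrm ξ : ℤ) : GaussianInt) = ξ * star ξ := by
          rw [cast_nrm]; exact Zsqrtd.norm_eq_mul_conj ξ
        rw [← h1, hc]; push_cast; exact Dvd.intro _ rfl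
      have h6 : (q : GaussianInt) ∣ star ξ := hco.symm.dvd_of_dvd_mul_left h5
      have h7 : (q : GaussianInt) ∣ ξ := by
        obtain ⟨c, hc⟩ := h6
        refine ⟨star c, ?_⟩
        rw [← star_star ξ, hc, star_mul', star_natCast]
      have h8 : IsUnit (q : GaussianInt) := hco.isUnit_of_dvd' h7 dvd_rfl
      have h9 := Zsqrtd.norm_eq_one_iff.2 h8
      rw [Zsqrtd.norm_natCast, Int.natAbs_mul] at h9
      have := Nat.eq_one_of_mul_eq_one_left h9
      simp at this
      exact hq.one_lt.ne' this
  refine Finset.card_le_card_of_injOn g ?_ ?_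
  · intro T _
    have := EuclideanDomain.gcd_dvd_left ξ ((∏ q ∈ T, q : ℕ) : GaussianInt)
    rw [Finset.mem_coe, Finset.mem_filter]
    exact ⟨hs _ this, this⟩
  · intro T hT T' hT' hTT
    rw [Finset.mem_coe] at hT hT'
    ext q
    by_cases hq : q.Prime
    · rw [← hg T hT q hq, ← hg T' hT' q hq]
      rw [hTT]
    · have key : ∀ T ∈ ((nrm ξ).primeFactors.filter Odd).powerset, q ∉ T := fun T hT h =>
        hq (Nat.prime_of_mem_primeFactors (Finset.mem_filter.1 (Finset.mem_powerset.1 hT h)).1)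
      exact iff_of_false (key T hT) (key T' hT')

/-! ### The moment bound -/

/-- The Gaussian integers built from common factors `a`, units `u` and signs `ε`. -/
noncomputable def assemble {ℓ k : ℕ} (ε : Fin ℓ → Fin k → Bool) (u : Fin ℓ → GaussianInt)
    (a : Fin k → GaussianInt) (i : Fin ℓ) : GaussianInt :=
  u i * ∏ j, conjIf (ε i j) (a j)

/-- Distinct Gaussian integers in the open first quadrant with prime imaginary part. -/
def Valid {ℓ : ℕ} (ξ : Fin ℓ → GaussianInt) : Prop :=
  (∀ i, 0 < (ξ i).re ∧ 0 < (ξ i).im ∧ (ξ i).im.natAbs.Prime) ∧ Function.Injective ξ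

/-- Equality case of Cauchy–Schwarz: parallel vectors of equal length are equal or opposite. -/
theorem eq_or_eq_neg_of_det_eq_zero {α β : GaussianInt} (hn : nrm α = nrm β)
    (hdet : α.im * β.re - α.re * β.im = 0) : α = β ∨ α = -β := by
  have h1 := cast_nrm_eq α
  have h2 := cast_nrm_eq β
  rw [← hn] at h2
  have h3 : (α.re * β.re + α.im * β.im) ^ 2 = (nrm α : ℤ) ^ 2 := by
    have : (nrm α : ℤ) ^ 2 = (α.re ^ 2 + α.im ^ 2) * (β.re ^ 2 + β.im ^ 2) := by
      rw [← h1, ← h2]; ring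
    rw [this]
    linear_combination (-(α.im * β.re - α.re * β.im)) * hdet
  rcases sq_eq_sq_iff_eq_or_eq_neg.1 h3 with h | h
  · left
    have e : (α.re - β.re) ^ 2 + (α.im - β.im) ^ 2 = 0 := by linear_combination -h1 - h2 - 2 * h
    have e1 : α.re - β.re = 0 := by nlinarith [sq_nonneg (α.re - β.re), sq_nonneg (α.im - β.im)]
    have e2 : α.im - β.im = 0 := by nlinarith [sq_nonneg (α.re - β.re), sq_nonneg (α.im - β.im)]
    exact Zsqrtd.ext (by linarith) (by linarith)
  · right
    have e : (α.re + β.re) ^ 2 + (α.im + β.im) ^ 2 = 0 := by linear_combination -h1 - h2 + 2 * h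
    have e1 : α.re + β.re = 0 := by nlinarith [sq_nonneg (α.re + β.re), sq_nonneg (α.im + β.im)]
    have e2 : α.im + β.im = 0 := by nlinarith [sq_nonneg (α.re + β.re), sq_nonneg (α.im + β.im)]
    refine Zsqrtd.ext ?_ ?_
    · rw [Zsqrtd.re_neg]; linarith
    · rw [Zsqrtd.im_neg]; linarith

/-- The coefficients of the linear forms in the factor with index `j`. -/
noncomputable def cofactor {ℓ k : ℕ} (ε : Fin ℓ → Fin (k + 1) → Bool) (u : Fin ℓ → GaussianInt)
    (j : Fin (k + 1)) (b : Fin k → GaussianInt) (i : Fin ℓ) : GaussianInt :=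
  conjIf (ε i j) (u i * ∏ t, conjIf (ε i (j.succAbove t)) (b t))

theorem conjIf_conjIf_mul (c : Bool) (α β : GaussianInt) :
    conjIf c (conjIf c α * β) = α * conjIf c β := by
  cases c <;> simp [conjIf]

/-- As a function of one factor `t`, each assembled integer is a fixed multiple of `t` up to
conjugation, so its imaginary part is up to sign a linear form. -/
theorem assemble_insertNth {ℓ k : ℕ} (ε : Fin ℓ → Fin (k + 1) → Bool) (u : Fin ℓ → GaussianInt)
    (j : Fin (k + 1)) (b : Fin k → GaussianInt) (t : GaussianInt) (i : Fin ℓ) :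
    assemble ε u (j.insertNth t b) i = conjIf (ε i j) (cofactor ε u j b i * t) := by
  unfold assemble cofactor
  rw [conjIf_conjIf_mul, Fin.prod_univ_succAbove _ j]
  simp only [Fin.insertNth_apply_same, Fin.insertNth_apply_succAbove]
  ring

theorem nrm_cofactor {ℓ k : ℕ} (ε : Fin ℓ → Fin (k + 1) → Bool) {u : Fin ℓ → GaussianInt}
    (hu : ∀ i, nrm (u i) = 1) (j : Fin (k + 1)) (b : Fin k → GaussianInt) (i : Fin ℓ) :
    nrm (cofactor ε u j b i) = ∏ t, nrm (b t) := by
  unfold cofactor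
  rw [nrm_conjIf, nrm_mul, hu, one_mul, nrm_prod]
  exact Finset.prod_congr rfl fun t _ => nrm_conjIf _ _

theorem conjIf_re (c : Bool) (α : GaussianInt) : (conjIf c α).re = α.re := by
  cases c <;> simp [conjIf]

theorem natAbs_conjIf_im (c : Bool) (α : GaussianInt) :
    (conjIf c α).im.natAbs = α.im.natAbs := by
  cases c <;> simp [conjIf]

/-- If the determinant vanished, the two cofactors would agree up to sign, so the assembled integers
would agree up to sign and conjugation. In the open first quadrant they would be equal, against
injectivity. -/
theorem det_cofactor_ne_zero {ℓ k : ℕ} {ε : Fin ℓ → Fin (k + 1) → Bool} {u : Fin ℓ → GaussianInt}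
    (hu : ∀ i, nrm (u i) = 1) {j : Fin (k + 1)} {b : Fin k → GaussianInt} {t : GaussianInt}
    (hv : Valid (assemble ε u (j.insertNth t b))) {i i' : Fin ℓ} (hii : i ≠ i') :
    (cofactor ε u j b i).im * (cofactor ε u j b i').re -
      (cofactor ε u j b i).re * (cofactor ε u j b i').im ≠ 0 := by
  intro hdet
  apply hii
  apply hv.2
  have h1 := hv.1 i
  have h2 := hv.1 i'
  have him := natAbs_conjIf_im (ε i j) (cofactor ε u j b i * t)
  have him' := natAbs_conjIf_im (ε i' j) (cofactor ε u j b i' * t)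
  have hre := conjIf_re (ε i j) (cofactor ε u j b i * t)
  have hre' := conjIf_re (ε i' j) (cofactor ε u j b i' * t)
  rw [← assemble_insertNth] at him him' hre hre'
  have key : (cofactor ε u j b i * t).re.natAbs = (cofactor ε u j b i' * t).re.natAbs ∧
      (cofactor ε u j b i * t).im.natAbs = (cofactor ε u j b i' * t).im.natAbs := by
    rcases eq_or_eq_neg_of_det_eq_zero (by rw [nrm_cofactor ε hu, nrm_cofactor ε hu]) hdet with h | h
    · rw [h]; simp
    · rw [h, neg_mul, Zsqrtd.re_neg, Zsqrtd.im_neg]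
      exact ⟨Int.natAbs_neg _, Int.natAbs_neg _⟩
  exact Zsqrtd.ext (by omega) (by omega)

open Classical in
/-- The sum over one large factor, the others being fixed. -/
theorem exists_sum_large_factor_le {z : ℝ} (hz0 : 0 < z) (hz1 : z < 1) (ℓ k : ℕ) {c : ℝ}
    (hc0 : 0 < c) :
    ∃ A : ℕ, ∃ C : ℝ, 0 < C ∧ ∀ x : ℝ, 16 ≤ x → ∀ ε : Fin ℓ → Fin (k + 1) → Bool,
      ∀ u : Fin ℓ → GaussianInt, (∀ i, nrm (u i) = 1) → ∀ j : Fin (k + 1),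
      ∀ b : Fin k → GaussianInt, ∀ M : ℕ, M = ∏ i, nrm (b i) → 0 < M →
      ∑ t ∈ gaussBall ⌊x⌋₊, (if M * nrm t ≤ ⌊x⌋₊ ∧ Valid (assemble ε u (j.insertNth t b)) ∧
          x ^ c ≤ nrm t then oddWeight z M (nrm t) else 0) ≤
        C * (x / M * (L x ^ A * Real.log x ^ (-(ℓ + 1 - z)))) := by
  obtain ⟨A, C, hC0, hC⟩ := exists_sieveSum_le hz0 hz1 ℓ
  have hκ : 0 < (ℓ : ℝ) + 1 - z := by
    have : (0 : ℝ) ≤ ℓ := Nat.cast_nonneg _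
    linarith
  refine ⟨A, C * (289 * 2 ^ A * (c / 2) ^ (-((ℓ : ℝ) + 1 - z))), by positivity,
    fun x hx ε u hu j b M hMdef hM => ?_⟩
  have hL := one_le_L hx
  have hlx : 0 < Real.log x := lt_of_lt_of_le (Real.exp_pos 1) (one_le_log_of_sixteen_le hx)
  set X := ⌊x⌋₊ with hX
  have hXx : (X : ℝ) ≤ x := Nat.floor_le (by linarith)
  have hM' : (0 : ℝ) < M := by exact_mod_cast hM
  rw [← Finset.sum_filter]
  set s := (gaussBall X).filter (fun t => M * nrm t ≤ X ∧
    Valid (assemble ε u (j.insertNth t b)) ∧ x ^ c ≤ nrm t) with hs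
  -- A single admissible `t₀` supplies everything the sieve needs: nonzero determinants, which
  -- depend only on the other factors, `M ≤ X`, and `x ^ c ≤ H ^ 2`, so that `log H` is comparable
  -- to `log x`.
  rcases Finset.eq_empty_or_nonempty s with h0 | ⟨t₀, ht₀⟩
  · rw [h0, Finset.sum_empty]; positivity
  have hmem : ∀ t ∈ s, 0 < nrm t ∧ M * nrm t ≤ X ∧
      Valid (assemble ε u (j.insertNth t b)) ∧ x ^ c ≤ nrm t := by
    intro t ht
    rw [hs, Finset.mem_filter, mem_gaussBall] at ht
    exact ⟨ht.1.1, ht.2⟩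
  obtain ⟨ht0, ht1, ht2, ht3⟩ := hmem t₀ ht₀
  have hMX : M ≤ X := (Nat.le_mul_of_pos_right M ht0).trans ht1
  set Q := X / M with hQ
  have hQ1 : 1 ≤ Q := (Nat.one_le_div_iff hM).2 hMX
  have hQx : (Q : ℝ) ≤ x / M := by
    refine (Nat.cast_div_le (α := ℝ)).trans ?_
    gcongr
  -- The `16` meets the sieve's lower bound on `H`; as `√Q ≥ 1` after rounding down, `H ^ 2 ≤ 17 ^ 2
  -- Q = 289 Q`. Since `H` may exceed `x`, the sieve is applied with `x ^ 2`.
  set H := Nat.sqrt Q + 16 with hH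
  have hsq1 : 1 ≤ Nat.sqrt Q := Nat.le_sqrt.2 (by omega)
  have hQH : Q ≤ H ^ 2 := by
    have := Nat.sqrt_le_add Q
    rw [hH]
    nlinarith
  have hH2 : (H : ℝ) ^ 2 ≤ 289 * (x / M) := by
    have h1 : H ^ 2 ≤ 289 * Q := by
      have := Nat.sqrt_le Q
      rw [hH]
      nlinarith
    have h2 : (H : ℝ) ^ 2 ≤ 289 * Q := by exact_mod_cast h1
    linarith
  have hMx : (M : ℝ) ≤ x := le_trans (by exact_mod_cast hMX) hXx
  have hHx : (H : ℝ) ≤ x ^ 2 := by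
    have h1 : H ≤ Q + 16 := by
      have := Nat.sqrt_le_self Q
      omega
    have h2 : (H : ℝ) ≤ Q + 16 := by exact_mod_cast h1
    have h3 : x / M ≤ x := div_le_self (by linarith) (by exact_mod_cast hM)
    nlinarith
  have hnrmt : ∀ t ∈ s, nrm t ≤ H ^ 2 := by
    intro t ht
    refine le_trans ?_ hQH
    rw [hQ, Nat.le_div_iff_mul_le hM, mul_comm]
    exact (hmem t ht).2.1
  have hlogH : c / 2 * Real.log x ≤ Real.log H := by
    have h1 : x ^ c ≤ (H : ℝ) ^ 2 := ht3.trans (by exact_mod_cast hnrmt t₀ ht₀)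
    have h2 := Real.log_le_log (Real.rpow_pos_of_pos (by linarith) _) h1
    rw [Real.log_rpow (by linarith), Real.log_pow] at h2
    push_cast at h2
    linarith
  have hb := hC (x ^ 2) (by nlinarith) H (by omega) hHx M hM (by nlinarith)
    (cofactor ε u j b) (fun i => by
      rw [← cast_nrm, nrm_cofactor ε hu, hMdef]) (fun i i' hii => det_cofactor_ne_zero hu ht2 hii)
  have hss := sum_oddWeight_le_sieveSum hz0 (γ := cofactor ε u j b) M (H := H) (s := s)
    (fun t ht => ⟨nrm_pos.1 (hmem t ht).1, hnrmt t ht, fun i => by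
      have := ((hmem t ht).2.2.1.1 i).2.2
      rwa [assemble_insertNth, natAbs_conjIf_im] at this⟩)
  have hL2 : 0 ≤ L (x ^ 2) := le_trans zero_le_one (one_le_L (by nlinarith))
  calc _ ≤ C * ((H : ℝ) ^ 2 * L (x ^ 2) ^ A * Real.log H ^ (-((ℓ : ℝ) + 1 - z))) := hss.trans hb
    _ ≤ C * (289 * (x / M) * (2 * L x) ^ A * (c / 2 * Real.log x) ^ (-((ℓ : ℝ) + 1 - z))) := by
        have h1 : Real.log H ^ (-((ℓ : ℝ) + 1 - z)) ≤
            (c / 2 * Real.log x) ^ (-((ℓ : ℝ) + 1 - z)) :=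
          Real.rpow_le_rpow_of_nonpos (by positivity) hlogH (by linarith)
        have h2 := log_sq_le_two_mul_L hx
        gcongr
    _ = _ := by
        rw [Real.mul_rpow (by positivity) hlx.le, mul_pow]
        ring

open Classical in
/-- The sum of the weights over tuples of common factors. -/
noncomputable def tupleSum (z : ℝ) {ℓ k : ℕ} (ε : Fin ℓ → Fin k → Bool)
    (u : Fin ℓ → GaussianInt) (X : ℕ) : ℝ :=
  ∑ a ∈ Fintype.piFinset (fun _ : Fin k => gaussBall X),
    if ∏ i, nrm (a i) ≤ X ∧ Valid (assemble ε u a) then oddWeight z 1 (∏ i, nrm (a i)) else 0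

theorem exists_log_pow_le_sqrt (n : ℕ) : ∃ C : ℝ, 0 < C ∧ ∀ x : ℝ, 1 ≤ x →
    Real.log x ^ n * x ^ (1 / 2 : ℝ) ≤ C * x := by
  refine ⟨n.factorial * 2 ^ n, by positivity, fun x hx => ?_⟩
  have hl : 0 ≤ Real.log x := Real.log_nonneg hx
  have h1 := Real.pow_div_factorial_le_exp (x := Real.log x / 2) (by positivity) n
  have h2 : Real.exp (Real.log x / 2) = x ^ (1 / 2 : ℝ) := by
    rw [Real.rpow_def_of_pos (by linarith)]; congr 1; ring
  rw [h2, div_pow, div_div, div_le_iff₀ (by positivity)] at h1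
  have h3 : x ^ (1 / 2 : ℝ) * x ^ (1 / 2 : ℝ) = x := by
    rw [← Real.rpow_add (by linarith)]; norm_num
  calc _ ≤ x ^ (1 / 2 : ℝ) * (2 ^ n * n.factorial) * x ^ (1 / 2 : ℝ) := by gcongr
    _ = 2 ^ n * n.factorial * (x ^ (1 / 2 : ℝ) * x ^ (1 / 2 : ℝ)) := by ring
    _ = _ := by rw [h3]; ring

open Classical in
-- Either all factors are small and there are few tuples, or some factor is large and is sieved with
-- the others fixed. The sieve gives `(log x) ^ (-(ℓ + 1 - z))` and the `k` fixed factors give `(log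
-- x) ^ (k z)`.
theorem exists_tupleSum_le {z : ℝ} (hz0 : 0 < z) (hz1 : z < 1) (ℓ k : ℕ) :
    ∃ A : ℕ, ∃ C : ℝ, 0 < C ∧ ∀ x : ℝ, 16 ≤ x → ∀ ε : Fin ℓ → Fin (k + 1) → Bool,
      ∀ u : Fin ℓ → GaussianInt, (∀ i, nrm (u i) = 1) →
      tupleSum z ε u ⌊x⌋₊ ≤ C * (x * (L x ^ A * Real.log x ^ ((k + 1) * z - ℓ - 1))) := by
  -- Chosen so that `k + 1` factors of norm at most `x ^ c` leave only `O(x ^ (1/2))` tuples.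
  set c : ℝ := 1 / (2 * (k + 1)) with hc
  have hc0 : 0 < c := by positivity
  obtain ⟨A₁, C₁, hC₁0, hC₁⟩ := exists_sum_large_factor_le hz0 hz1 ℓ k hc0
  obtain ⟨A₂, C₂, hC₂0, hC₂⟩ := exists_sum_tuple_oddWeight_div_le hz0 hz1
  obtain ⟨C₃, hC₃0, hC₃⟩ := exists_log_pow_le_sqrt (ℓ + 1)
  refine ⟨A₁ + A₂ * k, (k + 1) * (C₁ * C₂ ^ k) + 9 ^ (k + 1) * C₃, by positivity,
    fun x hx ε u hu => ?_⟩
  have hL := one_le_L hx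
  have hlx1 := one_le_log_of_sixteen_le hx
  have hlx : 0 < Real.log x := lt_of_lt_of_le (Real.exp_pos 1) hlx1
  set X := ⌊x⌋₊ with hX
  set κ : ℝ := (k + 1) * z - ℓ - 1 with hκ
  set S := Fintype.piFinset (fun _ : Fin (k + 1) => gaussBall X) with hS
  have hsplit : tupleSum z ε u X ≤
      ∑ j, ∑ a ∈ S, (if ∏ i, nrm (a i) ≤ X ∧ Valid (assemble ε u a) ∧ x ^ c ≤ nrm (a j)
        then oddWeight z 1 (∏ i, nrm (a i)) else 0) +
      ∑ a ∈ S, (if ∀ j, (nrm (a j) : ℝ) ≤ x ^ c then (1 : ℝ) else 0) := by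
    unfold tupleSum
    rw [Finset.sum_comm, ← Finset.sum_add_distrib]
    refine Finset.sum_le_sum fun a _ => ?_
    have hw := oddWeight_nonneg hz0 1 (∏ i, nrm (a i))
    have h0 : 0 ≤ ∑ j, (if ∏ i, nrm (a i) ≤ X ∧ Valid (assemble ε u a) ∧ x ^ c ≤ nrm (a j)
        then oddWeight z 1 (∏ i, nrm (a i)) else 0) :=
      Finset.sum_nonneg fun j _ => by split_ifs <;> simp [hw]
    have h0' : (0 : ℝ) ≤ (if ∀ j, (nrm (a j) : ℝ) ≤ x ^ c then (1 : ℝ) else 0) := by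
      split_ifs <;> norm_num
    split_ifs with h
    · have := oddWeight_le_one hz0 hz1 1 (∏ i, nrm (a i))
      linarith
    · push Not at *
      rename_i hsmall
      obtain ⟨j, hj⟩ := hsmall
      have h1 := Finset.single_le_sum (f := fun j => if ∏ i, nrm (a i) ≤ X ∧
        Valid (assemble ε u a) ∧ x ^ c ≤ nrm (a j) then oddWeight z 1 (∏ i, nrm (a i)) else 0)
        (fun j _ => by split_ifs <;> simp [hw]) (Finset.mem_univ j)
      simp only [h.1, h.2, hj.le, and_self, true_and, if_true] at h1
      simp only [h.1, h.2, true_and, add_zero]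
      exact h1
    · linarith
    · linarith
  have hlarge : ∀ j : Fin (k + 1), ∑ a ∈ S, (if ∏ i, nrm (a i) ≤ X ∧ Valid (assemble ε u a) ∧
      x ^ c ≤ nrm (a j) then oddWeight z 1 (∏ i, nrm (a i)) else 0) ≤
      C₁ * C₂ ^ k * (x * (L x ^ (A₁ + A₂ * k) * Real.log x ^ κ)) := by
    intro j
    rw [hS, sum_piFinset_insertNth j]
    simp only [prod_nrm_insertNth, Fin.insertNth_apply_same]
    calc _ ≤ ∑ b ∈ Fintype.piFinset (fun _ : Fin k => gaussBall X),
          C₁ * (x * (L x ^ A₁ * Real.log x ^ (-((ℓ : ℝ) + 1 - z)))) *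
          (if ∏ i, nrm (b i) ≤ X then oddWeight z 1 (∏ i, nrm (b i)) / (∏ i, nrm (b i) : ℕ) else 0) := by
          refine Finset.sum_le_sum fun b hb => ?_
          rw [Fintype.mem_piFinset] at hb
          set M := ∏ i, nrm (b i) with hMdef
          have hM : 0 < M := Finset.prod_pos fun i _ => (mem_gaussBall.1 (hb i)).1
          split_ifs with hMX
          · calc _ = oddWeight z 1 M * ∑ t ∈ gaussBall X, (if M * nrm t ≤ X ∧
                  Valid (assemble ε u (j.insertNth t b)) ∧ x ^ c ≤ nrm t
                  then oddWeight z M (nrm t) else 0) := by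
                  rw [Finset.mul_sum]
                  refine Finset.sum_congr rfl fun t ht => ?_
                  rw [mul_ite, mul_zero, oddWeight_one_mul z hM.ne' (mem_gaussBall.1 ht).1.ne']
              _ ≤ oddWeight z 1 M * (C₁ * (x / M * (L x ^ A₁ *
                  Real.log x ^ (-((ℓ : ℝ) + 1 - z))))) :=
                  mul_le_mul_of_nonneg_left (hC₁ x hx ε u hu j b M hMdef hM)
                    (oddWeight_nonneg hz0 _ _)
              _ = _ := by ring
          · rw [mul_zero]
            refine le_of_eq (Finset.sum_eq_zero fun t ht => ?_)
            rw [if_neg]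
            intro h
            exact hMX ((Nat.le_mul_of_pos_right M (mem_gaussBall.1 ht).1).trans h.1)
      _ = C₁ * (x * (L x ^ A₁ * Real.log x ^ (-((ℓ : ℝ) + 1 - z)))) *
          ∑ b ∈ Fintype.piFinset (fun _ : Fin k => gaussBall X),
          (if ∏ i, nrm (b i) ≤ X then oddWeight z 1 (∏ i, nrm (b i)) / (∏ i, nrm (b i) : ℕ) else 0) := by
          rw [Finset.mul_sum]
      _ ≤ C₁ * (x * (L x ^ A₁ * Real.log x ^ (-((ℓ : ℝ) + 1 - z)))) *
          (C₂ * (L x ^ A₂ * Real.log x ^ z)) ^ k := by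
          gcongr
          exact hC₂ x hx k
      _ = _ := by
          have e : Real.log x ^ κ =
              Real.log x ^ (-((ℓ : ℝ) + 1 - z)) * (Real.log x ^ z) ^ k := by
            rw [← Real.rpow_natCast, ← Real.rpow_mul hlx.le, ← Real.rpow_add hlx]
            congr 1; rw [hκ]; ring
          rw [e, mul_pow, mul_pow, pow_add, pow_mul]; ring
  have hsmall : ∑ a ∈ S, (if ∀ j, (nrm (a j) : ℝ) ≤ x ^ c then (1 : ℝ) else 0) ≤
      9 ^ (k + 1) * C₃ * (x * (L x ^ (A₁ + A₂ * k) * Real.log x ^ κ)) := by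
    have h1 : ∑ a ∈ S, (if ∀ j, (nrm (a j) : ℝ) ≤ x ^ c then (1 : ℝ) else 0) ≤
        9 ^ (k + 1) * x ^ (1 / 2 : ℝ) := by
      rw [Finset.sum_boole]
      have hcard : (S.filter fun a => ∀ j, (nrm (a j) : ℝ) ≤ x ^ c).card ≤
          (9 * ⌊x ^ c⌋₊) ^ (k + 1) := by
        calc _ ≤ (Fintype.piFinset (fun _ : Fin (k + 1) => gaussBall ⌊x ^ c⌋₊)).card := by
              refine Finset.card_le_card fun a ha => ?_
              rw [Finset.mem_filter, hS, Fintype.mem_piFinset] at ha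
              rw [Fintype.mem_piFinset]
              exact fun j => mem_gaussBall.2 ⟨(mem_gaussBall.1 (ha.1 j)).1, Nat.le_floor (ha.2 j)⟩
          _ = (gaussBall ⌊x ^ c⌋₊).card ^ (k + 1) := by simp
          _ ≤ _ := Nat.pow_le_pow_left (card_gaussBall_le _) _
      have hfl : (⌊x ^ c⌋₊ : ℝ) ≤ x ^ c := Nat.floor_le (by positivity)
      calc ((S.filter fun a => ∀ j, (nrm (a j) : ℝ) ≤ x ^ c).card : ℝ)
          ≤ (9 * (⌊x ^ c⌋₊ : ℝ)) ^ (k + 1) := by exact_mod_cast hcard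
        _ ≤ (9 * x ^ c) ^ (k + 1) := by gcongr
        _ = _ := by
            rw [mul_pow, ← Real.rpow_natCast (x ^ c), ← Real.rpow_mul (by linarith)]
            congr 2
            rw [hc]; push_cast; field_simp
    have h2 : x ^ (1 / 2 : ℝ) ≤ C₃ * (x * Real.log x ^ κ) := by
      have h3 := hC₃ x (by linarith)
      -- As `(k + 1) z ≥ 0`, the target exponent is at least `-(ℓ + 1)`, so `√x` is within the
      -- claimed bound.
      have h4 : Real.log x ^ (-((ℓ + 1 : ℕ) : ℝ)) ≤ Real.log x ^ κ := by
        refine Real.rpow_le_rpow_of_exponent_le (by linarith [Real.exp_one_gt_d9]) ?_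
        have : 0 ≤ ((k : ℝ) + 1) * z := by positivity
        rw [hκ]; push_cast; linarith
      rw [Real.rpow_neg hlx.le, Real.rpow_natCast] at h4
      calc x ^ (1 / 2 : ℝ) = Real.log x ^ (ℓ + 1) * x ^ (1 / 2 : ℝ) * (Real.log x ^ (ℓ + 1))⁻¹ := by
            field_simp
        _ ≤ C₃ * x * Real.log x ^ κ := by gcongr
        _ = _ := by ring
    have h5 : 1 ≤ L x ^ (A₁ + A₂ * k) := one_le_pow₀ hL
    have hpos : 0 < Real.log x ^ κ := Real.rpow_pos_of_pos hlx _
    calc _ ≤ 9 ^ (k + 1) * (C₃ * (x * Real.log x ^ κ)) := h1.trans (by gcongr)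
      _ ≤ 9 ^ (k + 1) * (C₃ * (x * (L x ^ (A₁ + A₂ * k) * Real.log x ^ κ))) := by
          gcongr
          exact le_mul_of_one_le_left hpos.le h5
      _ = _ := by ring
  refine hsplit.trans ((add_le_add (Finset.sum_le_sum fun j _ => hlarge j) hsmall).trans
    (le_of_eq ?_))
  rw [Finset.sum_const, Finset.card_univ, Fintype.card_fin, nsmul_eq_mul]
  push_cast
  ring

/-! ### Passage from representations to tuples of factors -/

/-- The Gaussian integer `a + p i` of a representation `(a, p)`. -/
def repGauss (q : ℕ × ℕ) : GaussianInt := ⟨q.1, q.2⟩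

theorem repGauss_injective : Function.Injective repGauss := by
  intro q q' h
  have h1 := congrArg Zsqrtd.re h
  have h2 := congrArg Zsqrtd.im h
  simp only [repGauss] at h1 h2
  exact Prod.ext (by exact_mod_cast h1) (by exact_mod_cast h2)

theorem nrm_repGauss {n : ℕ} {q : ℕ × ℕ} (hq : q ∈ reps n) : nrm (repGauss q) = n := by
  have h := (mem_reps (n := n) (a := q.1) (p := q.2)).1 hq
  have h2 := cast_nrm_eq (repGauss q)
  have h3 : ((nrm (repGauss q) : ℕ) : ℤ) = n := by rw [h2, ← h.2.2]; simp [repGauss]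
  exact_mod_cast h3

theorem repGauss_pos {n : ℕ} {q : ℕ × ℕ} (hq : q ∈ reps n) :
    0 < (repGauss q).re ∧ 0 < (repGauss q).im ∧ (repGauss q).im.natAbs.Prime := by
  have h := (mem_reps (n := n) (a := q.1) (p := q.2)).1 hq
  simp only [repGauss]
  exact ⟨by exact_mod_cast h.1, by exact_mod_cast h.2.1.pos, by simpa using h.2.1⟩

theorem repGauss_ne_zero {n : ℕ} {q : ℕ × ℕ} (hq : q ∈ reps n) : repGauss q ≠ 0 := by
  intro h
  have := (repGauss_pos hq).1
  rw [h] at this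
  simp at this

theorem exists_assemble_eq (m k : ℕ) (hk : k + 1 = 2 ^ m) :
    ∃ ε : Fin (m + 1) → Fin (k + 1) → Bool, ∀ ξ : Fin (m + 1) → GaussianInt, (∀ i, ξ i ≠ 0) →
      (∀ i, nrm (ξ i) = nrm (ξ 0)) → ∃ (a : Fin (k + 1) → GaussianInt)
        (u : Fin (m + 1) → GaussianInt), (∀ i, nrm (u i) = 1) ∧ assemble ε u a = ξ := by
  obtain ⟨ι, _, hcard, ε, hε⟩ := exists_simultaneous_factorization m
  let e : ι ≃ Fin (k + 1) := Fintype.equivFinOfCardEq (hcard.trans hk.symm)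
  refine ⟨fun i j => ε i (e.symm j), fun ξ hξ0 hξ => ?_⟩
  obtain ⟨α, u, h⟩ := hε (fun i => ξ (Fin.ofNat (m + 1) i)) (fun i _ => hξ0 _) (fun i _ =>
    (hξ _).trans (hξ _).symm)
  refine ⟨fun j => α (e.symm j), fun i => u i, fun i => (h i (by omega)).1, ?_⟩
  funext i
  have h1 := (h i (by omega)).2
  simp only [Fin.ofNat_eq_cast, Fin.cast_val_eq_self] at h1
  unfold assemble
  rw [h1]
  congr 1
  exact (Equiv.prod_comp e.symm fun t => conjIf (ε i t) (α t))

theorem nrm_assemble {ℓ k : ℕ} (ε : Fin ℓ → Fin k → Bool) {u : Fin ℓ → GaussianInt}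
    (hu : ∀ i, nrm (u i) = 1) (a : Fin k → GaussianInt) (i : Fin ℓ) :
    nrm (assemble ε u a i) = ∏ j, nrm (a j) := by
  unfold assemble
  rw [nrm_mul, hu, one_mul, nrm_prod]
  exact Finset.prod_congr rfl fun j _ => nrm_conjIf _ _

theorem sum_le_sum_of_injection {ι κ : Type*} {s : Finset ι} {t : Finset κ} {f : ι → ℝ} {g : κ → ℝ}
    (Φ : ι → κ) (hΦ : ∀ i ∈ s, Φ i ∈ t) (hinj : Set.InjOn Φ s) (hfg : ∀ i ∈ s, f i = g (Φ i))
    (hg : ∀ j ∈ t, 0 ≤ g j) : ∑ i ∈ s, f i ≤ ∑ j ∈ t, g j := by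
  classical
  calc ∑ i ∈ s, f i = ∑ i ∈ s, g (Φ i) := Finset.sum_congr rfl hfg
    _ = ∑ j ∈ s.image Φ, g j := (Finset.sum_image hinj).symm
    _ ≤ _ := Finset.sum_le_sum_of_subset_of_nonneg (fun j hj => by
        obtain ⟨i, hi, rfl⟩ := Finset.mem_image.1 hj
        exact hΦ i hi) fun j hj _ => hg j hj

/-- Passing from sets to ordered tuples discards a factor `ℓ!`, harmless for an upper bound. -/
theorem choose_le_card_embedding (n ℓ : ℕ) :
    (r1 n).choose ℓ ≤ Fintype.card (Fin ℓ ↪ {q // q ∈ reps n}) := by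
  rw [Fintype.card_embedding_eq, Fintype.card_fin, Fintype.card_coe,
    Nat.descFactorial_eq_factorial_mul_choose]
  exact Nat.le_mul_of_pos_left _ (Nat.factorial_pos _)

open Classical in
/-- The weighted sum over `ℓ`-sets of representations is bounded by sums over tuples of factors. -/
theorem exists_sum_choose_le_tupleSum {z : ℝ} (hz0 : 0 < z) (m k : ℕ) (hk : k + 1 = 2 ^ m) :
    ∃ ε : Fin (m + 1) → Fin (k + 1) → Bool, ∀ X : ℕ,
      ∑ n ∈ Finset.Icc 1 X, ((r1 n).choose (m + 1) : ℝ) * z ^ omegaStar n ≤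
        ∑ u ∈ Fintype.piFinset (fun _ : Fin (m + 1) => gaussBall 1), tupleSum z ε u X := by
  obtain ⟨ε, hε⟩ := exists_assemble_eq m k hk
  refine ⟨ε, fun X => ?_⟩
  have hdata : ∀ σ : (Σ n : ℕ, Fin (m + 1) ↪ {q // q ∈ reps n}),
      ∃ p : (Fin (m + 1) → GaussianInt) × (Fin (k + 1) → GaussianInt), (∀ i, nrm (p.1 i) = 1) ∧
        assemble ε p.1 p.2 = fun i => repGauss (σ.2 i).1 := by
    intro σ
    obtain ⟨a, u, hu, ha⟩ := hε (fun i => repGauss (σ.2 i).1)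
      (fun i => repGauss_ne_zero (σ.2 i).2)
      (fun i => by rw [nrm_repGauss (σ.2 i).2, nrm_repGauss (σ.2 0).2])
    exact ⟨(u, a), hu, ha⟩
  choose Φ hΦu hΦ using hdata
  have hprod : ∀ σ, ∏ j, nrm ((Φ σ).2 j) = σ.1 := by
    intro σ
    rw [← nrm_assemble ε (hΦu σ) (Φ σ).2 0, hΦ, nrm_repGauss (σ.2 0).2]
  set W : (Fin (m + 1) → GaussianInt) × (Fin (k + 1) → GaussianInt) → ℝ := fun p =>
    if ∏ i, nrm (p.2 i) ≤ X ∧ Valid (assemble ε p.1 p.2) then oddWeight z 1 (∏ i, nrm (p.2 i))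
      else 0 with hW
  have hvalid : ∀ σ, Valid (assemble ε (Φ σ).1 (Φ σ).2) := by
    intro σ
    rw [hΦ]
    exact ⟨fun i => repGauss_pos (σ.2 i).2, fun i i' h =>
      σ.2.injective (Subtype.ext (repGauss_injective h))⟩
  calc ∑ n ∈ Finset.Icc 1 X, ((r1 n).choose (m + 1) : ℝ) * z ^ omegaStar n
      ≤ ∑ n ∈ Finset.Icc 1 X, ∑ _f : Fin (m + 1) ↪ {q // q ∈ reps n}, z ^ omegaStar n := by
        refine Finset.sum_le_sum fun n _ => ?_
        rw [Finset.sum_const, Finset.card_univ, nsmul_eq_mul]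
        gcongr
        exact choose_le_card_embedding n (m + 1)
    _ = ∑ σ ∈ (Finset.Icc 1 X).sigma (fun n => (Finset.univ :
          Finset (Fin (m + 1) ↪ {q // q ∈ reps n}))), z ^ omegaStar σ.1 := by
        rw [Finset.sum_sigma]
    _ ≤ ∑ p ∈ Fintype.piFinset (fun _ : Fin (m + 1) => gaussBall 1) ×ˢ
          Fintype.piFinset (fun _ : Fin (k + 1) => gaussBall X), W p := by
        -- The map to units and factors is injective: the product of the norms returns `n`, and
        -- assembling returns the representations.
        refine sum_le_sum_of_injection Φ ?_ ?_ ?_ ?_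
        · intro σ hσ
          rw [Finset.mem_sigma, Finset.mem_Icc] at hσ
          rw [Finset.mem_product, Fintype.mem_piFinset, Fintype.mem_piFinset]
          refine ⟨fun i => mem_gaussBall.2 (by rw [hΦu]; simp), fun j => mem_gaussBall.2 ?_⟩
          have hd : nrm ((Φ σ).2 j) ∣ σ.1 := by
            rw [← hprod σ]; exact Finset.dvd_prod_of_mem _ (Finset.mem_univ j)
          exact ⟨Nat.pos_of_dvd_of_pos hd hσ.1.1, (Nat.le_of_dvd hσ.1.1 hd).trans hσ.1.2⟩
        · intro σ _ σ' _ h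
          have h1 : σ.1 = σ'.1 := by rw [← hprod σ, ← hprod σ', h]
          have h2 : (fun i => repGauss (σ.2 i).1) = fun i => repGauss (σ'.2 i).1 := by
            rw [← hΦ σ, ← hΦ σ', h]
          obtain ⟨n, f⟩ := σ
          obtain ⟨n', f'⟩ := σ'
          obtain rfl : n = n' := h1
          congr 1
          ext1 i
          exact Subtype.ext (repGauss_injective (congrFun h2 i))
        · intro σ hσ
          rw [Finset.mem_sigma, Finset.mem_Icc] at hσ
          simp only [hW]
          rw [if_pos ⟨by rw [hprod]; exact hσ.1.2, hvalid σ⟩, hprod, oddWeight_one]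
        · intro p _
          simp only [hW]
          split_ifs
          · exact oddWeight_nonneg hz0 _ _
          · exact le_rfl
    _ = _ := by
        rw [Finset.sum_product]
        rfl

open Classical in
/-- The second weighted sum: divisors of a single representation. -/
theorem sum_r1_mul_le_tupleSum {z : ℝ} (hz0 : 0 < z) (X : ℕ) :
    ∑ n ∈ Finset.Icc 1 X, (r1 n : ℝ) * (2 * z) ^ omegaStar n ≤
      tupleSum z (fun (_ : Fin 1) (_ : Fin 2) => true) (fun _ => 1) X := by
  set W : (Fin 2 → GaussianInt) → ℝ := fun a =>
    if ∏ i, nrm (a i) ≤ X ∧ Valid (assemble (fun (_ : Fin 1) (_ : Fin 2) => true) (fun _ => 1) a)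
      then oddWeight z 1 (∏ i, nrm (a i)) else 0 with hW
  have hassemble : ∀ a : Fin 2 → GaussianInt,
      assemble (fun (_ : Fin 1) (_ : Fin 2) => true) (fun _ => 1) a = fun _ => a 0 * a 1 := by
    intro a; funext i; simp [assemble, conjIf]
  have hdiv : ∀ (ξ α : GaussianInt), ∃ β, α ∣ ξ → ξ = α * β := by
    intro ξ α
    by_cases h : α ∣ ξ
    · obtain ⟨β, hβ⟩ := h; exact ⟨β, fun _ => hβ⟩
    · exact ⟨0, fun h' => absurd h' h⟩
  choose D hD using hdiv
  calc ∑ n ∈ Finset.Icc 1 X, (r1 n : ℝ) * (2 * z) ^ omegaStar n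
      ≤ ∑ n ∈ Finset.Icc 1 X, ∑ q ∈ reps n, ∑ _α ∈ (gaussBall X).filter (fun α => α ∣ repGauss q),
          z ^ omegaStar n := by
        refine Finset.sum_le_sum fun n hn => ?_
        rw [Finset.mem_Icc] at hn
        rw [r1, ← nsmul_eq_mul, ← Finset.sum_const]
        refine Finset.sum_le_sum fun q hq => ?_
        rw [Finset.sum_const, nsmul_eq_mul, mul_pow]
        gcongr
        have h := two_pow_omegaStar_le (ξ := repGauss q) (s := gaussBall X) (fun α hα => by
          obtain ⟨β, hβ⟩ := hα
          have h1 := nrm_repGauss hq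
          rw [hβ, nrm_mul] at h1
          have hd : nrm α ∣ n := ⟨_, h1.symm⟩
          exact mem_gaussBall.2 ⟨Nat.pos_of_dvd_of_pos hd hn.1, (Nat.le_of_dvd hn.1 hd).trans hn.2⟩)
        rw [nrm_repGauss hq] at h
        exact_mod_cast h
    _ = ∑ σ ∈ (Finset.Icc 1 X).sigma (fun n => (reps n).sigma fun q =>
          (gaussBall X).filter (fun α => α ∣ repGauss q)), z ^ omegaStar σ.1 := by
        rw [Finset.sum_sigma]
        exact Finset.sum_congr rfl fun n _ => by rw [Finset.sum_sigma]
    _ ≤ ∑ a ∈ Fintype.piFinset (fun _ : Fin 2 => gaussBall X), W a := by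
        have hmem : ∀ σ ∈ (Finset.Icc 1 X).sigma (fun n => (reps n).sigma fun q =>
            (gaussBall X).filter (fun α => α ∣ repGauss q)), (1 ≤ σ.1 ∧ σ.1 ≤ X) ∧
            σ.2.1 ∈ reps σ.1 ∧ repGauss σ.2.1 = σ.2.2 * D (repGauss σ.2.1) σ.2.2 := by
          intro σ hσ
          rw [Finset.mem_sigma, Finset.mem_Icc, Finset.mem_sigma, Finset.mem_filter] at hσ
          exact ⟨hσ.1, hσ.2.1, hD _ _ hσ.2.2.2⟩
        have hprod : ∀ σ ∈ (Finset.Icc 1 X).sigma (fun n => (reps n).sigma fun q =>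
            (gaussBall X).filter (fun α => α ∣ repGauss q)),
            nrm σ.2.2 * nrm (D (repGauss σ.2.1) σ.2.2) = σ.1 := by
          intro σ hσ
          obtain ⟨_, h2, h3⟩ := hmem σ hσ
          rw [← nrm_mul, ← h3, nrm_repGauss h2]
        -- A divisor `α` of `ξ` is sent to the pair `(α, ξ / α)`. The product of the pair returns
        -- `ξ`, hence the representation, and its norm returns `n`.
        refine sum_le_sum_of_injection
          (fun σ => ![σ.2.2, D (repGauss σ.2.1) σ.2.2]) ?_ ?_ ?_ ?_
        · intro σ hσ
          have h1 := hprod σ hσ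
          have h2 := (hmem σ hσ).1
          have hd1 : nrm σ.2.2 ∣ σ.1 := ⟨_, h1.symm⟩
          have hd2 : nrm (D (repGauss σ.2.1) σ.2.2) ∣ σ.1 := ⟨nrm σ.2.2, by rw [mul_comm]; exact h1.symm⟩
          rw [Fintype.mem_piFinset]
          intro j
          fin_cases j
          · exact mem_gaussBall.2 ⟨Nat.pos_of_dvd_of_pos hd1 h2.1,
              (Nat.le_of_dvd h2.1 hd1).trans h2.2⟩
          · exact mem_gaussBall.2 ⟨Nat.pos_of_dvd_of_pos hd2 h2.1,
              (Nat.le_of_dvd h2.1 hd2).trans h2.2⟩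
        · intro σ hσ σ' hσ' h
          rw [Finset.mem_coe] at hσ hσ'
          have e0 : σ.2.2 = σ'.2.2 := by simpa using congrFun h 0
          have e1 : D (repGauss σ.2.1) σ.2.2 = D (repGauss σ'.2.1) σ'.2.2 := by
            simpa using congrFun h 1
          have e2 : σ.2.1 = σ'.2.1 := by
            apply repGauss_injective
            rw [(hmem σ hσ).2.2, (hmem σ' hσ').2.2, e0, ← e1, e0]
          have e3 : σ.1 = σ'.1 := by rw [← hprod σ hσ, ← hprod σ' hσ', e0, ← e1, e0]
          obtain ⟨n, q, α⟩ := σ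
          obtain ⟨n', q', α'⟩ := σ'
          simp only at e0 e2 e3
          subst e0 e2 e3
          rfl
        · intro σ hσ
          obtain ⟨h1, h2, h3⟩ := hmem σ hσ
          have h4 := hprod σ hσ
          have hP : ∏ i, nrm (![σ.2.2, D (repGauss σ.2.1) σ.2.2] i) = σ.1 := by
            simpa [Fin.prod_univ_two] using h4
          have hV : Valid (assemble (fun (_ : Fin 1) (_ : Fin 2) => true) (fun _ => 1)
              ![σ.2.2, D (repGauss σ.2.1) σ.2.2]) := by
            have h5 : assemble (fun (_ : Fin 1) (_ : Fin 2) => true) (fun _ => 1)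
                ![σ.2.2, D (repGauss σ.2.1) σ.2.2] = fun _ => repGauss σ.2.1 :=
              (hassemble _).trans (funext fun _ => h3.symm)
            rw [h5]
            exact ⟨fun _ => repGauss_pos h2, Function.injective_of_subsingleton _⟩
          simp only [hW]
          rw [if_pos ⟨hP.le.trans h1.2, hV⟩, hP, oddWeight_one]
        · intro a _
          simp only [hW]
          split_ifs
          · exact oddWeight_nonneg hz0 _ _
          · exact le_rfl
    _ = _ := rfl

/-! ### The two bounds -/

/-- Converts the Rankin factor, an exponential in `log log x`, into a power of `log x`. -/
theorem rpow_mul_L {z x : ℝ} (hz : 0 < z) (hx : 16 ≤ x) (t : ℝ) :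
    z ^ (t * L x) = Real.log x ^ (t * Real.log z) := by
  have h0 : 0 < Real.log x := (Real.exp_pos 1).trans_le (one_le_log_of_sixteen_le hx)
  rw [Real.rpow_def_of_pos hz, Real.rpow_def_of_pos h0, L]
  congr 1
  ring

theorem log_two_bounds : (1 / 2 : ℝ) < Real.log 2 ∧ Real.log 2 < 1 :=
  ⟨by linarith [Real.log_two_gt_d9], by linarith [Real.log_two_lt_d9]⟩

/-- Rankin's trick for large values of `ω*`. -/
theorem exists_sum_r1_le : ∃ A C : ℝ, ∀ x : ℝ, 16 ≤ x →
    ∑ n ∈ (Finset.Icc 1 ⌊x⌋₊).filter (fun n => K x ≤ (omegaStar n : ℤ)), (r1 n : ℝ)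
      ≤ C * (x * L x ^ A / Real.log x ^ (1 + delta)) := by
  obtain ⟨hlo, hhi⟩ := log_two_bounds
  have h2 : 0 < Real.log 2 := by linarith
  -- The exponent to minimise is `2 z - log (2 z) / log 2`, whose minimum is at `2 z = 1 / log 2`.
  have hz0 : 0 < 1 / (2 * Real.log 2) := by positivity
  have hz1 : 1 / (2 * Real.log 2) < 1 := by
    rw [div_lt_one (by positivity)]; linarith
  set c : ℝ := 1 / Real.log 2 with hc
  have hc1 : 1 ≤ c := by rw [hc, le_div_iff₀ h2]; linarith
  have hc0 : 0 < c := by linarith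
  have h2z : 2 * (1 / (2 * Real.log 2)) = c := by rw [hc]; field_simp
  obtain ⟨A, C, hC, h⟩ := exists_tupleSum_le hz0 hz1 1 1
  refine ⟨A, c * C, fun x hx => ?_⟩
  have hlx : 0 < Real.log x := (Real.exp_pos 1).trans_le (one_le_log_of_sixteen_le hx)
  -- The summand `1` in the exponent pays for the floor: `K > L / log 2 - 1`, so `c ^ ω*` times this
  -- factor is at least `1` when `ω* ≥ K`.
  have hw : c ^ (1 + -1 / Real.log 2 * L x) =
      c * Real.log x ^ (Real.log (Real.log 2) / Real.log 2) := by
    rw [Real.rpow_add hc0, Real.rpow_one, rpow_mul_L hc0 hx]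
    congr 2
    rw [hc, one_div, Real.log_inv]
    ring
  set w : ℝ := c ^ (1 + -1 / Real.log 2 * L x) with hw'
  have hw0 : 0 < w := Real.rpow_pos_of_pos hc0 _
  calc ∑ n ∈ (Finset.Icc 1 ⌊x⌋₊).filter (fun n => K x ≤ (omegaStar n : ℤ)), (r1 n : ℝ)
      ≤ ∑ n ∈ (Finset.Icc 1 ⌊x⌋₊).filter (fun n => K x ≤ (omegaStar n : ℤ)),
          w * ((r1 n : ℝ) * c ^ omegaStar n) := by
        refine Finset.sum_le_sum fun n hn => ?_
        have hK : ((K x : ℤ) : ℝ) ≤ (omegaStar n : ℝ) := by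
          exact_mod_cast (Finset.mem_filter.1 hn).2
        have hfl : L x / Real.log 2 < (K x : ℝ) + 1 := Int.lt_floor_add_one _
        have h1 : 1 ≤ w * c ^ omegaStar n := by
          rw [hw', ← Real.rpow_natCast c, ← Real.rpow_add hc0]
          refine Real.one_le_rpow hc1 ?_
          have : -1 / Real.log 2 * L x = -(L x / Real.log 2) := by ring
          linarith
        calc (r1 n : ℝ) = r1 n * 1 := (mul_one _).symm
          _ ≤ r1 n * (w * c ^ omegaStar n) := by gcongr
          _ = _ := by ring
    _ ≤ ∑ n ∈ Finset.Icc 1 ⌊x⌋₊, w * ((r1 n : ℝ) * c ^ omegaStar n) :=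
        Finset.sum_le_sum_of_subset_of_nonneg (Finset.filter_subset _ _)
          fun n _ _ => by positivity
    _ = w * ∑ n ∈ Finset.Icc 1 ⌊x⌋₊, (r1 n : ℝ) * c ^ omegaStar n := by rw [Finset.mul_sum]
    _ ≤ w * (C * (x * (L x ^ A * Real.log x ^
          (((1 : ℕ) + 1 : ℝ) * (1 / (2 * Real.log 2)) - (1 : ℕ) - 1)))) := by
        gcongr
        have h3 := sum_r1_mul_le_tupleSum hz0 ⌊x⌋₊
        rw [h2z] at h3
        exact h3.trans (h x hx _ _ fun i => by simp [nrm])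
    _ = c * C * (x * L x ^ (A : ℝ) / Real.log x ^ (1 + delta)) := by
        have e : ((1 : ℕ) + 1 : ℝ) * (1 / (2 * Real.log 2)) - (1 : ℕ) - 1 =
            -(1 + delta) - Real.log (Real.log 2) / Real.log 2 := by
          unfold delta; push_cast; field_simp; ring
        rw [hw, e, Real.rpow_sub hlx, Real.rpow_neg hlx.le, Real.rpow_natCast]
        have : Real.log x ^ (Real.log (Real.log 2) / Real.log 2) ≠ 0 :=
          (Real.rpow_pos_of_pos hlx _).ne'
        field_simp

/-- Rankin's trick for small values of `ω*`. -/
theorem exists_sum_choose_le (m : ℕ) (hm : 1 ≤ m) : ∃ A C : ℝ, ∀ x : ℝ, 16 ≤ x → ∀ τ : ℕ,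
    ∑ n ∈ (Finset.Icc 1 ⌊x⌋₊).filter (fun n => (omegaStar n : ℤ) ≤ K x - (τ : ℤ)),
        ((r1 n).choose (m + 1) : ℝ)
      ≤ C * (x * L x ^ A / Real.log x ^ (1 + delta)) * (1 / ((2 : ℝ) ^ m * Real.log 2) ^ τ) := by
  obtain ⟨hlo, hhi⟩ := log_two_bounds
  have h2 : 0 < Real.log 2 := by linarith
  have h2m : (2 : ℝ) ≤ 2 ^ m := by
    simpa using pow_le_pow_right₀ (one_le_two (α := ℝ)) hm
  -- This minimises `2 ^ m z - log z / log 2`; it is below `1` because `m ≥ 1` and `log 2 > 1/2`.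
  set z : ℝ := 1 / (2 ^ m * Real.log 2) with hz
  have hz0 : 0 < z := by positivity
  have hz1 : z < 1 := by
    rw [hz, div_lt_one (by positivity)]; nlinarith
  obtain ⟨k, hk⟩ : ∃ k, k + 1 = 2 ^ m := ⟨2 ^ m - 1, Nat.sub_add_cancel Nat.one_le_two_pow⟩
  have hkR : ((k : ℝ) + 1) = 2 ^ m := by exact_mod_cast hk
  obtain ⟨A, C, hC, h⟩ := exists_tupleSum_le hz0 hz1 (m + 1) k
  obtain ⟨ε, hε⟩ := exists_sum_choose_le_tupleSum hz0 m k hk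
  set U := Fintype.piFinset (fun _ : Fin (m + 1) => gaussBall 1) with hU
  refine ⟨A, U.card * C, fun x hx τ => ?_⟩
  have hlx : 0 < Real.log x := (Real.exp_pos 1).trans_le (one_le_log_of_sixteen_le hx)
  -- Since `z < 1` and `ω* ≤ K - τ ≤ L / log 2 - τ`, multiplying `z ^ ω*` by this factor and by `z ^
  -- τ` gives at least `1`. The floor goes in the favourable direction, and `z ^ τ` is the claimed
  -- decay in `τ`.
  have hw : z ^ (-1 / Real.log 2 * L x) =
      Real.log x ^ (m + Real.log (Real.log 2) / Real.log 2) := by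
    rw [rpow_mul_L hz0 hx]
    congr 1
    rw [hz, one_div, Real.log_inv, Real.log_mul (by positivity) h2.ne', Real.log_pow]
    field_simp
  set w : ℝ := z ^ (-1 / Real.log 2 * L x) with hw'
  have hw0 : 0 < w := Real.rpow_pos_of_pos hz0 _
  calc ∑ n ∈ (Finset.Icc 1 ⌊x⌋₊).filter (fun n => (omegaStar n : ℤ) ≤ K x - (τ : ℤ)),
          ((r1 n).choose (m + 1) : ℝ)
      ≤ ∑ n ∈ (Finset.Icc 1 ⌊x⌋₊).filter (fun n => (omegaStar n : ℤ) ≤ K x - (τ : ℤ)),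
          w * z ^ τ * (((r1 n).choose (m + 1) : ℝ) * z ^ omegaStar n) := by
        refine Finset.sum_le_sum fun n hn => ?_
        have hK : (omegaStar n : ℝ) ≤ K x - τ := by
          exact_mod_cast (Finset.mem_filter.1 hn).2
        have hfl : (K x : ℝ) ≤ L x / Real.log 2 := Int.floor_le _
        have h1 : 1 ≤ w * z ^ τ * z ^ omegaStar n := by
          rw [hw', ← Real.rpow_natCast z, ← Real.rpow_natCast z, ← Real.rpow_add hz0,
            ← Real.rpow_add hz0]
          refine Real.one_le_rpow_of_pos_of_le_one_of_nonpos hz0 hz1.le ?_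
          have : -1 / Real.log 2 * L x = -(L x / Real.log 2) := by ring
          linarith
        calc ((r1 n).choose (m + 1) : ℝ) = (r1 n).choose (m + 1) * 1 := (mul_one _).symm
          _ ≤ (r1 n).choose (m + 1) * (w * z ^ τ * z ^ omegaStar n) := by gcongr
          _ = _ := by ring
    _ ≤ ∑ n ∈ Finset.Icc 1 ⌊x⌋₊, w * z ^ τ * (((r1 n).choose (m + 1) : ℝ) * z ^ omegaStar n) :=
        Finset.sum_le_sum_of_subset_of_nonneg (Finset.filter_subset _ _)
          fun n _ _ => by positivity
    _ = w * z ^ τ * ∑ n ∈ Finset.Icc 1 ⌊x⌋₊, ((r1 n).choose (m + 1) : ℝ) * z ^ omegaStar n := by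
        rw [Finset.mul_sum]
    _ ≤ w * z ^ τ * ∑ _u ∈ U, C * (x * (L x ^ A * Real.log x ^
          (((k : ℝ) + 1) * z - (m + 1 : ℕ) - 1))) := by
        gcongr
        refine (hε _).trans (Finset.sum_le_sum fun u hu => h x hx ε u fun i => ?_)
        have h3 := mem_gaussBall.1 (Fintype.mem_piFinset.1 hu i)
        omega
    _ = U.card * C * (x * L x ^ (A : ℝ) / Real.log x ^ (1 + delta)) *
          (1 / ((2 : ℝ) ^ m * Real.log 2) ^ τ) := by
        -- Here `(k + 1) z = 1 / log 2`; the `m` extra logarithms saved by the additional prime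
        -- forms exactly offset the power `m` in the Rankin factor, so `1 + δ` is independent of
        -- `ℓ`.
        have e : ((k : ℝ) + 1) * z - (m + 1 : ℕ) - 1 =
            -(1 + delta) - (m + Real.log (Real.log 2) / Real.log 2) := by
          rw [hkR, hz]; unfold delta; push_cast; field_simp; ring
        rw [Finset.sum_const, nsmul_eq_mul, hw, e, Real.rpow_sub hlx, Real.rpow_neg hlx.le,
          Real.rpow_natCast, ← one_div_pow, ← hz]
        have : Real.log x ^ ((m : ℝ) + Real.log (Real.log 2) / Real.log 2) ≠ 0 :=
          (Real.rpow_pos_of_pos hlx _).ne'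
        field_simp

end SquarePlusPrimeSquare

open SquarePlusPrimeSquare in
theorem mainTheorem7 :
    (∃ A C : ℝ, ∀ x : ℝ, 16 ≤ x →
      ∑ n ∈ (Finset.Icc 1 ⌊x⌋₊).filter (fun n => K x ≤ (omegaStar n : ℤ)), (r1 n : ℝ)
        ≤ C * (x * L x ^ A / Real.log x ^ (1 + delta))) ∧
    (∀ ℓ : ℕ, 2 ≤ ℓ → ∃ A C : ℝ, ∀ B : ℝ, 0 < B → ∀ x : ℝ, 16 ≤ x →
      ∀ τ : ℕ, (τ : ℝ) ≤ B * L x →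
        ∑ n ∈ (Finset.Icc 1 ⌊x⌋₊).filter (fun n => (omegaStar n : ℤ) ≤ K x - (τ : ℤ)),
            ((r1 n).choose ℓ : ℝ)
          ≤ C * (x * L x ^ A / Real.log x ^ (1 + delta))
              * (1 / ((2 : ℝ) ^ (ℓ - 1) * Real.log 2) ^ τ)) := by
  refine ⟨exists_sum_r1_le, fun ℓ hℓ => ?_⟩
  obtain ⟨m, rfl⟩ : ∃ m, ℓ = m + 1 := ⟨ℓ - 1, by omega⟩
  obtain ⟨A, C, h⟩ := exists_sum_choose_le m (by omega)
  exact ⟨A, C, fun _ _ x hx τ _ => h x hx τ⟩
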